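/- **Theorem 3.1.** For $M\in\mathbb{R}^{p\times q}$ put $\mathbb{R}_+^p\cdot M=\{y^TM : y\in\mathbb{R}^p,\ y\ge 0\}$, $\mathbb{R}^p\cdot M=\{y^TM : y\in\mathbb{R}^p\}$, and similarly $M\cdot\mathbb{R}_+^q$ and $M\cdot\mathbb{R}^q$. A nonnegative matrix $M\in\mathbb{R}_+^{p\times q}$ satisfies the *row cone generating condition* (RCGC) if $\mathbb{R}_+^p\cdot M=(\mathbb{R}^p\cdot M)\cap\mathbb{R}_+^q$, and the *column cone generating condition* (CCGC) if $M\cdot\mathbb{R}_+^q=(M\cdot\mathbb{R}^q)\cap\mathbb{R}_+^p$. $M\in\mathbb{R}^{p\times q}$ is a *slack matrix of a polyhedral cone* if $M=AB$ for some $n$, $A\in\mathbb{R}^{p\times n}$ and $B\in\mathbb{R}^{n\times q}$ with $\mathbb{R}_+^p\cdot A=\{x\in\mathbb{R}^n : x^TB\ge 0\}$. It is a *slack matrix of a polytope* if there are $n$, $V\in\mathbb{R}^{p\times n}$, $W\in\mathbb{R}^{q\times n}$ and $w\in\mathbb{R}^q$ such that the convex hull $P$ of the rows $v_1,\dots,v_p$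 of $V$ equals $\{x\in\mathbb{R}^n : Wx\le w\}$, $\dim P\ge 1$, and $M_{ij}=w_j-(Wv_i)_j$ for all $i,j$. Let rational matrices be encoded as strings over a finite alphabet, each entry being written as a fraction of an integer and a positive integer in binary notation. Then each of the following decision problems for a rational matrix $M$, regarded as the language of all encodings of the matrices for which the answer is yes, belongs to coNP (its complement in the set of all strings has polynomial-length certificates that are verified by a deterministic Turing machine in polynomial time): 1. Is $M$ nonnegative and does it satisfy the RCGC? 2. Is $M$ nonnegative and does it satisfy the CCGC? 3. Is $M$ a slack matrix of some polyhedral cone? 4. Is $M$ a slack matrix of some polytope? -/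

import Mathlib

namespace SlackCoNP

open Matrix

/-! ### The classes NP and coNP

A decision problem is a language over a finite alphabet. Polynomial time is Mathlib's
`Turing.TM2ComputableInPolyTime`: a multi-stack Turing machine together with a polynomial bound,
in the length of the input, on the number of its steps. -/

section Complexity

/-- `L` is in NP: there are a polynomial `p` and a polynomial-time verifier `V` such that a string
`x` belongs to `L` if and only if `V` accepts `(x, y)` for some certificate `y` of length at
most `p(|x|)`. Certificates are strings over some finite alphabet `Δ` (which may be chosen freely,
as any finite alphabet can be block-coded in binary); the pair `(x, y)` is written on the input
stack as a string over the disjoint union of the two alphabets. -/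
def InNP {Γ : Type} (L : Language Γ) : Prop :=
  ∃ (Δ : Type) (_ : Fintype Δ) (p : Polynomial ℕ) (V : List Γ × List Δ → Bool),
    Nonempty (Turing.TM2ComputableInPolyTime
      (Computability.encodingProd (Computability.encodingList Γ)
        (Computability.encodingList Δ)).encode
      Computability.encodeBool V) ∧
    ∀ x : List Γ, x ∈ L ↔ ∃ y : List Δ, y.length ≤ p.eval x.length ∧ V (x, y) = true

/-- `L` is in coNP: its complement, in the set of all strings, is in NP. -/
def InCoNP {Γ : Type} (L : Language Γ) : Prop :=
  InNP (Γ := Γ) {x | x ∉ L}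

end Complexity

/-! ### Rational matrices as inputs -/

section Encoding

/-- The input alphabet: two binary digits and four auxiliary symbols. -/
inductive Symbol where
  | bit (b : Bool)
  | minus
  | slash
  | comma
  | semicolon
  deriving DecidableEq, Fintype

/-- A `p × q` rational matrix given by fractions with integer numerators and positive integer
denominators (not necessarily in lowest terms). -/
structure FractionMatrix (p q : ℕ) where
  num : Fin p → Fin q → ℤ
  den : Fin p → Fin q → ℕ
  den_pos : ∀ i j, 0 < den i j

/-- The rational matrix given by a matrix of fractions, regarded as a real matrix. -/
noncomputable def FractionMatrix.toReal {p q : ℕ} (F : FractionMatrix p q) :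
    Matrix (Fin p) (Fin q) ℝ :=
  Matrix.of fun i j => (F.num i j : ℝ) / (F.den i j : ℝ)

/-- Binary notation of a natural number (least significant digit first, no superfluous zeros,
`0` is the empty word). -/
def encodeNat (n : ℕ) : List Symbol :=
  (Computability.encodeNat n).map Symbol.bit

/-- An integer: a minus sign if it is negative, then its absolute value in binary. -/
def encodeInt (z : ℤ) : List Symbol :=
  (if z < 0 then [Symbol.minus] else []) ++ encodeNat z.natAbs

/-- The string that encodes a matrix: the number `q` of columns in unary and a semicolon, then the
rows from top to bottom. A row is the sequence of its entries, each entry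
`numerator / denominator` being followed by a comma, and each row is followed by a semicolon. -/
def FractionMatrix.encode {p q : ℕ} (F : FractionMatrix p q) : List Symbol :=
  List.replicate q (Symbol.bit true) ++ [Symbol.semicolon] ++
    (List.ofFn fun i : Fin p =>
      (List.ofFn fun j : Fin q =>
        encodeInt (F.num i j) ++ [Symbol.slash] ++ encodeNat (F.den i j) ++
          [Symbol.comma]).flatten ++ [Symbol.semicolon]).flatten

/-- The decision problem, as a language, "does a given rational matrix have the property `P`?":
the set of all strings that encode a rational matrix with this property. -/
def matrixProblem (P : ∀ {p q : ℕ}, Matrix (Fin p) (Fin q) ℝ → Prop) : Language Symbol :=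
  {w | ∃ (p q : ℕ) (F : FractionMatrix p q), F.encode = w ∧ P F.toReal}

end Encoding

/-! ### The cone generating conditions and slack matrices -/

section Slack

variable {p q n : ℕ}

/-- All entries are nonnegative. -/
def IsNonneg (M : Matrix (Fin p) (Fin q) ℝ) : Prop :=
  ∀ i j, 0 ≤ M i j

/-- Row cone generating condition `ℝ₊ᵖ · M = ℝᵖ · M ∩ ℝ₊^q`. -/
def RCGC (M : Matrix (Fin p) (Fin q) ℝ) : Prop :=
  {x : Fin q → ℝ | ∃ y : Fin p → ℝ, (∀ i, 0 ≤ y i) ∧ y ᵥ* M = x} =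
    {x : Fin q → ℝ | ∃ y : Fin p → ℝ, y ᵥ* M = x} ∩ {x | ∀ j, 0 ≤ x j}

/-- Column cone generating condition `M · ℝ₊^q = M · ℝ^q ∩ ℝ₊ᵖ`. -/
def CCGC (M : Matrix (Fin p) (Fin q) ℝ) : Prop :=
  {x : Fin p → ℝ | ∃ y : Fin q → ℝ, (∀ j, 0 ≤ y j) ∧ M *ᵥ y = x} =
    {x : Fin p → ℝ | ∃ y : Fin q → ℝ, M *ᵥ y = x} ∩ {x | ∀ i, 0 ≤ x i}

/-- `(A, B)` represents the polyhedral cone `K`: the rows of `A` generate `K`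
and the columns of `B` give linear inequalities describing `K`. -/
def IsConeRepresentation (K : Set (Fin n → ℝ)) (A : Matrix (Fin p) (Fin n) ℝ)
    (B : Matrix (Fin n) (Fin q) ℝ) : Prop :=
  K = {x | ∃ y : Fin p → ℝ, (∀ i, 0 ≤ y i) ∧ y ᵥ* A = x} ∧
    K = {x | ∀ j, 0 ≤ (x ᵥ* B) j}

/-- `M` is a slack matrix of some polyhedral cone. -/
def IsConeSlackMatrix (M : Matrix (Fin p) (Fin q) ℝ) : Prop :=
  ∃ (n : ℕ) (K : Set (Fin n → ℝ)) (A : Matrix (Fin p) (Fin n) ℝ) (B : Matrix (Fin n) (Fin q) ℝ),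
    IsConeRepresentation K A B ∧ M = A * B

/-- `(V, W, w)` represents the polytope `P`: it is the convex hull of the rows of `V` and the
solution set of `W x ≤ w`. -/
def IsPolytopeRepresentation (P : Set (Fin n → ℝ)) (V : Matrix (Fin p) (Fin n) ℝ)
    (W : Matrix (Fin q) (Fin n) ℝ) (w : Fin q → ℝ) : Prop :=
  P = convexHull ℝ (Set.range fun i => V i) ∧ P = {x | ∀ j, (W *ᵥ x) j ≤ w j}

/-- `M` is a slack matrix of some polytope of dimension at least one. The entry at `(i, j)` is the
slack of the `i`-th generating point in the `j`-th inequality. -/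
def IsPolytopeSlackMatrix (M : Matrix (Fin p) (Fin q) ℝ) : Prop :=
  ∃ (n : ℕ) (P : Set (Fin n → ℝ)) (V : Matrix (Fin p) (Fin n) ℝ)
    (W : Matrix (Fin q) (Fin n) ℝ) (w : Fin q → ℝ),
    IsPolytopeRepresentation P V W w ∧ 1 ≤ Module.finrank ℝ (vectorSpan ℝ P) ∧
      M = Matrix.of fun i j => w j - (W *ᵥ V i) j

end Slack

end SlackCoNP

/-!
The idea is that failure of the conditions has a small witness.

*Geometry.* For a nonnegative matrix `M` the row cone generating condition fails if and only if
some row combination `yᵀ M ≥ 0` is not a nonnegative combination of the rows, and by Farkas' lemma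
(`exists_nonneg_combination`) this means that there is a `z` with `M z ≥ 0` and `yᵀ M z < 0`. Such a
pair `(y, z)` is a separating pair (`Sep`). The notion is invariant under transposition, so both
cone generating conditions are equivalent. A matrix is a slack matrix of a cone if and only if it is
nonnegative and satisfies them (`isConeSlackMatrix_iff`): describe the row cone in coordinates on
the row space. For slack matrices of polytopes (`isPolytopeSlackMatrix_iff`) two more things are
needed: the all-ones vector is in the column space, that is, `yᵀ M = 0` implies `∑ i, y i = 0`, and
the rows are not all equal. The violation of each of the conditions is thus witnessed by a pair
`(y, z)`, by a vector `y`, or by the matrix itself.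

*Small witnesses.* After clearing denominators, `y` solves a linear system with integer
coefficients together with one strict inequality. A solution with minimal support is basic, and
Cramer's rule and the Leibniz formula bound its numerators by a number with polynomially many bits
(`exists_bounded_solution`). In a separating pair, first `y` is replaced for the given `z`, then `z`
for the new `y` (`exists_small_natSep`).

*Computation.* A verifier has to be a Turing machine. Binary trees (`SExp`) are coded on a stack, and
`PolyTime f` says that a structured program replaces the tree on top of a stack by its image under
`f`, in polynomial time and without touching anything else. This class is closed under composition,
case distinction and iteration over lists with polynomially bounded state (`PolyTime.fold`), which
suffices for parsing the input and for binary arithmetic. Structured programs are compiled to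
Mathlib's stack machines (`Cmd.Exec.steps`), whence `inNP_of_polyTime`. Strings that are not codes of
matrices, and codes with a minus sign, are accepted at once; otherwise the verifier checks a
witness.
-/

namespace SlackCoNP

open Turing Function

/-! ### Structured programs for stack machines -/

/-- Structured programs acting on a family of stacks with alphabets `Γ k`. Tests look only at the
top symbol of a stack (`none` if the stack is empty). -/
inductive Cmd {K : Type} (Γ : K → Type) : Type
  | push (k : K) (a : Γ k)
  | pop (k : K)
  | seq (c d : Cmd Γ)
  | ite (k : K) (p : Option (Γ k) → Bool) (c d : Cmd Γ)
  | loop (k : K) (p : Option (Γ k) → Bool) (c : Cmd Γ)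

namespace Cmd

variable {K : Type} {Γ : K → Type}

/-- The control points of a program, which serve as labels of the compiled machine. -/
def Lab : Cmd Γ → Type
  | push _ _ => Unit
  | pop _ => Unit
  | seq c d => c.Lab ⊕ d.Lab
  | ite _ _ c d => Option (c.Lab ⊕ d.Lab)
  | loop _ _ c => Option c.Lab

instance Lab.fintype : ∀ c : Cmd Γ, Fintype c.Lab
  | push _ _ => inferInstanceAs (Fintype Unit)
  | pop _ => inferInstanceAs (Fintype Unit)
  | seq c d =>
    have := Lab.fintype c
    have := Lab.fintype d
    inferInstanceAs (Fintype (c.Lab ⊕ d.Lab))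
  | ite _ _ c d =>
    have := Lab.fintype c
    have := Lab.fintype d
    inferInstanceAs (Fintype (Option (c.Lab ⊕ d.Lab)))
  | loop _ _ c =>
    have := Lab.fintype c
    inferInstanceAs (Fintype (Option c.Lab))

/-- The control point at which the execution of a program starts. -/
def start : (c : Cmd Γ) → c.Lab
  | push _ _ => ()
  | pop _ => ()
  | seq c _ => Sum.inl c.start
  | ite _ _ _ _ => none
  | loop _ _ _ => none

/-- Compilation of a program to machine statements: the labels of the program are placed into the
labels `Λ` of the machine by `emb`, and the program leaves through the label `out`. The Boolean
register of the machine holds the outcome of the last test. -/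
def compile {Λ : Type} : (c : Cmd Γ) → (emb : c.Lab → Λ) → (out : Λ) → c.Lab → TM2.Stmt Γ Λ Bool
  | push k a, _, out, _ => .push k (fun _ => a) (.goto fun _ => out)
  | pop k, _, out, _ => .pop k (fun v _ => v) (.goto fun _ => out)
  | seq c d, emb, out, l =>
    match l with
    | .inl l => c.compile (fun x => emb (.inl x)) (emb (.inr d.start)) l
    | .inr l => d.compile (fun x => emb (.inr x)) out l
  | ite k p c d, emb, out, l =>
    match l with
    | none => .peek k (fun _ o => p o)
        (.goto fun v => if v then emb (some (.inl c.start)) else emb (some (.inr d.start)))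
    | some (.inl l) => c.compile (fun x => emb (some (.inl x))) out l
    | some (.inr l) => d.compile (fun x => emb (some (.inr x))) out l
  | loop k p c, emb, out, l =>
    match l with
    | none => .peek k (fun _ o => p o)
        (.goto fun v => if v then emb (some c.start) else out)
    | some l => c.compile (fun x => emb (some x)) (emb none) l

variable [DecidableEq K]

/-- `Exec c S S' n`: started on the stacks `S`, the program `c` terminates with the stacks `S'`
after exactly `n` steps. -/
inductive Exec : Cmd Γ → (∀ k, List (Γ k)) → (∀ k, List (Γ k)) → ℕ → Prop
  | push (k a S) : Exec (push k a) S (update S k (a :: S k)) 1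
  | pop (k S) : Exec (pop k) S (update S k (S k).tail) 1
  | seq {c d S S' S'' n m} : Exec c S S' n → Exec d S' S'' m → Exec (seq c d) S S'' (n + m)
  | ite_true {k p c d S S' n} : p (S k).head? = true → Exec c S S' n →
      Exec (ite k p c d) S S' (1 + n)
  | ite_false {k p c d S S' n} : p (S k).head? = false → Exec d S S' n →
      Exec (ite k p c d) S S' (1 + n)
  | loop_true {k p c S S' S'' n m} : p (S k).head? = true → Exec c S S' n →
      Exec (loop k p c) S' S'' m → Exec (loop k p c) S S'' (1 + n + m)
  | loop_false {k p c S} : p (S k).head? = false → Exec (loop k p c) S S 1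

/-- `n` steps of a machine. -/
def Steps {Λ σ : Type} (M : Λ → TM2.Stmt Γ Λ σ) (n : ℕ) (a b : TM2.Cfg Γ Λ σ) : Prop :=
  (flip bind (TM2.step M))^[n] (some a) = some b

theorem Steps.trans {Λ σ : Type} {M : Λ → TM2.Stmt Γ Λ σ} {n m : ℕ} {a b c : TM2.Cfg Γ Λ σ}
    (h : Steps M n a b) (h' : Steps M m b c) : Steps M (n + m) a c := by
  unfold Steps at *
  rw [Nat.add_comm, iterate_add_apply, h, h']

theorem Steps.single {Λ σ : Type} {M : Λ → TM2.Stmt Γ Λ σ} {a b : TM2.Cfg Γ Λ σ}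
    (h : TM2.step M a = some b) : Steps M 1 a b := h

/-- The compiled program simulates the structured one step by step. -/
theorem Exec.steps {Λ : Type} {M : Λ → TM2.Stmt Γ Λ Bool} {c : Cmd Γ}
    {S S' : ∀ k, List (Γ k)} {n : ℕ} (h : Exec c S S' n) :
    ∀ (emb : c.Lab → Λ) (out : Λ), (∀ l, M (emb l) = c.compile emb out l) → ∀ v, ∃ v',
      Steps M n ⟨some (emb c.start), v, S⟩ ⟨some out, v', S'⟩ := by
  induction h with
  | push k a S =>
    intro emb out hM v
    have h := hM (Cmd.push k a).start
    exact ⟨v, Steps.single (by simp [TM2.step, h, compile])⟩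
  | pop k S =>
    intro emb out hM v
    have h := hM (Cmd.pop k).start
    exact ⟨v, Steps.single (by simp [TM2.step, h, compile])⟩
  | seq _ _ ih₁ ih₂ =>
    intro emb out hM v
    obtain ⟨v₁, h₁⟩ := ih₁ (fun x => emb (.inl x)) _ (fun l => hM (.inl l)) v
    obtain ⟨v₂, h₂⟩ := ih₂ (fun x => emb (.inr x)) out (fun l => hM (.inr l)) v₁
    exact ⟨v₂, h₁.trans h₂⟩
  | ite_true hp _ ih =>
    intro emb out hM v
    obtain ⟨v₁, h₁⟩ := ih (fun x => emb (some (.inl x))) out (fun l => hM (some (.inl l))) true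
    have h := hM none
    exact ⟨v₁, (Steps.single (by simp [start, TM2.step, h, compile, hp])).trans h₁⟩
  | ite_false hp _ ih =>
    intro emb out hM v
    obtain ⟨v₁, h₁⟩ := ih (fun x => emb (some (.inr x))) out (fun l => hM (some (.inr l))) false
    have h := hM none
    exact ⟨v₁, (Steps.single (by simp [start, TM2.step, h, compile, hp])).trans h₁⟩
  | loop_true hp _ _ ih₁ ih₂ =>
    intro emb out hM v
    obtain ⟨v₁, h₁⟩ := ih₁ (fun x => emb (some x)) (emb none) (fun l => hM (some l)) true
    obtain ⟨v₂, h₂⟩ := ih₂ emb out hM v₁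
    have h := hM none
    exact ⟨v₂, ((Steps.single (by simp [start, TM2.step, h, compile, hp])).trans h₁).trans h₂⟩
  | loop_false hp =>
    intro emb out hM v
    have h := hM none
    exact ⟨false, Steps.single (by simp [start, TM2.step, h, compile, hp])⟩

/-- Each step adds at most one symbol to a given stack. -/
theorem Exec.length_le {c : Cmd Γ} {S S' : ∀ k, List (Γ k)} {n : ℕ} (h : Exec c S S' n) (j : K) :
    (S' j).length ≤ (S j).length + n := by
  induction h with
  | push k a S =>
    by_cases hj : j = k
    · subst hj; simp
    · simp [update_of_ne hj]
  | pop k S =>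
    by_cases hj : j = k
    · subst hj; simp; omega
    · simp [update_of_ne hj]
  | seq _ _ ih₁ ih₂ => omega
  | ite_true _ _ ih => omega
  | ite_false _ _ ih => omega
  | loop_true _ _ _ ih₁ ih₂ => omega
  | loop_false _ => omega

/-- `Run c S S' n`: started on `S`, the program `c` reaches `S'` within `n` steps. -/
def Run (c : Cmd Γ) (S S' : ∀ k, List (Γ k)) (n : ℕ) : Prop := ∃ m ≤ n, Exec c S S' m

namespace Run

variable {c d : Cmd Γ} {S S' S'' : ∀ k, List (Γ k)} {n m : ℕ} {k : K} {p : Option (Γ k) → Bool}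

theorem mono (h : Run c S S' n) (hn : n ≤ m) : Run c S S' m :=
  let ⟨l, hl, e⟩ := h
  ⟨l, hl.trans hn, e⟩

theorem push {a : Γ k} (h : S' = update S k (a :: S k)) : Run (push k a) S S' 1 :=
  ⟨1, le_rfl, h ▸ .push k a S⟩

theorem pop (h : S' = update S k (S k).tail) : Run (pop k : Cmd Γ) S S' 1 :=
  ⟨1, le_rfl, h ▸ .pop k S⟩

theorem seq (h : Run c S S' n) (h' : Run d S' S'' m) : Run (seq c d) S S'' (n + m) :=
  let ⟨_, hl, e⟩ := h
  let ⟨_, hl', e'⟩ := h'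
  ⟨_, Nat.add_le_add hl hl', .seq e e'⟩

theorem ite_true (hp : p (S k).head? = true) (h : Run c S S' n) :
    Run (ite k p c d) S S' (1 + n) :=
  let ⟨_, hl, e⟩ := h
  ⟨_, Nat.add_le_add le_rfl hl, .ite_true hp e⟩

theorem ite_false (hp : p (S k).head? = false) (h : Run d S S' n) :
    Run (ite k p c d) S S' (1 + n) :=
  let ⟨_, hl, e⟩ := h
  ⟨_, Nat.add_le_add le_rfl hl, .ite_false hp e⟩

theorem loop_true (hp : p (S k).head? = true) (h : Run c S S' n) (h' : Run (loop k p c) S' S'' m) :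
    Run (loop k p c) S S'' (1 + n + m) :=
  let ⟨_, hl, e⟩ := h
  let ⟨_, hl', e'⟩ := h'
  ⟨_, Nat.add_le_add (Nat.add_le_add le_rfl hl) hl', .loop_true hp e e'⟩

theorem loop_false (hp : p (S k).head? = false) : Run (loop k p c) S S 1 :=
  ⟨1, le_rfl, .loop_false hp⟩

end Run

end Cmd

/-! ### Binary trees on a stack -/

/-- Binary trees, the universal data type of the programs below. The right spine of a tree is a list
of trees; `nil` also stands for "false", all other trees for "true". -/
inductive SExp
  | nil
  | cons (a b : SExp)
  deriving DecidableEq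

namespace SExp

/-- The prefix code of a tree. -/
def code : SExp → List Bool
  | nil => [false]
  | cons a b => true :: (code a ++ code b)

/-- The size of a tree is the length of its code. -/
def size (t : SExp) : ℕ := t.code.length

@[simp] theorem size_nil : size nil = 1 := rfl

@[simp] theorem size_cons (a b : SExp) : size (cons a b) = size a + size b + 1 := by
  simp [size, code]

theorem size_pos (t : SExp) : 0 < t.size := by cases t <;> simp

/-- The left subtree: the first element of a list. -/
def hd : SExp → SExp
  | nil => nil
  | cons a _ => a

/-- The right subtree: the tail of a list. -/
def tl : SExp → SExp
  | nil => nil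
  | cons _ b => b

@[simp] theorem hd_nil : hd nil = nil := rfl
@[simp] theorem tl_nil : tl nil = nil := rfl
@[simp] theorem hd_cons (a b : SExp) : hd (cons a b) = a := rfl
@[simp] theorem tl_cons (a b : SExp) : tl (cons a b) = b := rfl

theorem size_hd_le (t : SExp) : t.hd.size ≤ t.size := by cases t <;> simp; omega
theorem size_tl_le (t : SExp) : t.tl.size ≤ t.size := by cases t <;> simp; omega

/-- `sel c a b` is `b` if `c` is `nil`, and `a` otherwise. -/
def sel : SExp → SExp → SExp → SExp
  | nil, _, b => b
  | cons _ _, a, _ => a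

@[simp] theorem sel_nil (a b : SExp) : sel nil a b = b := rfl
@[simp] theorem sel_cons (x y a b : SExp) : sel (cons x y) a b = a := rfl

/-- Left fold over the list of trees on the right spine. -/
def fold (F : SExp → SExp → SExp) : SExp → SExp → SExp
  | nil, s => s
  | cons x l, s => fold F l (F x s)

@[simp] theorem fold_nil (F : SExp → SExp → SExp) (s : SExp) : fold F nil s = s := rfl
@[simp] theorem fold_cons (F : SExp → SExp → SExp) (x l s : SExp) :
    fold F (cons x l) s = fold F l (F x s) := rfl

end SExp

/-- The stacks of the machines: input, output, a data stack `A`, an auxiliary stack `B`, and a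
counter `C`. -/
inductive Stk
  | inp | out | A | B | C
  deriving DecidableEq

instance : Fintype Stk := ⟨{.inp, .out, .A, .B, .C}, fun x => by cases x <;> simp⟩

/-- The stack alphabets. On the stacks `A`, `B`, `C` the symbol `none` is a marker. -/
@[reducible] def StkAlph : Stk → Type
  | .inp => Symbol ⊕ Bool
  | .out => Bool
  | _ => Option Bool

/-- The stacks with the given contents. -/
def st (i : List (Symbol ⊕ Bool)) (o : List Bool) (a b c : List (Option Bool)) :
    ∀ k, List (StkAlph k)
  | .inp => i
  | .out => o
  | .A => a
  | .B => b
  | .C => c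

section st

variable (i : List (Symbol ⊕ Bool)) (o : List Bool) (a b c : List (Option Bool))

@[simp] theorem st_inp : st i o a b c .inp = i := rfl
@[simp] theorem st_out : st i o a b c .out = o := rfl
@[simp] theorem st_A : st i o a b c .A = a := rfl
@[simp] theorem st_B : st i o a b c .B = b := rfl
@[simp] theorem st_C : st i o a b c .C = c := rfl
@[simp] theorem st_update_inp (x) : update (st i o a b c) .inp x = st x o a b c := by
  funext k; cases k <;> simp [update]
@[simp] theorem st_update_out (x) : update (st i o a b c) .out x = st i x a b c := by
  funext k; cases k <;> simp [update]
@[simp] theorem st_update_A (x) : update (st i o a b c) .A x = st i o x b c := by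
  funext k; cases k <;> simp [update]
@[simp] theorem st_update_B (x) : update (st i o a b c) .B x = st i o a x c := by
  funext k; cases k <;> simp [update]
@[simp] theorem st_update_C (x) : update (st i o a b c) .C x = st i o a b x := by
  funext k; cases k <;> simp [update]

end st

/-- Programs over the stacks `Stk`. -/
abbrev Prg := Cmd StkAlph

/-- The code of a tree as a string of stack symbols. -/
def SExp.str (t : SExp) : List (Option Bool) := t.code.map some

@[simp] theorem SExp.str_nil : SExp.nil.str = [some false] := rfl
@[simp] theorem SExp.str_cons (a b : SExp) :
    (SExp.cons a b).str = some true :: (a.str ++ b.str) := by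
  simp [str, code]
@[simp] theorem SExp.length_str (a : SExp) : a.str.length = a.size := by
  simp [str, size]

namespace Prg

open Cmd SExp

/-- The test for a given top symbol of a work stack. -/
def is (x : Option Bool) : Option (Option Bool) → Bool := fun o => decide (o = some x)

/-- Move one symbol `true`/`false` from the top of `A` to `B`. -/
def moveAB : Prg :=
  .ite .A (is (some true)) (.seq (.pop .A) (.seq (.push .B (some true)) (.push .C (some true))))
    (.seq (.pop .A) (.seq (.push .B (some false)) (.pop .C)))

/-- Move the top tree of `A` to `B`, reversed and on top of a marker. The stack `C` counts the
subtrees that are still to be moved. -/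
def takeAB : Prg :=
  .seq (.push .B none) (.seq (.push .C none) (.seq (.push .C (some true))
    (.seq (.loop .C (is (some true)) moveAB) (.pop .C))))

variable {i : List (Symbol ⊕ Bool)} {o : List Bool} {a b c : List (Option Bool)}

theorem takeAB_loop (t : SExp) : ∀ {a b c S n},
    Run (.loop .C (is (some true)) moveAB) (st i o a (t.str.reverse ++ b) c) S n →
    Run (.loop .C (is (some true)) moveAB) (st i o (t.str ++ a) b (some true :: c)) S
      (5 * t.size + n) := by
  induction t with
  | nil =>
    intro a b c S n h
    have h1 : Run moveAB (st i o (nil.str ++ a) b (some true :: c))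
        (st i o a (nil.str.reverse ++ b) c) (1 + (1 + (1 + 1))) :=
      .ite_false (by simp [is]) (.seq (S' := st i o a b (some true :: c)) (.pop (by simp))
        (.seq (S' := st i o a (some false :: b) (some true :: c)) (.push (by simp))
          (.pop (by simp))))
    exact (Run.loop_true (by simp [is]) h1 h).mono (by simp)
  | cons x y ihx ihy =>
    intro a b c S n h
    have h1 : Run moveAB (st i o ((cons x y).str ++ a) b (some true :: c))
        (st i o (x.str ++ (y.str ++ a)) (some true :: b) (some true :: some true :: c))
          (1 + (1 + (1 + 1))) :=
      .ite_true (by simp [is])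
        (.seq (S' := st i o (x.str ++ (y.str ++ a)) b (some true :: c)) (.pop (by simp))
        (.seq (S' := st i o (x.str ++ (y.str ++ a)) (some true :: b) (some true :: c))
          (.push (by simp)) (.push (by simp))))
    have h2 := ihy (a := a) (b := x.str.reverse ++ some true :: b) (c := c) (S := S) (n := n)
      (by simpa using h)
    exact (Run.loop_true (by simp [is]) h1 (ihx h2)).mono (by simp; omega)

theorem takeAB_run (t : SExp) :
    Run takeAB (st i o (t.str ++ a) b c) (st i o a (t.str.reverse ++ none :: b) c)
      (5 * t.size + 5) := by
  have h := takeAB_loop (i := i) (o := o) t (a := a) (b := none :: b) (c := none :: c)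
    (S := st i o a (t.str.reverse ++ none :: b) (none :: c)) (.loop_false (by simp [is]))
  refine (Run.seq (S' := st i o (t.str ++ a) (none :: b) c) (.push (by simp))
    (.seq (S' := st i o (t.str ++ a) (none :: b) (none :: c)) (.push (by simp))
    (.seq (S' := st i o (t.str ++ a) (none :: b) (some true :: none :: c)) (.push (by simp))
    (.seq h (.pop (by simp)))))).mono (by omega)

/-- The test that the top symbol is not a marker. -/
def notMark : Option (Option Bool) → Bool := fun o => !decide (o = some none)

/-- Move the string on top of a marker from `B` to `A`, and remove the marker. -/
def moveBA : Prg :=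
  .seq (.loop .B notMark (.ite .B (is (some true)) (.seq (.pop .B) (.push .A (some true)))
    (.seq (.pop .B) (.push .A (some false))))) (.pop .B)

/-- Move the string on top of a marker from `B` to `A`, and copy it to `C`. -/
def moveBAC : Prg :=
  .seq (.loop .B notMark (.ite .B (is (some true))
      (.seq (.pop .B) (.seq (.push .A (some true)) (.push .C (some true))))
      (.seq (.pop .B) (.seq (.push .A (some false)) (.push .C (some false)))))) (.pop .B)

/-- Move the string on top of a marker from `B` to `C`, and remove the marker. -/
def moveBC : Prg :=
  .seq (.loop .B notMark (.ite .B (is (some true)) (.seq (.pop .B) (.push .C (some true)))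
    (.seq (.pop .B) (.push .C (some false))))) (.pop .B)

/-- Move the string on top of a marker from `C` to `B`, and remove the marker. -/
def moveCB : Prg :=
  .seq (.loop .C notMark (.ite .C (is (some true)) (.seq (.pop .C) (.push .B (some true)))
    (.seq (.pop .C) (.push .B (some false))))) (.pop .C)

/-- Remove the string on top of a marker from `B`, and the marker. -/
def dropB : Prg := .seq (.loop .B notMark (.pop .B)) (.pop .B)

theorem moveBA_run (w : List Bool) :
    Run moveBA (st i o a (w.map some ++ none :: b) c) (st i o (w.reverse.map some ++ a) b c)
      (4 * w.length + 2) := by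
  have h : ∀ (w : List Bool) (a : List (Option Bool)), Run (.loop .B notMark
      (.ite .B (is (some true))
      (.seq (.pop .B) (.push .A (some true))) (.seq (.pop .B) (.push .A (some false)))))
      (st i o a (w.map some ++ none :: b) c) (st i o (w.reverse.map some ++ a) (none :: b) c)
      (4 * w.length + 1) := by
    intro w
    induction w with
    | nil => exact fun a => .loop_false (by simp [notMark])
    | cons x w ih =>
      intro a
      refine (Run.loop_true (n := 1 + (1 + 1)) (by simp [notMark]) ?_ (ih (some x :: a))).mono
        (by simp; omega) |> fun h => by simpa using h
      cases x
      · exact .ite_false (by simp [is]) (.seq (.pop rfl) (.push (by simp)))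
      · exact .ite_true (by simp [is]) (.seq (.pop rfl) (.push (by simp)))
  exact (Run.seq (h w a) (.pop (by simp))).mono (by omega)

theorem moveBC_run (w : List Bool) :
    Run moveBC (st i o a (w.map some ++ none :: b) c) (st i o a b (w.reverse.map some ++ c))
      (4 * w.length + 2) := by
  have h : ∀ (w : List Bool) (c : List (Option Bool)), Run (.loop .B notMark
      (.ite .B (is (some true))
      (.seq (.pop .B) (.push .C (some true))) (.seq (.pop .B) (.push .C (some false)))))
      (st i o a (w.map some ++ none :: b) c) (st i o a (none :: b) (w.reverse.map some ++ c))
      (4 * w.length + 1) := by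
    intro w
    induction w with
    | nil => exact fun a => .loop_false (by simp [notMark])
    | cons x w ih =>
      intro c
      refine (Run.loop_true (n := 1 + (1 + 1)) (by simp [notMark]) ?_ (ih (some x :: c))).mono
        (by simp; omega) |> fun h => by simpa using h
      cases x
      · exact .ite_false (by simp [is]) (.seq (.pop rfl) (.push (by simp)))
      · exact .ite_true (by simp [is]) (.seq (.pop rfl) (.push (by simp)))
  exact (Run.seq (h w c) (.pop (by simp))).mono (by omega)

theorem moveCB_run (w : List Bool) :
    Run moveCB (st i o a b (w.map some ++ none :: c)) (st i o a (w.reverse.map some ++ b) c)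
      (4 * w.length + 2) := by
  have h : ∀ (w : List Bool) (b : List (Option Bool)), Run (.loop .C notMark
      (.ite .C (is (some true))
      (.seq (.pop .C) (.push .B (some true))) (.seq (.pop .C) (.push .B (some false)))))
      (st i o a b (w.map some ++ none :: c)) (st i o a (w.reverse.map some ++ b) (none :: c))
      (4 * w.length + 1) := by
    intro w
    induction w with
    | nil => exact fun a => .loop_false (by simp [notMark])
    | cons x w ih =>
      intro b
      refine (Run.loop_true (n := 1 + (1 + 1)) (by simp [notMark]) ?_ (ih (some x :: b))).mono
        (by simp; omega) |> fun h => by simpa using h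
      cases x
      · exact .ite_false (by simp [is]) (.seq (.pop rfl) (.push (by simp)))
      · exact .ite_true (by simp [is]) (.seq (.pop rfl) (.push (by simp)))
  exact (Run.seq (h w b) (.pop (by simp))).mono (by omega)

theorem moveBAC_run (w : List Bool) :
    Run moveBAC (st i o a (w.map some ++ none :: b) c)
      (st i o (w.reverse.map some ++ a) b (w.reverse.map some ++ c)) (5 * w.length + 2) := by
  have h : ∀ (w : List Bool) (a c : List (Option Bool)), Run (.loop .B notMark
      (.ite .B (is (some true))
        (.seq (.pop .B) (.seq (.push .A (some true)) (.push .C (some true))))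
        (.seq (.pop .B) (.seq (.push .A (some false)) (.push .C (some false))))))
      (st i o a (w.map some ++ none :: b) c)
      (st i o (w.reverse.map some ++ a) (none :: b) (w.reverse.map some ++ c))
      (5 * w.length + 1) := by
    intro w
    induction w with
    | nil => exact fun a c => .loop_false (by simp [notMark])
    | cons x w ih =>
      intro a c
      refine (Run.loop_true (n := 1 + (1 + (1 + 1))) (by simp [notMark]) ?_
        (ih (some x :: a) (some x :: c))).mono (by simp; omega) |> fun h => by simpa using h
      cases x
      · exact .ite_false (by simp [is]) (.seq (.pop rfl) (.seq (.push rfl) (.push (by simp))))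
      · exact .ite_true (by simp [is]) (.seq (.pop rfl) (.seq (.push rfl) (.push (by simp))))
  exact (Run.seq (h w a c) (.pop (by simp))).mono (by omega)

theorem dropB_run (w : List Bool) :
    Run dropB (st i o a (w.map some ++ none :: b) c) (st i o a b c) (2 * w.length + 2) := by
  have h : ∀ (w : List Bool), Run (.loop .B notMark (.pop .B))
      (st i o a (w.map some ++ none :: b) c) (st i o a (none :: b) c) (2 * w.length + 1) := by
    intro w
    induction w with
    | nil => exact .loop_false (by simp [notMark])
    | cons x w ih =>
      refine (Run.loop_true (n := 1) (by simp [notMark]) (.pop (by simp)) ih).mono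
        (by simp; omega)
  exact (Run.seq (h w) (.pop (by simp))).mono (by omega)

/-- Remove the top tree of `A`. -/
def drop : Prg := .seq takeAB dropB

theorem drop_run (t : SExp) : Run drop (st i o (t.str ++ a) b c) (st i o a b c)
    (7 * t.size + 7) :=
  (Run.seq (takeAB_run t) (by simpa [str, List.map_reverse] using dropB_run t.code.reverse)).mono
    (by simp [size]; omega)

/-- Duplicate the top tree of `A`. -/
def dup : Prg := .seq takeAB (.seq (.push .C none) (.seq moveBAC (.seq (.push .B none)
  (.seq moveCB moveBA))))

theorem dup_run (t : SExp) : Run dup (st i o (t.str ++ a) b c) (st i o (t.str ++ (t.str ++ a)) b c)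
    (18 * t.size + 13) := by
  have h1 := moveBAC_run (i := i) (o := o) (a := a) (b := b) (c := none :: c) t.code.reverse
  have h2 := moveCB_run (i := i) (o := o) (a := t.str ++ a) (b := none :: b) (c := c) t.code
  have h3 := moveBA_run (i := i) (o := o) (a := t.str ++ a) (b := b) (c := c) t.code.reverse
  simp only [List.reverse_reverse] at h1 h3
  refine (Run.seq (takeAB_run t) (Run.seq (.push rfl) (Run.seq (by simpa [str] using h1)
    (Run.seq (.push rfl) (Run.seq (by simpa [str] using h2) (by simpa [str] using h3)))))).mono ?_
  simp [size]
  omega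

/-- Exchange the two top trees of `A`. -/
def swap : Prg := .seq takeAB (.seq takeAB (.seq (.push .C none) (.seq moveBC (.seq moveBA
  (.seq (.push .B none) (.seq moveCB moveBA))))))

theorem swap_run (t s : SExp) : Run swap (st i o (t.str ++ (s.str ++ a)) b c)
    (st i o (s.str ++ (t.str ++ a)) b c) (20 * t.size + 20 * s.size + 20) := by
  have h1 := moveBC_run (i := i) (o := o) (a := a) (b := t.str.reverse ++ none :: b)
    (c := none :: c) s.code.reverse
  have h2 := moveBA_run (i := i) (o := o) (a := a) (b := b) (c := s.str ++ none :: c)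
    t.code.reverse
  have h3 := moveCB_run (i := i) (o := o) (a := t.str ++ a) (b := none :: b) (c := c) s.code
  have h4 := moveBA_run (i := i) (o := o) (a := t.str ++ a) (b := b) (c := c) s.code.reverse
  simp only [List.reverse_reverse] at h1 h2 h4
  refine (Run.seq (takeAB_run t) (Run.seq (takeAB_run s) (Run.seq (.push rfl)
    (Run.seq (by simpa [str] using h1) (Run.seq (by simpa [str] using h2) (Run.seq (.push rfl)
      (Run.seq (by simpa [str] using h3) (by simpa [str] using h4)))))))).mono ?_
  simp [size]
  omega

end Prg

end SlackCoNP

namespace SlackCoNP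

open Turing Function

/-! ### Polynomial-time functions on trees -/

theorem eval_mono (p : Polynomial ℕ) : Monotone fun n => p.eval n := by
  intro m n h
  simp only [Polynomial.eval_eq_sum_range]
  gcongr

/-- A function on trees is polynomial-time computable if a structured program replaces the tree on
top of the stack `A` by its image, within a time polynomial in the size of the tree. Everything
below that tree and all other stacks are left as they were, so that programs can be nested. -/
@[fun_prop]
def PolyTime (f : SExp → SExp) : Prop :=
  ∃ (c : Prg) (p : Polynomial ℕ), ∀ t i o a b d,
    Cmd.Run c (st i o (t.str ++ a) b d) (st i o ((f t).str ++ a) b d) (p.eval t.size)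

namespace PolyTime

open Cmd SExp Prg

variable {f g h : SExp → SExp}

/-- In polynomial time only polynomially many symbols can be pushed. -/
theorem size_le (hf : PolyTime f) : ∃ p : Polynomial ℕ, ∀ t, (f t).size ≤ p.eval t.size := by
  obtain ⟨c, p, hc⟩ := hf
  refine ⟨p + .X, fun t => ?_⟩
  obtain ⟨n, hn, e⟩ := hc t [] [] [] [] []
  have := e.length_le .A
  simp at this ⊢
  omega

@[fun_prop]
protected theorem id : PolyTime fun t => t :=
  ⟨.seq (.push .C none) (.pop .C), 2, fun t i o a b d =>
    (Run.seq (.push rfl) (.pop (by simp))).mono (by simp)⟩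

@[fun_prop]
theorem comp (hf : PolyTime f) (hg : PolyTime g) : PolyTime fun t => f (g t) := by
  obtain ⟨r, hr⟩ := hg.size_le
  obtain ⟨c, p, hc⟩ := hf
  obtain ⟨d, q, hd⟩ := hg
  refine ⟨.seq d c, q + p.comp r, fun t i o a b e => (Run.seq (hd ..) (hc ..)).mono ?_⟩
  simpa using eval_mono p (hr t)

@[fun_prop]
theorem const (s : SExp) : PolyTime fun _ => s := by
  have key : ∀ w : List Bool, ∃ c : Prg, ∀ i o a b d,
      Run c (st i o a b d) (st i o (w.map some ++ a) b d) (w.length + 2) := by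
    intro w
    induction w with
    | nil => exact ⟨.seq (.push .C none) (.pop .C), fun i o a b d =>
        (Run.seq (.push rfl) (.pop (by simp))).mono (by simp)⟩
    | cons x w ih =>
      obtain ⟨c, hc⟩ := ih
      exact ⟨.seq c (.push .A (some x)), fun i o a b d =>
        (Run.seq (hc ..) (.push (by simp))).mono (by simp)⟩
  obtain ⟨c, hc⟩ := key s.code
  refine ⟨.seq drop c, 7 * .X + 7 + (s.size + 2 : ℕ), fun t i o a b d =>
    (Run.seq (drop_run t) (hc ..)).mono ?_⟩
  simp [size]

@[fun_prop]
theorem hd (hf : PolyTime f) : PolyTime fun t => (f t).hd := by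
  refine comp (f := SExp.hd) ?_ hf
  refine ⟨.ite .A (is (some true)) (.seq (.pop .A) (.seq swap drop))
    (.seq (.pop .A) (.push .A (some false))), 27 * .X + 30, fun t i o a b d => ?_⟩
  cases t with
  | nil => exact (Run.ite_false (by simp [is]) (.seq (.pop rfl) (.push (by simp)))).mono (by simp)
  | cons x y =>
    refine (Run.ite_true (by simp [is]) (.seq (.pop (S' := st i o (x.str ++ (y.str ++ a)) b d)
      (by simp)) (.seq (swap_run x y) (drop_run y)))).mono ?_
    simp
    omega

@[fun_prop]
theorem tl (hf : PolyTime f) : PolyTime fun t => (f t).tl := by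
  refine comp (f := SExp.tl) ?_ hf
  refine ⟨.ite .A (is (some true)) (.seq (.pop .A) drop)
    (.seq (.pop .A) (.push .A (some false))), 7 * .X + 10, fun t i o a b d => ?_⟩
  cases t with
  | nil => exact (Run.ite_false (by simp [is]) (.seq (.pop rfl) (.push (by simp)))).mono (by simp)
  | cons x y =>
    refine (Run.ite_true (by simp [is]) (.seq (.pop (S' := st i o (x.str ++ (y.str ++ a)) b d)
      (by simp)) (drop_run x))).mono ?_
    simp
    omega

@[fun_prop]
theorem cons (hf : PolyTime f) (hg : PolyTime g) : PolyTime fun t => SExp.cons (f t) (g t) := by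
  obtain ⟨r, hr⟩ := hf.size_le
  obtain ⟨s, hs⟩ := hg.size_le
  obtain ⟨c, p, hc⟩ := hf
  obtain ⟨d, q, hd⟩ := hg
  refine ⟨.seq dup (.seq c (.seq swap (.seq d (.seq swap (.push .A (some true)))))),
    38 * .X + 60 + p + q + 40 * r + 20 * s, fun t i o a b e => ?_⟩
  refine (Run.seq (dup_run t) (.seq (hc ..) (.seq (swap_run ..) (.seq (hd ..)
    (.seq (swap_run ..) (.push (by simp))))))).mono ?_
  have := hr t
  have := hs t
  simp
  omega

@[fun_prop]
theorem sel (hh : PolyTime h) (hf : PolyTime f) (hg : PolyTime g) :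
    PolyTime fun t => SExp.sel (h t) (f t) (g t) := by
  obtain ⟨r, hr⟩ := hh.size_le
  obtain ⟨e, u, he⟩ := hh
  obtain ⟨c, p, hc⟩ := hf
  obtain ⟨d, q, hd⟩ := hg
  refine ⟨.seq dup (.seq e (.ite .A (is (some true)) (.seq drop c) (.seq drop d))),
    18 * .X + 30 + u + 7 * r + p + q, fun t i o a b z => ?_⟩
  have := hr t
  cases ht : h t with
  | nil =>
    refine (Run.seq (dup_run t) (.seq (he ..) (.ite_false (by simp [is, ht])
      (.seq (drop_run ..) (by simpa [ht] using hd t i o a b z))))).mono ?_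
    simp
    omega
  | cons x y =>
    refine (Run.seq (dup_run t) (.seq (he ..) (.ite_true (by simp [is, ht])
      (.seq (drop_run ..) (by simpa [ht] using hc t i o a b z))))).mono ?_
    simp
    omega

/-- Iterating over a list is polynomial-time if the size of the state stays polynomially bounded.
As the bound is required for all lists, it also controls the intermediate states. -/
theorem fold {F : SExp → SExp → SExp → SExp} (hF : PolyTime fun t => F t.hd t.tl.hd t.tl.tl)
    (B : Polynomial ℕ)
    (hB : ∀ p l s, (SExp.fold (F p) l s).size ≤ B.eval (p.size + l.size + s.size))
    (hf : PolyTime f) (hg : PolyTime g) (hh : PolyTime h) :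
    PolyTime fun t => SExp.fold (F (f t)) (g t) (h t) := by
  suffices hmain : PolyTime fun t => SExp.fold (F t.tl.hd) t.hd t.tl.tl from
    comp (g := fun t => .cons (g t) (.cons (f t) (h t))) hmain (by fun_prop)
  -- one round acts on the triple of remaining list, parameter, and state
  have hG : PolyTime fun t => SExp.cons t.hd.tl (.cons t.tl.hd (F t.tl.hd t.hd.hd t.tl.tl)) :=
    cons (by fun_prop) (cons (by fun_prop)
      (comp (f := fun t => F t.hd t.tl.hd t.tl.tl)
        (g := fun t => .cons t.tl.hd (.cons t.hd.hd t.tl.tl)) hF (by fun_prop)))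
  have htl : PolyTime SExp.tl := tl PolyTime.id
  obtain ⟨d, q, hd⟩ := htl
  -- normalize the input to a triple, so that its first symbol need not be tested
  have hN : PolyTime fun t => SExp.cons t.hd (.cons t.tl.hd t.tl.tl) := by fun_prop
  obtain ⟨sN, hsN⟩ := hN.size_le
  obtain ⟨e, u, he⟩ := hN
  obtain ⟨c, p, hc⟩ := hG
  have key : ∀ (P : SExp) (m N : ℕ) (l s : SExp) i o a b z, l.size ≤ m →
      (∀ l₁ : SExp, l₁.size ≤ l.size → (SExp.fold (F P) l₁ s).size ≤ N) →
      Run (.loop .A (is (some true)) (.seq (.push .A (some true)) (.seq c (.pop .A))))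
        (st i o (l.str ++ ((SExp.cons P s).str ++ a)) b z)
        (st i o (nil.str ++ ((SExp.cons P (SExp.fold (F P) l s)).str ++ a)) b z)
        (l.size * (p.eval (m + P.size + N + 2) + 3) + 1) := by
    intro P m N l
    induction l with
    | nil => intro s i o a b z _ _; exact (Run.loop_false (by simp [is])).mono (by simp)
    | cons x l _ ih =>
      intro s i o a b z hm hN
      have h1 := ih (F P x s) i o a b z (le_trans (by simp; omega) hm)
        fun l₁ hl₁ => hN (.cons x l₁) (by simpa using hl₁)
      have h2 := hc (.cons (.cons x l) (.cons P s)) i o a b z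
      have h3 : p.eval (SExp.cons (.cons x l) (.cons P s)).size ≤
          p.eval (m + P.size + N + 2) := by
        have := hN .nil (by simp)
        refine eval_mono p ?_
        simp at hm this ⊢
        omega
      refine (Run.loop_true (by simp [is]) (.seq
        (S' := st i o ((SExp.cons (.cons x l) (.cons P s)).str ++ a) b z) (.push (by simp))
        (.seq h2 (.pop (S' := st i o (l.str ++ ((SExp.cons P (F P x s)).str ++ a)) b z)
        (by simp)))) h1).mono ?_
      have := size_pos x
      simp only [size_cons] at h3 ⊢
      nlinarith
  refine ⟨.seq e (.seq (.pop .A) (.seq (.loop .A (is (some true))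
    (.seq (.push .A (some true)) (.seq c (.pop .A)))) (.seq (.pop .A) d))),
    u + sN * ((p.comp (2 * sN + B.comp (3 * sN) + 2)) + 3) + 3 +
      q.comp (sN + B.comp (3 * sN) + 1), fun t i o a b z => ?_⟩
  have hB' : ∀ l₁ : SExp, l₁.size ≤ t.hd.size →
      (SExp.fold (F t.tl.hd) l₁ t.tl.tl).size ≤ B.eval (3 * sN.eval t.size) := fun l₁ hl₁ => by
    refine (hB ..).trans (eval_mono B ?_)
    have := hsN t
    simp at this ⊢
    omega
  have h1 := key t.tl.hd (sN.eval t.size) (B.eval (3 * sN.eval t.size)) t.hd t.tl.tl i o a b z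
    (le_trans (by simp; omega) (hsN t)) hB'
  refine (Run.seq (he ..) (.seq (.pop (S' := st i o (t.hd.str ++
    ((SExp.cons t.tl.hd t.tl.tl).str ++ a)) b z) (by simp)) (.seq h1 (.seq (.pop
      (S' := st i o ((SExp.cons t.tl.hd (SExp.fold (F t.tl.hd) t.hd t.tl.tl)).str ++ a) b z)
      (by simp)) (hd ..))))).mono ?_
  have h2 := hsN t
  have h3 := hB' t.hd le_rfl
  simp only [size_cons] at h2
  have h4 : p.eval (sN.eval t.size + t.tl.hd.size + B.eval (3 * sN.eval t.size) + 2) ≤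
      p.eval (2 * sN.eval t.size + B.eval (3 * sN.eval t.size) + 2) :=
    eval_mono p (by omega)
  have h5 : q.eval (SExp.cons t.tl.hd (SExp.fold (F t.tl.hd) t.hd t.tl.tl)).size ≤
      q.eval (sN.eval t.size + B.eval (3 * sN.eval t.size) + 1) :=
    eval_mono q (by simp only [size_cons]; omega)
  have h6 := Nat.mul_le_mul (show t.hd.size ≤ sN.eval t.size by omega)
    (Nat.add_le_add_right h4 3)
  simp only [Polynomial.eval_add, Polynomial.eval_mul, Polynomial.eval_comp,
    Polynomial.eval_ofNat, Polynomial.eval_one]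
  omega

end PolyTime

/-! ### Polynomial-time verifiers -/

/-- Truth values as trees. -/
def SExp.ofBool (b : Bool) : SExp := if b then .cons .nil .nil else .nil

/-- The first of four flags that code the symbols of the input stack: certificate bits are told from
symbols of the input string. -/
def flag₁ : Symbol ⊕ Bool → Bool
  | .inr _ => true
  | .inl _ => false

/-- The second flag: the value of a bit; it also tells the comma from the semicolon. -/
def flag₂ : Symbol ⊕ Bool → Bool
  | .inr b => b
  | .inl (.bit b) => b
  | .inl .comma => true
  | .inl _ => false

/-- The third flag: bits and the slash are told from the other symbols of the input string. -/
def flag₃ : Symbol ⊕ Bool → Bool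
  | .inl (.bit _) => true
  | .inl .slash => true
  | _ => false

/-- The fourth flag: it tells bits from the slash, and the separators from the minus sign. -/
def flag₄ : Symbol ⊕ Bool → Bool
  | .inl (.bit _) => true
  | .inl .comma => true
  | .inl .semicolon => true
  | _ => false

/-- A symbol of the input stack as a tree, given by its four flags. -/
def symTree (v : Symbol ⊕ Bool) : SExp :=
  .cons (.ofBool (flag₁ v)) (.cons (.ofBool (flag₂ v))
    (.cons (.ofBool (flag₃ v)) (.ofBool (flag₄ v))))

/-- A list of trees as a tree. -/
def SExp.ofList : List SExp → SExp
  | [] => .nil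
  | x :: l => .cons x (ofList l)

namespace Prg

open Cmd SExp

variable {i : List (Symbol ⊕ Bool)} {o : List Bool} {a b c : List (Option Bool)}

/-- Push a flag of the next input symbol as a tree. -/
def pushFlag (p : Symbol ⊕ Bool → Bool) : Prg :=
  .ite .inp (fun x => x.elim false p)
    (.seq (.push .A (some false)) (.seq (.push .A (some false)) (.push .A (some true))))
    (.push .A (some false))

theorem pushFlag_run (p : Symbol ⊕ Bool → Bool) (v : Symbol ⊕ Bool) :
    Run (pushFlag p) (st (v :: i) o a b c) (st (v :: i) o ((ofBool (p v)).str ++ a) b c) 4 := by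
  cases h : p v
  · exact (Run.ite_false (by simpa using h) (.push (by simp [ofBool]))).mono (by simp)
  · exact (Run.ite_true (by simpa using h) (.seq (.push rfl) (.seq (.push rfl)
      (.push (by simp [ofBool]))))).mono (by simp)

/-- Read the input and build the reversed list of its symbols. -/
def read : Prg :=
  .seq (.push .A (some false)) (.loop .inp Option.isSome
    (.seq (pushFlag flag₄) (.seq (pushFlag flag₃) (.seq (.push .A (some true))
      (.seq (pushFlag flag₂) (.seq (.push .A (some true)) (.seq (pushFlag flag₁)
        (.seq (.push .A (some true)) (.seq (.push .A (some true)) (.pop .inp))))))))))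

theorem read_run (l : List (Symbol ⊕ Bool)) :
    Run read (st l o a b c) (st [] o ((ofList (l.reverse.map symTree)).str ++ a) b c)
      (22 * l.length + 2) := by
  have h : ∀ (l l' : List (Symbol ⊕ Bool)), Run (.loop .inp Option.isSome
      (.seq (pushFlag flag₄) (.seq (pushFlag flag₃) (.seq (.push .A (some true))
      (.seq (pushFlag flag₂) (.seq (.push .A (some true)) (.seq (pushFlag flag₁)
        (.seq (.push .A (some true)) (.seq (.push .A (some true)) (.pop .inp))))))))))
      (st l o ((ofList (l'.map symTree)).str ++ a) b c)
      (st [] o ((ofList ((l.reverse ++ l').map symTree)).str ++ a) b c) (22 * l.length + 1) := by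
    intro l
    induction l with
    | nil => exact fun l' => .loop_false (by simp)
    | cons v l ih =>
      intro l'
      have := ih (v :: l')
      refine (Run.loop_true (m := 22 * l.length + 1) (by simp)
        (.seq (pushFlag_run ..) (.seq (pushFlag_run ..) (.seq (.push rfl)
        (.seq (by simpa using pushFlag_run ..) (.seq (.push rfl)
        (.seq (by simpa using pushFlag_run ..)
        (.seq (.push rfl) (.seq (.push rfl) (.pop rfl))))))))) ?_).mono ?_
      · simpa [ofList, symTree] using this
      · simp
        omega
  have := h l []
  exact (Run.seq (.push rfl) (by simpa [ofList] using this)).mono (by omega)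

/-- Output whether the tree on `A` differs from `nil`, and clean up. -/
def write : Prg :=
  .seq (.ite .A (is (some true)) (.push .out true) (.push .out false))
    (.loop .A Option.isSome (.pop .A))

theorem write_run (t : SExp) :
    Run write (st [] [] t.str [] []) (st [] [decide (t ≠ nil)] [] [] []) (2 * t.size + 3) := by
  have h : ∀ (l : List (Option Bool)) (o : List Bool), Run (.loop .A Option.isSome (.pop .A))
      (st [] o l [] []) (st [] o [] [] []) (2 * l.length + 1) := by
    intro l o
    induction l with
    | nil => exact .loop_false (by simp)
    | cons x l ih => exact (Run.loop_true (by simp) (.pop (by simp)) ih).mono (by simp; omega)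
  have h' := h t.str [decide (t ≠ nil)]
  refine (Run.seq (n := 2) ?_ h').mono (by simp; omega)
  cases t with
  | nil => exact .ite_false (by simp [is]) (.push (by simp))
  | cons x y => exact .ite_true (by simp [is]) (.push (by simp))

/-- The machine that executes a program and then halts. -/
def toTM (c : Prg) : FinTM2 where
  K := Stk
  k₀ := .inp
  k₁ := .out
  Γ := StkAlph
  Λ := Option c.Lab
  main := some c.start
  ΛFin := have := Lab.fintype c; inferInstance
  σ := Bool
  initialState := false
  Γk₀Fin := inferInstanceAs (Fintype (Symbol ⊕ Bool))
  m
    | none => .load (fun _ => false) .halt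
    | some l => c.compile some none l

end Prg

open Cmd Prg SExp in
/-- A polynomial-time function on trees gives a polynomial-time verifier in the sense of
Turing machines. -/
theorem PolyTime.tm2 {f : SExp → SExp} (hf : PolyTime f) :
    Nonempty (TM2ComputableInPolyTime
      (Computability.encodingProd (Computability.encodingList Symbol)
        (Computability.encodingList Bool)).encode
      Computability.encodeBool fun xy : List Symbol × List Bool =>
        decide (f (ofList ((xy.1.map Sum.inl ++ xy.2.map Sum.inr).reverse.map symTree)) ≠ nil)) :=
  by
  obtain ⟨s, hs⟩ := hf.size_le
  obtain ⟨c, p, hc⟩ := hf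
  refine ⟨{
    tm := toTM (.seq read (.seq c write))
    inputAlphabet := Equiv.refl _
    outputAlphabet := Equiv.refl _
    time := 22 * .X + 6 + p.comp (22 * .X + 2) + 2 * s.comp (22 * .X + 2)
    outputsFun := fun xy => Classical.choice ?_ }⟩
  obtain ⟨x, y⟩ := xy
  generalize hl : x.map Sum.inl ++ y.map Sum.inr = l
  have h1 := read_run (o := []) (a := []) (b := []) (c := []) l
  have hsize : (ofList (l.reverse.map symTree)).size ≤ 22 * l.length + 2 := by
    obtain ⟨n, hn, e⟩ := h1
    have := e.length_le .A
    simp at this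
    simp
    omega
  have h2 := hc (ofList (l.reverse.map symTree)) [] [] [] [] []
  have h3 := write_run (f (ofList (l.reverse.map symTree)))
  obtain ⟨n, hn, e⟩ := Run.seq h1 (.seq h2
    (S' := st [] [] ((f (ofList (l.reverse.map symTree))).str ++ []) [] [])
    (by rw [List.append_nil]; exact h3))
  let M := toTM (.seq read (.seq c write))
  obtain ⟨v, hv⟩ := e.steps (M := M.m) some none (fun _ => rfl) false
  have hfin : Steps M.m 1 ⟨some none, v, st [] [decide (f (ofList (l.reverse.map symTree)) ≠ nil)]
      [] [] []⟩ ⟨none, false, st [] [decide (f (ofList (l.reverse.map symTree)) ≠ nil)] [] [] []⟩ :=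
    Steps.single rfl
  refine ⟨⟨⟨n + 1, ?_⟩, ?_⟩⟩
  · have hi : ∀ w : List (Symbol ⊕ Bool), initList M w =
        (⟨some (some (Cmd.start _)), false, st w [] [] [] []⟩ : TM2.Cfg StkAlph _ Bool) := by
      intro w
      refine congrArg (TM2.Cfg.mk _ _) (funext fun k => ?_)
      cases k <;> rfl
    have ho : ∀ w : List Bool, haltList M w =
        (⟨none, false, st [] w [] [] []⟩ : TM2.Cfg StkAlph _ Bool) := by
      intro w
      refine congrArg (TM2.Cfg.mk _ _) (funext fun k => ?_)
      cases k <;> rfl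
    have hin : (Computability.encodingProd (Computability.encodingList Symbol)
        (Computability.encodingList Bool)).encode (x, y) = l := hl
    have h := hv.trans hfin
    rw [hin]
    erw [List.map_id, List.map_id]
    change (flip bind (TM2.step M.m))^[n + 1] (some (initList M l)) =
      some (haltList M [decide (f (ofList (l.reverse.map symTree)) ≠ nil)])
    exact (congrArg (fun z => (flip bind (TM2.step M.m))^[n + 1] (some z)) (hi l)).trans
      (Eq.trans h (congrArg some (ho _)).symm)
  · change n + 1 ≤ Polynomial.eval (x.map Sum.inl ++ y.map Sum.inr).length _
    rw [hl]
    have h4 := eval_mono p hsize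
    have h5 := (hs (ofList (l.reverse.map symTree))).trans (eval_mono s hsize)
    simp at h4 h5 hn ⊢
    omega

namespace SExp

theorem fold_size_le {F : SExp → SExp → SExp} {c : ℕ}
    (h : ∀ x s, (F x s).size ≤ s.size + c * x.size)
    (l s : SExp) : (fold F l s).size ≤ s.size + c * l.size := by
  induction l generalizing s with
  | nil => simp
  | cons x l _ ih =>
    refine (ih _).trans ?_
    have := h x s
    simp only [size_cons]
    nlinarith

theorem fold_ofList (F : SExp → SExp → SExp) (l : List SExp) (s : SExp) :
    fold F (ofList l) s = l.foldl (fun s x => F x s) s := by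
  induction l generalizing s with
  | nil => rfl
  | cons x l ih => exact ih _

/-- One step of reading the input from right to left. Certificate bits are the prefix code of a
tree, which is decoded by shifting and reducing on a stack of trees; input symbols are collected. -/
def splitStep (e s : SExp) : SExp :=
  sel e.hd
    (cons (sel e.tl.hd (cons (cons s.hd.hd s.hd.tl.hd) s.hd.tl.tl) (cons nil s.hd)) s.tl)
    (cons s.hd (cons e s.tl))

theorem size_splitStep_le (e s : SExp) : (splitStep e s).size ≤ s.size + 8 * e.size := by
  have h0 := size_pos e
  have h1 : s.hd.size + s.tl.size ≤ s.size + 1 := by cases s <;> simp; omega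
  have h2 : s.hd.hd.size + s.hd.tl.size ≤ s.hd.size + 1 := by cases s.hd <;> simp; omega
  have h3 : s.hd.tl.hd.size + s.hd.tl.tl.size ≤ s.hd.tl.size + 1 := by cases s.hd.tl <;> simp; omega
  unfold splitStep
  rcases e.hd with _ | ⟨_, _⟩
  · simp
    omega
  · rcases e.tl.hd with _ | ⟨_, _⟩ <;> simp <;> omega

/-- A certificate that is the code of a tree is decoded to that tree. -/
theorem foldl_splitStep_code (t : SExp) : ∀ F X,
    (t.code.reverse.map fun b => symTree (.inr b)).foldl (fun s x => splitStep x s) (cons F X) =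
      cons (cons t F) X := by
  induction t with
  | nil => intro F X; rfl
  | cons a b iha ihb =>
    intro F X
    simp only [code, List.reverse_cons, List.reverse_append, List.map_append, List.foldl_append,
      ihb, iha]
    rfl

theorem foldl_splitStep_symbols (x : List Symbol) : ∀ F X,
    (x.reverse.map fun b => symTree (.inl b)).foldl (fun s x => splitStep x s)
      (cons F (ofList X)) = cons F (ofList (x.map (fun b => symTree (.inl b)) ++ X)) := by
  induction x using List.reverseRecOn with
  | nil => intro F X; rfl
  | append_singleton x v ih =>
    intro F X
    rw [List.reverse_append]
    simp only [List.reverse_singleton, List.singleton_append, List.map_cons, List.foldl_cons]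
    exact (ih F (symTree (.inl v) :: X)).trans (by simp)

/-- Whatever the certificate, reading it does not affect the input string. -/
theorem foldl_splitStep_bits (y : List Bool) : ∀ F X, ∃ F',
    (y.map fun b => symTree (.inr b)).foldl (fun s x => splitStep x s) (cons F X) =
      cons F' X := by
  induction y with
  | nil => exact fun F X => ⟨F, rfl⟩
  | cons v y ih =>
    intro F X
    exact ih _ X

end SExp

/-- The input string as a tree. -/
def strTree (x : List Symbol) : SExp := .ofList (x.map fun b => symTree (.inl b))

open SExp in
/-- To show that a language is in NP it suffices to verify tree-valued certificates by a
polynomial-time function on trees. Only the trees needed as certificates have to be small. -/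
theorem inNP_of_polyTime {L : Language Symbol} {V : SExp → SExp} (hV : PolyTime V)
    (p : Polynomial ℕ)
    (hc : ∀ x ∈ L, ∃ t : SExp, t.size ≤ p.eval x.length ∧ V (.cons (strTree x) t) ≠ .nil)
    (hs : ∀ x t, V (.cons (strTree x) t) ≠ .nil → x ∈ L) : InNP L := by
  have hsplit : PolyTime fun t => fold splitStep t (.cons .nil .nil) :=
    PolyTime.fold (F := fun _ => splitStep) (f := fun _ => .nil) (by unfold splitStep; fun_prop)
      (8 * .X) (fun p l s => (fold_size_le size_splitStep_le l s).trans (by simp; omega))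
      (by fun_prop) (by fun_prop) (by fun_prop)
  have hW : PolyTime fun t => V (.cons (fold splitStep t (.cons .nil .nil)).tl
      (fold splitStep t (.cons .nil .nil)).hd.hd) := by fun_prop
  refine ⟨Bool, inferInstance, p, _, hW.tm2, fun x => ?_⟩
  have hx : ∀ F, (x.reverse.map fun b => symTree (.inl b)).foldl (fun s x => splitStep x s)
      (cons F nil) = cons F (strTree x) := fun F => by
    simpa [strTree, ofList] using foldl_splitStep_symbols x F []
  constructor
  · intro h
    obtain ⟨t, ht, hVt⟩ := hc x h
    refine ⟨t.code, ht, ?_⟩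
    have h1 := foldl_splitStep_code t nil nil
    have h2 : fold splitStep (ofList ((x.map Sum.inl ++ t.code.map Sum.inr).reverse.map symTree))
        (cons nil nil) = cons (cons t nil) (strTree x) := by
      rw [← hx, ← h1, fold_ofList]
      simp [Function.comp_def, List.map_reverse]
    simp only [h2]
    exact decide_eq_true hVt
  · rintro ⟨y, -, h⟩
    obtain ⟨F', h1⟩ := foldl_splitStep_bits y.reverse nil nil
    have h2 : fold splitStep (ofList ((x.map Sum.inl ++ y.map Sum.inr).reverse.map symTree))
        (cons nil nil) = cons F' (strTree x) := by
      rw [← hx, ← h1, fold_ofList]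
      simp [Function.comp_def, List.map_reverse]
    simp only [h2] at h
    exact hs x _ (of_decide_eq_true h)

end SlackCoNP

namespace SlackCoNP

open SExp

/-! ### List programs on trees -/

namespace SExp

/-- The list of trees on the right spine. -/
def toList : SExp → List SExp
  | nil => []
  | cons x l => x :: toList l

@[simp] theorem ofList_toList (t : SExp) : ofList t.toList = t := by
  induction t with
  | nil => rfl
  | cons x l _ ih => simp [toList, ofList, ih]

@[simp] theorem toList_ofList (l : List SExp) : (ofList l).toList = l := by
  induction l with
  | nil => rfl
  | cons x l ih => simp [toList, ofList, ih]

/-- The length of the right spine. -/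
def len : SExp → ℕ
  | nil => 0
  | cons _ l => len l + 1

@[simp] theorem len_nil : len nil = 0 := rfl
@[simp] theorem len_cons (x l : SExp) : len (cons x l) = len l + 1 := rfl

theorem len_tl (t : SExp) : t.tl.len = t.len - 1 := by cases t <;> simp

theorem len_lt_size (t : SExp) : t.len < t.size := by
  induction t with
  | nil => simp
  | cons x l _ ih => simp; omega

@[simp] theorem len_ofList (l : List SExp) : (ofList l).len = l.length := by
  induction l with
  | nil => rfl
  | cons x l ih => simp [ofList, ih]

/-- The `i`-th element of a list, `nil` beyond its end. -/
def get : SExp → ℕ → SExp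
  | t, 0 => t.hd
  | t, i + 1 => get t.tl i

@[simp] theorem get_zero (t : SExp) : get t 0 = t.hd := rfl
@[simp] theorem get_cons_succ (x t : SExp) (i : ℕ) : get (cons x t) (i + 1) = get t i := rfl
@[simp] theorem get_nil (i : ℕ) : get nil i = nil := by
  induction i with
  | zero => rfl
  | succ i ih => exact ih

theorem get_of_len_le {t : SExp} {i : ℕ} (h : t.len ≤ i) : get t i = nil := by
  induction i generalizing t with
  | zero => cases t <;> simp_all
  | succ i ih => cases t with
    | nil => simp
    | cons x t => exact ih (by simpa using h)

theorem get_eq_hd_iterate (t : SExp) (i : ℕ) : get t i = (tl^[i] t).hd := by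
  induction i generalizing t with
  | zero => rfl
  | succ i ih => exact ih t.tl

theorem get_ofList (l : List SExp) (i : ℕ) : get (ofList l) i = l.getD i nil := by
  induction l generalizing i with
  | nil => simp [ofList]
  | cons x l ih => cases i <;> simp [ofList, ih]

theorem size_ofList_le {l : List SExp} {N : ℕ} (h : ∀ x ∈ l, x.size ≤ N) :
    (ofList l).size ≤ l.length * (N + 1) + 1 := by
  induction l with
  | nil => simp [ofList]
  | cons x l ih =>
    have h1 := ih fun y hy => h y (by simp [hy])
    have h2 := h x (by simp)
    simp [ofList]
    nlinarith

/-- The reversal of the first list, followed by the second. -/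
def revApp (l s : SExp) : SExp := fold cons l s

@[simp] theorem revApp_nil (s : SExp) : revApp nil s = s := rfl

theorem toList_revApp (l s : SExp) : (revApp l s).toList = l.toList.reverse ++ s.toList := by
  unfold revApp
  induction l generalizing s with
  | nil => rfl
  | cons x l _ ih => simp [ih, toList]

theorem revApp_ofList (l : List SExp) (s : SExp) :
    revApp (ofList l) s = ofList (l.reverse ++ s.toList) := by
  rw [← ofList_toList (revApp _ _), toList_revApp, toList_ofList]

theorem revApp_revApp_nil (l s : SExp) : revApp (revApp l s) nil = revApp s l := by
  rw [← ofList_toList (revApp _ nil), ← ofList_toList (revApp s l)]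
  simp [toList_revApp, toList]

theorem len_revApp (l s : SExp) : (revApp l s).len = l.len + s.len := by
  unfold revApp
  induction l generalizing s with
  | nil => simp
  | cons x l _ ih => simp [ih]; omega

theorem size_revApp_le (l s : SExp) : (revApp l s).size ≤ l.size + s.size := by
  unfold revApp
  induction l generalizing s with
  | nil => simp
  | cons x l _ ih => have := ih (cons x s); simp at this ⊢; omega

/-- A map over a list with a running state `s` and a parameter `p`: the element `x` is replaced by
`o p x s`, and the state by `n p x s`. -/
def mapAcc (o n : SExp → SExp → SExp → SExp) (p : SExp) : SExp → SExp → SExp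
  | nil, _ => nil
  | cons x l, s => cons (o p x s) (mapAcc o n p l (n p x s))

@[simp] theorem mapAcc_nil (o n : SExp → SExp → SExp → SExp) (p s : SExp) :
    mapAcc o n p nil s = nil := rfl

@[simp] theorem mapAcc_cons (o n : SExp → SExp → SExp → SExp) (p x l s : SExp) :
    mapAcc o n p (cons x l) s = cons (o p x s) (mapAcc o n p l (n p x s)) := rfl

@[simp] theorem len_mapAcc (o n : SExp → SExp → SExp → SExp) (p l s : SExp) :
    (mapAcc o n p l s).len = l.len := by
  induction l generalizing s with
  | nil => rfl
  | cons x l _ ih => simp [ih]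

theorem get_mapAcc {o n : SExp → SExp → SExp → SExp} {p : SExp} {g : SExp → SExp}
    (hg : ∀ x s, n p x s = g s) {l : SExp} (s : SExp) {i : ℕ} (hi : i < l.len) :
    get (mapAcc o n p l s) i = o p (get l i) (g^[i] s) := by
  induction l generalizing s i with
  | nil => simp at hi
  | cons x l _ ih =>
    cases i with
    | zero => rfl
    | succ i => simpa [hg] using ih (n p x s) (by simpa using hi)

/-- One round of the loop that computes `mapAcc`, collecting the output in reverse order. -/
def mapAccStep (o n : SExp → SExp → SExp → SExp) (p x s : SExp) : SExp :=
  cons (n p x s.hd) (cons (o p x s.hd) s.tl)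

theorem fold_mapAccStep (o n : SExp → SExp → SExp → SExp) (p l s r : SExp) :
    (fold (mapAccStep o n p) l (cons s r)).tl = revApp (mapAcc o n p l s) r := by
  induction l generalizing s r with
  | nil => rfl
  | cons x l _ ih => exact ih _ _

end SExp

namespace PolyTime

variable {f g h : SExp → SExp}

@[fun_prop]
theorem revApp (hf : PolyTime f) (hg : PolyTime g) : PolyTime fun t => (f t).revApp (g t) :=
  PolyTime.fold (F := fun _ => SExp.cons) (f := fun _ => nil) (by fun_prop) .X
    (fun p l s => (size_revApp_le l s).trans (by simp)) (by fun_prop) hf hg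

/-- `mapAcc` is polynomial-time as soon as its state stays polynomially bounded. -/
theorem mapAcc {o n : SExp → SExp → SExp → SExp} (ho : PolyTime fun t => o t.hd t.tl.hd t.tl.tl)
    (hn : PolyTime fun t => n t.hd t.tl.hd t.tl.tl) (B : Polynomial ℕ)
    (hB : ∀ p l s, (SExp.fold (n p) l s).size ≤ B.eval (p.size + l.size + s.size))
    (hf : PolyTime f) (hg : PolyTime g) (hh : PolyTime h) :
    PolyTime fun t => SExp.mapAcc o n (f t) (g t) (h t) := by
  have hF : PolyTime fun t => mapAccStep o n t.hd t.tl.hd t.tl.tl :=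
    cons (comp (g := fun t => .cons t.hd (.cons t.tl.hd t.tl.tl.hd)) hn (by fun_prop))
      (cons (comp (g := fun t => .cons t.hd (.cons t.tl.hd t.tl.tl.hd)) ho (by fun_prop))
        (by fun_prop))
  obtain ⟨q, hq⟩ := ho.size_le
  have key : ∀ (p : SExp) (m N : ℕ) (l s : SExp), l.size ≤ m →
      (∀ l₁ : SExp, l₁.size ≤ l.size → (SExp.fold (n p) l₁ s.hd).size ≤ N) →
      (SExp.fold (mapAccStep o n p) l s).size ≤
        N + s.tl.size + 1 + l.size * (q.eval (p.size + m + N + 2) + 1) := by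
    intro p m N l
    induction l with
    | nil =>
      intro s _ hN
      have := hN .nil le_rfl
      cases s <;> simp at this ⊢ <;> omega
    | cons x l _ ih =>
      intro s hm hN
      have h1 := ih (mapAccStep o n p x s) (le_trans (by simp; omega) hm)
        fun l₁ hl₁ => hN (.cons x l₁) (by simpa using hl₁)
      have h2 := hN .nil (by simp)
      have h4 := (hq (.cons p (.cons x s.hd))).trans
        (eval_mono q (show _ ≤ p.size + m + N + 2 by simp at h2 hm ⊢; omega))
      have h5 := size_pos x
      simp only [mapAccStep, tl_cons, hd_cons, size_cons, fold_cons] at h1 h4 ⊢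
      nlinarith
  have hmain := PolyTime.fold (f := f) (g := g) (h := fun t => .cons (h t) .nil) hF
    (B + 2 * .X + 2 + .X * (q.comp (2 * .X + B + 2) + 1)) (fun p l s => by
      have hB' : ∀ l₁ : SExp, l₁.size ≤ l.size →
          (SExp.fold (n p) l₁ s.hd).size ≤ B.eval (p.size + l.size + s.size) := fun l₁ h₁ =>
        (hB ..).trans (eval_mono B (by have := size_hd_le s; omega))
      have h1 := key p l.size (B.eval (p.size + l.size + s.size)) l s le_rfl hB'
      have h2 : s.tl.size ≤ s.size := size_tl_le s
      have h3 : q.eval (p.size + l.size + B.eval (p.size + l.size + s.size) + 2) ≤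
          q.eval (2 * (p.size + l.size + s.size) + B.eval (p.size + l.size + s.size) + 2) :=
        eval_mono q (by omega)
      have h4 := Nat.mul_le_mul (show l.size ≤ p.size + l.size + s.size by omega)
        (Nat.add_le_add_right h3 1)
      simp only [Polynomial.eval_add, Polynomial.eval_mul, Polynomial.eval_comp,
        Polynomial.eval_ofNat, Polynomial.eval_X, Polynomial.eval_one]
      omega) hf hg (by fun_prop)
  have := (hmain.tl).revApp (const nil)
  simpa only [fold_mapAccStep, revApp_revApp_nil, revApp_nil] using this

end PolyTime

namespace SExp

/-- The truth value "true". -/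
def tt : SExp := cons nil nil

/-- Conjunction of truth values. -/
def and (x y : SExp) : SExp := sel x (sel y tt nil) nil

/-- Negation of truth values. -/
def not (x : SExp) : SExp := sel x nil tt

theorem and_ne_nil {x y : SExp} : and x y ≠ nil ↔ x ≠ nil ∧ y ≠ nil := by
  cases x <;> cases y <;> simp [and, tt]

theorem not_ne_nil {x : SExp} : not x ≠ nil ↔ x = nil := by
  cases x <;> simp [not, tt]

theorem size_and_le (x y : SExp) : (and x y).size ≤ 3 := by
  cases x <;> cases y <;> simp [and, tt]

/-- `all2 c p l m` tells whether the list `m` is not longer than `l` and the test `c p` accepts each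
element of `l` together with the corresponding element of `m` (which is `nil` beyond the end). -/
def all2 (c : SExp → SExp → SExp → SExp) (p l m : SExp) : SExp :=
  and (fold (fun x s => cons s.hd.tl (and s.tl (c p x s.hd.hd))) l (cons m tt)).tl
    (not (fold (fun x s => cons s.hd.tl (and s.tl (c p x s.hd.hd))) l (cons m tt)).hd)

theorem all2_ne_nil {c : SExp → SExp → SExp → SExp} {p l m : SExp} :
    all2 c p l m ≠ nil ↔ m.len ≤ l.len ∧ ∀ i < l.len, c p (get l i) (get m i) ≠ nil := by
  have key : ∀ l m b : SExp,
      (fold (fun x s => cons s.hd.tl (and s.tl (c p x s.hd.hd))) l (cons m b)).hd = tl^[l.len] m ∧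
      ((fold (fun x s => cons s.hd.tl (and s.tl (c p x s.hd.hd))) l (cons m b)).tl ≠ nil ↔
        b ≠ nil ∧ ∀ i < l.len, c p (get l i) (get m i) ≠ nil) := by
    intro l
    induction l with
    | nil => simp
    | cons x l _ ih =>
      intro m b
      obtain ⟨h1, h2⟩ := ih m.tl (and b (c p x m.hd))
      refine ⟨by simpa using h1, ?_⟩
      simp only [fold_cons, hd_cons, tl_cons, h2, and_ne_nil, and_assoc, len_cons]
      refine and_congr_right fun _ => ⟨?_, ?_⟩
      · rintro ⟨h3, h4⟩ (_ | i) hi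
        · exact h3
        · exact h4 i (by omega)
      · exact fun h => ⟨h 0 (by omega), fun i hi => h (i + 1) (by omega)⟩
  have hlen : ∀ (n : ℕ) (m : SExp), tl^[n] m = nil ↔ m.len ≤ n := by
    intro n
    induction n with
    | zero => intro m; cases m <;> simp
    | succ n ih => intro m; rw [Function.iterate_succ_apply, ih, len_tl]; omega
  obtain ⟨h1, h2⟩ := key l m tt
  rw [all2, and_ne_nil, not_ne_nil, h1, h2, hlen]
  simp [tt, and_comm]

/-- Apply `c p` to all elements of a list. -/
def map (c : SExp → SExp → SExp) (p l : SExp) : SExp :=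
  mapAcc (fun p x _ => c p x) (fun _ _ s => s) p l nil

@[simp] theorem len_map (c : SExp → SExp → SExp) (p l : SExp) : (map c p l).len = l.len :=
  len_mapAcc ..

theorem get_map (c : SExp → SExp → SExp) (p : SExp) {l : SExp} {i : ℕ} (h : i < l.len) :
    get (map c p l) i = c p (get l i) :=
  get_mapAcc (g := id) (fun _ _ => rfl) _ h

end SExp

namespace PolyTime

variable {f g h : SExp → SExp}

@[fun_prop]
theorem and (hf : PolyTime f) (hg : PolyTime g) : PolyTime fun t => SExp.and (f t) (g t) := by
  unfold SExp.and; fun_prop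

@[fun_prop]
theorem not (hf : PolyTime f) : PolyTime fun t => SExp.not (f t) := by
  unfold SExp.not; fun_prop

theorem all2 {c : SExp → SExp → SExp → SExp} (hc : PolyTime fun t => c t.hd t.tl.hd t.tl.tl)
    (hf : PolyTime f) (hg : PolyTime g) (hh : PolyTime h) :
    PolyTime fun t => SExp.all2 c (f t) (g t) (h t) := by
  have hF : PolyTime fun t => SExp.fold (fun x s => .cons s.hd.tl (.and s.tl (c (f t) x s.hd.hd)))
      (g t) (.cons (h t) tt) := by
    refine PolyTime.fold (F := fun p x s => .cons s.hd.tl (.and s.tl (c p x s.hd.hd)))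
      (f := f) (g := g) ?_ (4 * .X + 4) (fun p l s => ?_) hf hg (by fun_prop)
    · have h1 : PolyTime fun t => c t.hd t.tl.hd t.tl.tl.hd.hd :=
        comp (g := fun t => .cons t.hd (.cons t.tl.hd t.tl.tl.hd.hd)) hc (by fun_prop)
      exact cons (by fun_prop) (and (by fun_prop) h1)
    · refine (fold_size_le (c := 4) (fun x s => ?_) l s).trans ?_
      · have h1 := size_and_le s.tl (c p x s.hd.hd)
        have h2 := size_pos x
        have h3 := size_tl_le s.hd
        have h4 := size_hd_le s
        simp
        omega
      · simp
        omega
  exact and hF.tl hF.hd.not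

theorem map {c : SExp → SExp → SExp} (hc : PolyTime fun t => c t.hd t.tl)
    (hf : PolyTime f) (hg : PolyTime g) : PolyTime fun t => SExp.map c (f t) (g t) := by
  refine mapAcc (o := fun p x _ => c p x) (n := fun _ _ s => s) (h := fun _ => nil)
    (comp (g := fun t => .cons t.hd t.tl.hd) hc (by fun_prop)) (by fun_prop) .X (fun p l s => ?_)
    hf hg (by fun_prop)
  induction l <;> simp_all
  omega

end PolyTime

/-! ### Binary arithmetic on trees -/

namespace SExp

/-- The truth value of a tree as a number. -/
def bit : SExp → ℕ
  | nil => 0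
  | cons _ _ => 1

/-- The number denoted by a list of bits, least significant bit first. -/
def val : SExp → ℕ
  | nil => 0
  | cons b t => bit b + 2 * val t

@[simp] theorem val_nil : val nil = 0 := rfl
@[simp] theorem val_cons (b t : SExp) : val (cons b t) = bit b + 2 * val t := rfl
@[simp] theorem bit_nil : bit nil = 0 := rfl
@[simp] theorem bit_cons (a b : SExp) : bit (cons a b) = 1 := rfl

theorem bit_le (b : SExp) : bit b ≤ 1 := by cases b <;> simp

theorem val_eq (t : SExp) : val t = bit t.hd + 2 * val t.tl := by cases t <;> simp

theorem val_lt (t : SExp) : val t < 2 ^ len t := by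
  induction t with
  | nil => simp
  | cons b t _ ih =>
    have := bit_le b
    simp [pow_succ]
    omega

/-- The sum of three bits modulo two. -/
def xor3 (a b c : SExp) : SExp :=
  sel a (sel b (sel c tt nil) (sel c nil tt)) (sel b (sel c nil tt) (sel c tt nil))

/-- The carry of the sum of three bits. -/
def maj (a b c : SExp) : SExp := sel a (sel b tt (sel c tt nil)) (sel b (sel c tt nil) nil)

theorem bit_xor3_add (a b c : SExp) :
    bit (xor3 a b c) + 2 * bit (maj a b c) = bit a + bit b + bit c := by
  cases a <;> cases b <;> cases c <;> rfl

theorem size_xor3_le (a b c : SExp) : (xor3 a b c).size ≤ 3 := by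
  cases a <;> cases b <;> cases c <;> simp [xor3, tt]

theorem size_maj_le (a b c : SExp) : (maj a b c).size ≤ 3 := by
  cases a <;> cases b <;> cases c <;> simp [maj, tt]

/-- Binary addition; the state consists of the carry and the remaining bits of both summands. -/
def addCore : SExp → SExp → SExp :=
  mapAcc (fun _ _ s => xor3 s.hd s.tl.hd.hd s.tl.tl.hd)
    (fun _ _ s => cons (maj s.hd s.tl.hd.hd s.tl.tl.hd) (cons s.tl.hd.tl s.tl.tl.tl)) nil

/-- Addition of binary numbers. The first argument of `addCore` only counts the digits of
the result. -/
def add (a b : SExp) : SExp := addCore (cons nil (revApp a b)) (cons nil (cons a b))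

/-- The counter `l` has to be long enough for all digits of the sum. -/
theorem val_addCore (l c a b : SExp) :
    val (addCore l (cons c (cons a b))) = (bit c + val a + val b) % 2 ^ len l := by
  induction l generalizing c a b with
  | nil => simp [addCore, Nat.mod_one]
  | cons x l _ ih =>
    have h1 := ih (maj c a.hd b.hd) a.tl b.tl
    have h2 := bit_xor3_add c a.hd b.hd
    have h3 : bit c + val a + val b = bit (xor3 c a.hd b.hd) +
        2 * (bit (maj c a.hd b.hd) + val a.tl + val b.tl) := by
      rw [val_eq a, val_eq b]
      omega
    have h4 := bit_le (xor3 c a.hd b.hd)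
    simp only [addCore, mapAcc_cons, hd_cons, tl_cons, val_cons, len_cons] at h1 ⊢
    have h5 : (bit (xor3 c a.hd b.hd) + 2 * (bit (maj c a.hd b.hd) + val a.tl + val b.tl)) / 2 =
        bit (maj c a.hd b.hd) + val a.tl + val b.tl := by omega
    rw [h1, h3, pow_succ, mul_comm (2 ^ len l) 2, Nat.mod_mul, h5]
    omega

@[simp] theorem val_add (a b : SExp) : val (add a b) = val a + val b := by
  rw [add, val_addCore, Nat.mod_eq_of_lt]
  · simp
  · have h1 := val_lt a
    have h2 := val_lt b
    have h3 : 2 ^ len a ≤ 2 ^ (len a + len b) := Nat.pow_le_pow_right (by simp) (by omega)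
    have h4 : 2 ^ len b ≤ 2 ^ (len a + len b) := Nat.pow_le_pow_right (by simp) (by omega)
    simp [len_revApp, pow_succ]
    omega

theorem len_add (a b : SExp) : (add a b).len = a.len + b.len + 1 := by
  simp [add, addCore, len_revApp]

theorem size_add_le (a b : SExp) : (add a b).size ≤ 4 * (a.len + b.len + 1) + 1 := by
  have h : ∀ l s, (addCore l s).size ≤ 4 * l.len + 1 := by
    intro l
    induction l with
    | nil => simp [addCore]
    | cons x l _ ih =>
      intro s
      have h1 := ih (cons (maj s.hd s.tl.hd.hd s.tl.tl.hd) (cons s.tl.hd.tl s.tl.tl.tl))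
      have h2 := size_xor3_le s.hd s.tl.hd.hd s.tl.tl.hd
      simp [addCore] at h1 ⊢
      omega
  refine (h _ _).trans ?_
  simp [len_revApp]

/-- The sum of a list of numbers. -/
def sum (l : SExp) : SExp := fold add l nil

theorem val_sum (l : SExp) : val (sum l) = ∑ i ∈ Finset.range l.len, val (get l i) := by
  have h : ∀ l s, val (fold add l s) = val s + ∑ i ∈ Finset.range l.len, val (get l i) := by
    intro l
    induction l with
    | nil => simp
    | cons x l _ ih =>
      intro s
      rw [fold_cons, ih, val_add, len_cons, Finset.sum_range_succ']
      simp
      omega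
  rw [sum, h, val_nil, zero_add]

/-- Partial sums stay small: each summand adds at most its own length to the length of the sum, and
the digits of a sum are trees of constant size, whatever the digits of the summands are. -/
theorem size_fold_add_le (l s : SExp) : (fold add l s).size ≤ 5 * s.size + 4 * l.size := by
  have h : ∀ (K : ℕ) (l s : SExp), 1 ≤ K → s.size ≤ 4 * s.len + K →
      (fold add l s).size ≤ 4 * (s.len + l.size) + K := by
    intro K l
    induction l with
    | nil => intro s _ h; simp; omega
    | cons x l _ ih =>
      intro s hK hs
      have h1 := len_add x s
      have h2 := size_add_le x s
      have h3 := len_lt_size x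
      have h4 := ih (add x s) hK (by omega)
      simp
      omega
  have h1 := h s.size l s (size_pos s) (by omega)
  have := len_lt_size s
  omega

/-- The product of two numbers, as a sum of shifted copies of the second one. -/
def mul (a b : SExp) : SExp :=
  sum (mapAcc (fun _ x s => sel x s nil) (fun _ _ s => cons nil s) nil a b)

@[simp] theorem val_mul (a b : SExp) : val (mul a b) = val a * val b := by
  rw [mul, val_sum]
  induction a generalizing b with
  | nil => simp
  | cons x a _ ih =>
    have h := ih (cons nil b)
    simp only [mapAcc_cons, len_cons, Finset.sum_range_succ', get_cons_succ, get_zero, hd_cons, h]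
    cases x <;> simp <;> ring

/-- The scalar product of two vectors. -/
def dot (u v : SExp) : SExp := sum (mapAcc (fun _ x s => mul x s.hd) (fun _ _ s => s.tl) nil u v)

theorem val_dot (u v : SExp) :
    val (dot u v) = ∑ i ∈ Finset.range u.len, val (get u i) * val (get v i) := by
  rw [dot, val_sum, len_mapAcc]
  refine Finset.sum_congr rfl fun i hi => ?_
  rw [get_mapAcc (g := tl) (fun _ _ => rfl) _ (Finset.mem_range.1 hi), get_eq_hd_iterate v]
  simp

/-- One digit of the comparison of two numbers, starting from the least significant one. -/
def leStep (_x s : SExp) : SExp :=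
  cons (sel s.tl.hd.hd (sel s.tl.tl.hd s.hd nil) (sel s.tl.tl.hd tt s.hd))
    (cons s.tl.hd.tl s.tl.tl.tl)

/-- Comparison of two numbers. -/
def le (a b : SExp) : SExp := (fold leStep (revApp a b) (cons tt (cons a b))).hd

theorem le_ne_nil {a b : SExp} : le a b ≠ nil ↔ val a ≤ val b := by
  -- The carry `c` records the result of the comparison of the digits read so far.
  have key : ∀ l c a b : SExp, val a < 2 ^ len l → val b < 2 ^ len l →
      ((fold leStep l (cons c (cons a b))).hd ≠ nil ↔ val a < val b + bit c) := by
    intro l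
    induction l with
    | nil =>
      intro c a b ha hb
      have h1 : val a = 0 := by simpa using ha
      have h2 : val b = 0 := by simpa using hb
      cases c <;> simp [h1, h2]
    | cons x l _ ih =>
      intro c a b ha hb
      have ha' := val_eq a
      have hb' := val_eq b
      simp only [len_cons, pow_succ] at ha hb
      simp only [fold_cons, leStep, hd_cons, tl_cons]
      rw [ih _ _ _ (by omega) (by omega), ha', hb']
      have := bit_le c
      cases a.hd <;> cases b.hd <;> simp [tt] <;> omega
  have h1 : val a < 2 ^ len (revApp a b) :=
    (val_lt a).trans_le (Nat.pow_le_pow_right (by simp) (by rw [len_revApp]; omega))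
  have h2 : val b < 2 ^ len (revApp a b) :=
    (val_lt b).trans_le (Nat.pow_le_pow_right (by simp) (by rw [len_revApp]; omega))
  rw [le, key _ _ _ _ h1 h2]
  simp [tt]

/-- Equality of two numbers. -/
def eqv (a b : SExp) : SExp := and (le a b) (le b a)

theorem eqv_ne_nil {a b : SExp} : eqv a b ≠ nil ↔ val a = val b := by
  rw [eqv, and_ne_nil, le_ne_nil, le_ne_nil, le_antisymm_iff]

/-- The vector `yᵀ N` for a matrix `N` given as a list of rows. The length of the list `h` is the
number of columns; the running state of the loop consists of the rows without their first
entries. -/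
def vecMul (h N y : SExp) : SExp :=
  mapAcc (fun y _ s => dot (map (fun _ r => r.hd) nil s) y)
    (fun _ _ s => map (fun _ r => r.tl) nil s) y h N

@[simp] theorem len_vecMul (h N y : SExp) : (vecMul h N y).len = h.len := len_mapAcc ..

theorem val_get_vecMul (N y : SExp) {h : SExp} {j : ℕ} (hj : j < h.len) :
    val (get (vecMul h N y) j) =
      ∑ i ∈ Finset.range N.len, val (get (get N i) j) * val (get y i) := by
  rw [vecMul, get_mapAcc (g := fun s => map (fun _ r => r.tl) nil s) (fun _ _ => rfl) _ hj]
  have h1 : ∀ j, ((fun s => map (fun _ r => r.tl) nil s)^[j] N).len = N.len ∧ ∀ i < N.len,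
      get ((fun s => map (fun _ r => r.tl) nil s)^[j] N) i = tl^[j] (get N i) := by
    intro j
    induction j with
    | zero => simp
    | succ j ih =>
      refine ⟨by rw [Function.iterate_succ_apply', len_map, ih.1], fun i hi => ?_⟩
      rw [Function.iterate_succ_apply', get_map _ _ (by rwa [ih.1]), ih.2 i hi,
        Function.iterate_succ_apply']
  rw [val_dot, len_map, (h1 j).1]
  refine Finset.sum_congr rfl fun i hi => ?_
  have hi := Finset.mem_range.1 hi
  rw [get_map _ _ (by rwa [(h1 j).1]), (h1 j).2 i hi, get_eq_hd_iterate (get N i)]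

end SExp

namespace PolyTime

variable {f g h : SExp → SExp}

@[fun_prop]
theorem add (hf : PolyTime f) (hg : PolyTime g) : PolyTime fun t => SExp.add (f t) (g t) := by
  refine mapAcc (f := fun _ => nil) (g := fun t => .cons nil (.revApp (f t) (g t)))
    (h := fun t => .cons nil (.cons (f t) (g t)))
    (o := fun _ _ s => xor3 s.hd s.tl.hd.hd s.tl.tl.hd)
    (n := fun _ _ s => .cons (maj s.hd s.tl.hd.hd s.tl.tl.hd) (.cons s.tl.hd.tl s.tl.tl.tl))
    (by unfold xor3; fun_prop) (by unfold maj; fun_prop) (6 * .X + 5) (fun p l s => ?_)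
    (by fun_prop) (by fun_prop) (by fun_prop)
  refine (fold_size_le (c := 6) (fun x s => ?_) l s).trans ?_
  · have h1 := size_maj_le s.hd s.tl.hd.hd s.tl.tl.hd
    have h2 : s.tl.hd.tl.size ≤ s.tl.hd.size := size_tl_le _
    have h3 : s.tl.tl.tl.size ≤ s.tl.tl.size := size_tl_le _
    have h4 : s.hd.size + s.tl.size ≤ s.size + 1 := by cases s <;> simp; omega
    have h5 : s.tl.hd.size + s.tl.tl.size ≤ s.tl.size + 1 := by cases s.tl <;> simp; omega
    have h6 := size_pos x
    have h7 := size_pos s.hd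
    simp
    omega
  · simp
    omega

@[fun_prop]
theorem sum (hf : PolyTime f) : PolyTime fun t => SExp.sum (f t) :=
  PolyTime.fold (F := fun _ => SExp.add) (f := fun _ => nil) (by fun_prop) (5 * .X)
    (fun p l s => (size_fold_add_le l s).trans (by simp; omega)) (by fun_prop) hf (by fun_prop)

@[fun_prop]
theorem mul (hf : PolyTime f) (hg : PolyTime g) : PolyTime fun t => SExp.mul (f t) (g t) := by
  refine sum (mapAcc (f := fun _ => nil) (by fun_prop) (by fun_prop) (2 * .X) (fun p l s => ?_)
    (by fun_prop) hf hg)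
  refine (fold_size_le (c := 2) (fun x s => ?_) l s).trans ?_
  · have := size_pos x
    simp
    omega
  · simp
    omega

theorem size_fold_tl_le (l s : SExp) : (SExp.fold (fun _ s => s.tl) l s).size ≤ s.size := by
  induction l generalizing s with
  | nil => simp
  | cons x l _ ih => exact (ih s.tl).trans (size_tl_le s)

@[fun_prop]
theorem dot (hf : PolyTime f) (hg : PolyTime g) : PolyTime fun t => SExp.dot (f t) (g t) :=
  sum (mapAcc (f := fun _ => nil) (by fun_prop) (by fun_prop) .X
    (fun p l s => (size_fold_tl_le l s).trans (by simp)) (by fun_prop) hf hg)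

@[fun_prop]
theorem le (hf : PolyTime f) (hg : PolyTime g) : PolyTime fun t => SExp.le (f t) (g t) := by
  refine hd (PolyTime.fold (F := fun _ => leStep) (f := fun _ => nil) (by unfold leStep; fun_prop)
    (6 * .X + 5) (fun p l s => ?_) (by fun_prop) (by fun_prop) (by fun_prop))
  refine (fold_size_le (c := 6) (fun x s => ?_) l s).trans ?_
  · have h1 : (SExp.sel s.tl.hd.hd (.sel s.tl.tl.hd s.hd nil) (.sel s.tl.tl.hd tt s.hd)).size ≤
        s.hd.size + 2 := by
      have := size_pos s.hd
      cases s.tl.hd.hd <;> cases s.tl.tl.hd <;> simp [tt]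
      omega
    have h2 : s.tl.hd.tl.size ≤ s.tl.hd.size := size_tl_le _
    have h3 : s.tl.tl.tl.size ≤ s.tl.tl.size := size_tl_le _
    have h4 : s.hd.size + s.tl.size ≤ s.size + 1 := by cases s <;> simp; omega
    have h5 : s.tl.hd.size + s.tl.tl.size ≤ s.tl.size + 1 := by cases s.tl <;> simp; omega
    have h6 := size_pos x
    simp [leStep]
    omega
  · simp
    omega

@[fun_prop]
theorem eqv (hf : PolyTime f) (hg : PolyTime g) : PolyTime fun t => SExp.eqv (f t) (g t) := by
  unfold SExp.eqv; fun_prop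

@[fun_prop]
theorem vecMul (hh : PolyTime h) (hf : PolyTime f) (hg : PolyTime g) :
    PolyTime fun t => SExp.vecMul (h t) (f t) (g t) := by
  have h1 : PolyTime fun t => SExp.map (fun _ r => r.hd) nil t.tl.tl :=
    map (f := fun _ => nil) (by fun_prop) (by fun_prop) (by fun_prop)
  have h2 : PolyTime fun t => SExp.map (fun _ r => r.tl) nil t.tl.tl :=
    map (f := fun _ => nil) (by fun_prop) (by fun_prop) (by fun_prop)
  refine mapAcc (dot h1 (by fun_prop)) h2 .X (fun p l s => ?_) hg hh hf
  have h3 : ∀ s, (SExp.map (fun _ r => r.tl) nil s).size ≤ s.size := by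
    intro s
    unfold SExp.map
    induction s with
    | nil => simp
    | cons x s _ ih =>
      have := size_tl_le x
      simp at ih ⊢
      omega
  have h4 : ∀ l s, (SExp.fold (fun _ s => SExp.map (fun _ r => r.tl) nil s) l s).size ≤ s.size := by
    intro l
    induction l with
    | nil => simp
    | cons x l _ ih => exact fun s => (ih _).trans (h3 s)
  exact (h4 l s).trans (by simp)

end PolyTime

end SlackCoNP

namespace SlackCoNP

open SExp

/-! ### Parsing the input -/

/-- A row of fractions, numerators and denominators being given by their binary digits. -/
abbrev RawRow := List (List Bool × List Bool)

/-- The states of the automaton that reads the code of a matrix of nonnegative fractions from right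
to left: at the right end (`start`), after a semicolon or inside the header (`semi`, with the number
of digits of the header read so far), inside a denominator (`den`), and inside a numerator (`num`).
The automaton collects the entries to the right of its position. -/
inductive PState
  | fail
  | start
  | semi (h : ℕ) (rows : List RawRow)
  | den (bits : List Bool) (row : RawRow) (rows : List RawRow)
  | num (bits d : List Bool) (row : RawRow) (rows : List RawRow)

/-- The transitions of the automaton. A leading zero of a number, an empty denominator, and
a minus sign make it fail. -/
def PState.step : Symbol → PState → PState
  | .semicolon, .start => .semi 0 []
  | .bit true, .semi h rows => .semi (h + 1) rows
  | .comma, .semi 0 rows => .den [] [] rows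
  | .semicolon, .semi 0 rows => .semi 0 ([] :: rows)
  | .bit b, .den bits row rows => if bits = [] ∧ b = false then .fail else .den (b :: bits) row rows
  | .slash, .den bits row rows => if bits = [] then .fail else .num [] bits row rows
  | .bit b, .num bits d row rows =>
    if bits = [] ∧ b = false then .fail else .num (b :: bits) d row rows
  | .comma, .num bits d row rows => .den [] ((bits, d) :: row) rows
  | .semicolon, .num bits d row rows => .semi 0 (((bits, d) :: row) :: rows)
  | _, _ => .fail

/-- The state of the automaton at the left end of a string. -/
def PState.run (w : List Symbol) : PState := w.foldr PState.step .start

/-- The string of an entry, without sign. -/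
def entryStr (e : List Bool × List Bool) : List Symbol :=
  e.1.map Symbol.bit ++ .slash :: (e.2.map Symbol.bit ++ [.comma])

/-- The string of a row. -/
def rowStr (r : RawRow) : List Symbol := r.flatMap entryStr

/-- The string of a list of rows. -/
def rowsStr (l : List RawRow) : List Symbol := l.flatMap fun r => rowStr r ++ [.semicolon]

/-- A string of digits without superfluous zeros. -/
def Canonical (l : List Bool) : Prop := l.getLast? ≠ some false

/-- Entries written in the prescribed form. -/
def GoodEntry (e : List Bool × List Bool) : Prop :=
  Canonical e.1 ∧ Canonical e.2 ∧ e.2 ≠ []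

/-- Rows all of whose entries are written in the prescribed form. -/
def GoodRows (l : List RawRow) : Prop := ∀ r ∈ l, ∀ e ∈ r, GoodEntry e

theorem canonical_nil : Canonical [] := by simp [Canonical]

theorem canonical_cons {b : Bool} {l : List Bool} :
    Canonical (b :: l) ↔ Canonical l ∧ ¬(l = [] ∧ b = false) := by
  cases l <;> simp [Canonical]

/-- A state that is not `fail` determines the string that has been read. -/
def PState.Sound (w : List Symbol) : PState → Prop
  | .fail => True
  | .start => w = []
  | .semi h rows => GoodRows rows ∧
      w = List.replicate h (Symbol.bit true) ++ .semicolon :: rowsStr rows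
  | .den bits row rows => Canonical bits ∧ GoodRows (row :: rows) ∧
      w = bits.map Symbol.bit ++ .comma :: (rowStr row ++ .semicolon :: rowsStr rows)
  | .num bits d row rows => GoodRows (((bits, d) :: row) :: rows) ∧
      w = rowStr ((bits, d) :: row) ++ .semicolon :: rowsStr rows

theorem PState.sound_run (w : List Symbol) : (run w).Sound w := by
  induction w with
  | nil => rfl
  | cons a w ih =>
    change (step a (run w)).Sound (a :: w)
    generalize run w = s at ih
    cases s with
    | fail => rcases a with (_ | _) | _ | _ | _ | _ <;> trivial
    | start =>
      have hw : w = [] := ih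
      subst hw
      rcases a with (_ | _) | _ | _ | _ | _ <;> try trivial
      exact ⟨by simp [GoodRows], by simp [rowsStr]⟩
    | semi h rows =>
      obtain ⟨h1, rfl⟩ := ih
      rcases a with (_ | _) | _ | _ | _ | _
      · trivial
      · exact ⟨h1, rfl⟩
      · trivial
      · trivial
      · cases h with
        | zero => exact ⟨canonical_nil, by simpa [GoodRows] using h1, rfl⟩
        | succ h => trivial
      · cases h with
        | zero => exact ⟨by simpa [GoodRows] using h1, rfl⟩
        | succ h => trivial
    | den bits row rows =>
      obtain ⟨h1, h2, rfl⟩ := ih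
      rcases a with b | _ | _ | _ | _
      · simp only [step]
        split_ifs with hb
        · trivial
        · exact ⟨canonical_cons.2 ⟨h1, hb⟩, h2, rfl⟩
      · trivial
      · simp only [step]
        split_ifs with hb
        · trivial
        · refine ⟨?_, by simp [rowStr, entryStr]⟩
          simp only [GoodRows, List.mem_cons, forall_eq_or_imp] at h2 ⊢
          exact ⟨⟨⟨canonical_nil, h1, hb⟩, h2.1⟩, h2.2⟩
      · trivial
      · trivial
    | num bits d row rows =>
      obtain ⟨h2, rfl⟩ := ih
      rcases a with b | _ | _ | _ | _
      · simp only [step]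
        split_ifs with hb
        · trivial
        · refine ⟨?_, by simp [rowStr, entryStr]⟩
          simp only [GoodRows, List.mem_cons, forall_eq_or_imp] at h2 ⊢
          exact ⟨⟨⟨canonical_cons.2 ⟨h2.1.1.1, hb⟩, h2.1.1.2⟩, h2.1.2⟩, h2.2⟩
      · trivial
      · trivial
      · exact ⟨canonical_nil, h2, rfl⟩
      · exact ⟨h2, by simp [rowsStr]⟩

theorem PState.run_append (w w' : List Symbol) :
    run (w ++ w') = w.foldr step (run w') := by simp [run]

theorem PState.foldr_den {bits : List Bool} (h : Canonical bits) (row rows) :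
    (bits.map Symbol.bit).foldr step (den [] row rows) = den bits row rows := by
  induction bits with
  | nil => rfl
  | cons b bits ih =>
    rw [canonical_cons] at h
    simp [ih h.1, step]
    simpa using h.2

theorem PState.foldr_num {bits : List Bool} (h : Canonical bits) (d row rows) :
    (bits.map Symbol.bit).foldr step (num [] d row rows) = num bits d row rows := by
  induction bits with
  | nil => rfl
  | cons b bits ih =>
    rw [canonical_cons] at h
    simp [ih h.1, step]
    simpa using h.2

theorem PState.foldr_entry {e : List Bool × List Bool} (h : GoodEntry e) {s : PState} {row rows}
    (hs : step .comma s = den [] row rows) :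
    (entryStr e).foldr step s = num e.1 e.2 row rows := by
  simp only [entryStr, List.foldr_append, List.foldr_cons, List.foldr_nil, hs, foldr_den h.2.1]
  simp only [step, if_neg h.2.2, foldr_num h.1]

theorem PState.foldr_row (e : List Bool × List Bool) (row : RawRow)
    (h : ∀ e' ∈ e :: row, GoodEntry e') (rows) :
    (rowStr (e :: row)).foldr step (semi 0 rows) = num e.1 e.2 row rows := by
  induction row generalizing e with
  | nil => simpa [rowStr] using foldr_entry (h e (by simp)) rfl
  | cons e' row ih =>
    have h1 := ih e' fun x hx => h x (by simp_all)
    rw [rowStr, List.flatMap_cons, List.foldr_append]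
    rw [rowStr] at h1
    rw [h1]
    exact foldr_entry (h e (by simp)) rfl

theorem PState.run_rows (l : List RawRow) (h : GoodRows l) :
    run (.semicolon :: rowsStr l) = semi 0 l := by
  induction l with
  | nil => rfl
  | cons r l ih =>
    have h1 := ih fun r' hr' => h r' (by simp [hr'])
    have h2 : Symbol.semicolon :: rowsStr (r :: l) =
        (.semicolon :: rowStr r) ++ (.semicolon :: rowsStr l) := by simp [rowsStr]
    rw [h2, run_append, h1]
    cases r with
    | nil => rfl
    | cons e r => rw [List.foldr_cons, foldr_row e r (h _ (by simp))]; rfl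

theorem PState.run_matrix (q : ℕ) (l : List RawRow) (h : GoodRows l) :
    run (List.replicate q (Symbol.bit true) ++ .semicolon :: rowsStr l) = semi q l := by
  rw [run_append, run_rows l h]
  induction q with
  | zero => rfl
  | succ q ih => rw [List.replicate_succ, List.foldr_cons, ih]; rfl

/-! ### Binary notation -/

/-- The number denoted by binary digits, least significant digit first. -/
def bval : List Bool → ℕ
  | [] => 0
  | b :: l => b.toNat + 2 * bval l

theorem bval_encodeNat (n : ℕ) : bval (Computability.encodeNat n) = n := by
  have h : ∀ p : PosNum, bval (Computability.encodePosNum p) = p := by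
    intro p
    induction p with
    | one => rfl
    | bit0 p ih => simp [Computability.encodePosNum, bval, ih]; omega
    | bit1 p ih => simp [Computability.encodePosNum, bval, ih]; omega
  have h' : ∀ m : Num, bval (Computability.encodeNum m) = m := by
    intro m
    cases m with
    | zero => rfl
    | pos p => exact h p
  rw [Computability.encodeNat, h']
  simp

theorem canonical_encodeNat (n : ℕ) : Canonical (Computability.encodeNat n) := by
  have h : ∀ p : PosNum, Canonical (Computability.encodePosNum p) := by
    intro p
    induction p with
    | one => simp [Computability.encodePosNum, Canonical]
    | bit0 p ih =>
      exact canonical_cons.2 ⟨ih, fun h => Computability.encodePosNum_nonempty p h.1⟩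
    | bit1 p ih => exact canonical_cons.2 ⟨ih, by simp⟩
  rw [Computability.encodeNat]
  cases (n : Num) with
  | zero => exact canonical_nil
  | pos p => exact h p

theorem bval_pos {l : List Bool} (hl : Canonical l) (h : l ≠ []) : 0 < bval l := by
  induction l with
  | nil => exact absurd rfl h
  | cons b l ih =>
    rw [canonical_cons] at hl
    by_cases h' : l = []
    · subst h'
      simp at hl
      simp [bval, hl.2]
    · have := ih hl.1 h'
      simp [bval, this]

/-- Binary notation without superfluous zeros is unique. -/
theorem bval_injective {l l' : List Bool} (hl : Canonical l) (hl' : Canonical l')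
    (h : bval l = bval l') : l = l' := by
  induction l generalizing l' with
  | nil =>
    by_contra h'
    have := bval_pos hl' (Ne.symm h')
    simp [bval] at h
    omega
  | cons b l ih =>
    cases l' with
    | nil =>
      have := bval_pos hl (by simp)
      simp only [bval] at h this
      omega
    | cons b' l' =>
      simp only [bval] at h
      have h1 := Bool.toNat_le b
      have h2 := Bool.toNat_le b'
      have h3 : b = b' := by cases b <;> cases b' <;> simp at h ⊢ <;> omega
      rw [canonical_cons] at hl hl'
      rw [h3, ih hl.1 hl'.1 (by subst h3; omega)]

theorem encodeNat_bval {l : List Bool} (hl : Canonical l) : Computability.encodeNat (bval l) = l :=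
  bval_injective (canonical_encodeNat _) hl (bval_encodeNat _)

/-- The digits of all entries of a matrix, disregarding signs. -/
def FractionMatrix.raw {p q : ℕ} (F : FractionMatrix p q) : List RawRow :=
  List.ofFn fun i => List.ofFn fun j =>
    (Computability.encodeNat (F.num i j).natAbs, Computability.encodeNat (F.den i j))

theorem FractionMatrix.goodRows_raw {p q : ℕ} (F : FractionMatrix p q) : GoodRows F.raw := by
  intro r hr e he
  obtain ⟨i, rfl⟩ := (List.mem_ofFn' _ _).1 hr
  obtain ⟨j, rfl⟩ := (List.mem_ofFn' _ _).1 he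
  refine ⟨canonical_encodeNat _, canonical_encodeNat _, fun h => ?_⟩
  have h1 := bval_encodeNat (F.den i j)
  have h2 := F.den_pos i j
  simp only at h
  rw [h] at h1
  simp [bval] at h1
  omega

theorem FractionMatrix.encode_eq {p q : ℕ} (F : FractionMatrix p q) (hF : ∀ i j, 0 ≤ F.num i j) :
    F.encode = List.replicate q (Symbol.bit true) ++ .semicolon :: rowsStr F.raw := by
  have h : ∀ i j, ¬ F.num i j < 0 := fun i j => not_lt.2 (hF i j)
  simp [FractionMatrix.encode, FractionMatrix.raw, rowsStr, rowStr, entryStr, List.flatMap,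
    List.map_ofFn, Function.comp_def, encodeInt, encodeNat, h]

/-- The automaton reads off the digits of a matrix with nonnegative entries. -/
theorem PState.run_encode {p q : ℕ} (F : FractionMatrix p q) (hF : ∀ i j, 0 ≤ F.num i j) :
    run F.encode = semi q F.raw := by
  rw [F.encode_eq hF, run_matrix _ _ F.goodRows_raw]

/-- If the automaton ends in the state of the header and all rows have the length given there, then
the string is the code of a matrix. -/
theorem PState.exists_of_run_eq {w : List Symbol} {q : ℕ} {rows : List RawRow}
    (h : run w = semi q rows) (hq : ∀ r ∈ rows, r.length = q) :
    ∃ (p : ℕ) (F : FractionMatrix p q), (∀ i j, 0 ≤ F.num i j) ∧ F.encode = w ∧ F.raw = rows := by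
  have h1 := sound_run w
  rw [h] at h1
  obtain ⟨hg, hw⟩ := h1
  have hl : ∀ i : Fin rows.length, (rows[i]).length = q := fun i => hq _ (List.getElem_mem i.2)
  have hge : ∀ (i : Fin rows.length) (j : Fin q),
      GoodEntry (rows[i][j]'(by rw [hl]; exact j.2)) := fun i j =>
    hg _ (List.getElem_mem i.2) _ (List.getElem_mem _)
  let F : FractionMatrix rows.length q :=
    { num := fun i j => bval (rows[i][j]'(by rw [hl]; exact j.2)).1
      den := fun i j => bval (rows[i][j]'(by rw [hl]; exact j.2)).2
      den_pos := fun i j => bval_pos (hge i j).2.1 (hge i j).2.2 }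
  have hraw : F.raw = rows := by
    refine List.ext_getElem (by simp [FractionMatrix.raw]) fun i h1 h2 => ?_
    refine List.ext_getElem (by simp [FractionMatrix.raw]; exact (hl ⟨i, h2⟩).symm)
      fun j h3 h4 => ?_
    have hj : j < q := by rw [← hl ⟨i, h2⟩]; exact h4
    have h5 := hge ⟨i, h2⟩ ⟨j, hj⟩
    simp only [Fin.getElem_fin] at h5
    simp [FractionMatrix.raw, F, encodeNat_bval h5.1, encodeNat_bval h5.2.1]
  refine ⟨rows.length, F, fun i j => Int.natCast_nonneg _, ?_, hraw⟩
  rw [F.encode_eq fun i j => Int.natCast_nonneg _, hraw, hw]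

/-! ### The parser as a program on trees -/

/-- Binary digits as a tree. -/
def bitsTree (l : List Bool) : SExp := ofList (l.map ofBool)

/-- A row as a tree. -/
def rowTree (r : RawRow) : SExp := ofList (r.map fun e => cons (bitsTree e.1) (bitsTree e.2))

/-- A list of rows as a tree. -/
def rowsTree (l : List RawRow) : SExp := ofList (l.map rowTree)

/-- A list of `n` entries `nil`. -/
def unary : ℕ → SExp
  | 0 => nil
  | n + 1 => cons nil (unary n)

theorem len_unary (n : ℕ) : (unary n).len = n := by
  induction n with
  | zero => rfl
  | succ n ih => simp [unary, ih]

/-- The tree of a state of the parser with the given components. The first one numbers the kind of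
the state. -/
def mkState (k a b row rows : SExp) : SExp := cons k (cons a (cons b (cons row rows)))

/-- A state of the parser as a tree. -/
def PState.tree : PState → SExp
  | .fail => nil
  | .start => mkState (unary 1) nil nil nil nil
  | .semi h rows => mkState (unary 2) (unary h) nil nil (rowsTree rows)
  | .den bits row rows => mkState (unary 3) (bitsTree bits) nil (rowTree row) (rowsTree rows)
  | .num bits d row rows =>
    mkState (unary 4) (bitsTree bits) (bitsTree d) (rowTree row) (rowsTree rows)

/-- Case distinction by input symbols: digit, slash, comma, semicolon. -/
def selSym (e b sl co se : SExp) : SExp :=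
  sel e.tl.tl.hd (sel e.tl.tl.tl b sl) (sel e.tl.tl.tl (sel e.tl.hd co se) nil)

/-- Case distinction by states. -/
def selState (s start semi den num : SExp) : SExp :=
  sel s.hd (sel s.hd.tl (sel s.hd.tl.tl (sel s.hd.tl.tl.tl num den) semi) start) nil

/-- The transition function of the parser on trees. -/
def parseStep (e s : SExp) : SExp :=
  selState s
    (selSym e nil nil nil (mkState (unary 2) nil nil nil nil))
    (selSym e (sel e.tl.hd (mkState (unary 2) (cons nil s.tl.hd) nil nil s.tl.tl.tl.tl) nil) nil
      (sel s.tl.hd nil (mkState (unary 3) nil nil nil s.tl.tl.tl.tl))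
      (sel s.tl.hd nil (mkState (unary 2) nil nil nil (cons nil s.tl.tl.tl.tl))))
    (selSym e
      (sel (sel s.tl.hd tt e.tl.hd)
        (mkState (unary 3) (cons e.tl.hd s.tl.hd) nil s.tl.tl.tl.hd s.tl.tl.tl.tl) nil)
      (sel s.tl.hd (mkState (unary 4) nil s.tl.hd s.tl.tl.tl.hd s.tl.tl.tl.tl) nil) nil nil)
    (selSym e
      (sel (sel s.tl.hd tt e.tl.hd)
        (mkState (unary 4) (cons e.tl.hd s.tl.hd) s.tl.tl.hd s.tl.tl.tl.hd s.tl.tl.tl.tl) nil) nil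
      (mkState (unary 3) nil nil (cons (cons s.tl.hd s.tl.tl.hd) s.tl.tl.tl.hd) s.tl.tl.tl.tl)
      (mkState (unary 2) nil nil nil
        (cons (cons (cons s.tl.hd s.tl.tl.hd) s.tl.tl.tl.hd) s.tl.tl.tl.tl)))

theorem parseStep_tree (a : Symbol) (s : PState) :
    parseStep (symTree (.inl a)) s.tree = (s.step a).tree := by
  cases s with
  | fail => rcases a with (_ | _) | _ | _ | _ | _ <;> rfl
  | start => rcases a with (_ | _) | _ | _ | _ | _ <;> rfl
  | semi h rows => cases h <;> rcases a with (_ | _) | _ | _ | _ | _ <;> rfl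
  | den bits row rows => cases bits <;> rcases a with (_ | _) | _ | _ | _ | _ <;> rfl
  | num bits d row rows => cases bits <;> rcases a with (_ | _) | _ | _ | _ | _ <;> rfl

theorem size_sel_le {c a b : SExp} {K : ℕ} (ha : a.size ≤ K) (hb : b.size ≤ K) :
    (sel c a b).size ≤ K := by
  cases c <;> simpa

theorem size_parseStep_le (e s : SExp) : (parseStep e s).size ≤ s.size + 40 * e.size := by
  have h0 := size_pos e
  have h1 : s.hd.size + s.tl.size ≤ s.size + 1 := by cases s <;> simp; omega
  have h2 : s.tl.hd.size + s.tl.tl.size ≤ s.tl.size + 1 := by cases s.tl <;> simp; omega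
  have h3 : s.tl.tl.hd.size + s.tl.tl.tl.size ≤ s.tl.tl.size + 1 := by
    cases s.tl.tl <;> simp; omega
  have h4 : s.tl.tl.tl.hd.size + s.tl.tl.tl.tl.size ≤ s.tl.tl.tl.size + 1 := by
    cases s.tl.tl.tl <;> simp; omega
  have h5 : e.tl.hd.size ≤ e.size := (size_hd_le _).trans (size_tl_le _)
  have h6 := size_pos s.hd
  have h7 := size_pos s.tl.hd
  have h8 := size_pos s.tl.tl.hd
  have h9 := size_pos s.tl.tl.tl.hd
  have h10 := size_pos s.tl.tl.tl.tl
  unfold parseStep selState selSym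
  repeat' apply size_sel_le
  all_goals
    simp only [mkState, unary, size_cons, size_nil]
    omega

/-- The program that parses the input string. -/
def parse (x : SExp) : SExp :=
  fold parseStep (revApp x nil) (mkState (unary 1) nil nil nil nil)

theorem parse_strTree (w : List Symbol) : parse (strTree w) = (PState.run w).tree := by
  have h : ∀ w : List Symbol, (w.foldr (fun b s => parseStep (symTree (.inl b)) s)
      PState.start.tree) = (PState.run w).tree := by
    intro w
    induction w with
    | nil => rfl
    | cons a w ih => rw [List.foldr_cons, ih, parseStep_tree]; rfl
  rw [← h, parse, strTree, revApp_ofList, fold_ofList]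
  simp [toList, List.foldl_reverse, List.foldr_map, PState.tree]

@[fun_prop]
theorem PolyTime.parse {f : SExp → SExp} (hf : PolyTime f) :
    PolyTime fun t => SlackCoNP.parse (f t) := by
  refine PolyTime.fold (F := fun _ => parseStep) (f := fun _ => nil) ?_ (40 * .X)
    (fun p l s => (fold_size_le size_parseStep_le l s).trans (by simp; omega))
    (by fun_prop) (by fun_prop) (by fun_prop)
  unfold parseStep selState selSym mkState
  fun_prop

/-- The test whether the parser has ended in the header and all rows have the same length as the
header. -/
def parseOk (s : SExp) : SExp :=
  and (sel s.hd (sel s.hd.tl (sel s.hd.tl.tl (sel s.hd.tl.tl.tl nil nil) tt) nil) nil)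
    (all2 (fun h r _ => and (all2 (fun _ _ _ => tt) nil h r) (all2 (fun _ _ _ => tt) nil r h))
      s.tl.hd s.tl.tl.tl.tl nil)

@[fun_prop]
theorem PolyTime.parseOk {f : SExp → SExp} (hf : PolyTime f) :
    PolyTime fun t => SlackCoNP.parseOk (f t) := by
  unfold SlackCoNP.parseOk
  refine PolyTime.and (by fun_prop) (PolyTime.all2 (PolyTime.and
    (PolyTime.all2 (f := fun _ => nil) (by fun_prop) (by fun_prop) (by fun_prop) (by fun_prop))
    (PolyTime.all2 (f := fun _ => nil) (by fun_prop) (by fun_prop) (by fun_prop) (by fun_prop)))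
    (by fun_prop) (by fun_prop) (by fun_prop))

theorem get_rowsTree (l : List RawRow) (i : ℕ) :
    get (rowsTree l) i = rowTree (l.getD i []) := by
  rw [rowsTree, get_ofList, List.getD_eq_getElem?_getD, List.getD_eq_getElem?_getD,
    List.getElem?_map]
  cases l[i]? <;> rfl

theorem parseOk_tree {s : PState} : parseOk s.tree ≠ nil ↔
    ∃ q rows, s = .semi q rows ∧ ∀ r ∈ rows, r.length = q := by
  cases s with
  | semi q rows =>
    have h1 : ∀ r : RawRow, (rowTree r).len = r.length := fun r => by simp [rowTree]
    have h2 : (rowsTree rows).len = rows.length := by simp [rowsTree]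
    simp only [parseOk, PState.tree, mkState, unary, hd_cons, tl_cons, sel_cons, and_ne_nil,
      all2_ne_nil, len_unary, h1, h2, get_rowsTree]
    simp only [sel_nil, tt, ne_eq, reduceCtorEq, not_false_eq_true, implies_true, and_true,
      true_and, len_nil, zero_le, PState.semi.injEq]
    constructor
    · refine fun h => ⟨q, rows, ⟨rfl, rfl⟩, fun r hr => ?_⟩
      obtain ⟨i, hi, rfl⟩ := List.getElem_of_mem hr
      have := h i hi
      rw [List.getD_eq_getElem _ _ hi] at this
      omega
    · rintro ⟨q', rows', ⟨rfl, rfl⟩, h⟩ i hi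
      rw [List.getD_eq_getElem _ _ hi]
      have := h _ (List.getElem_mem hi)
      omega
  | _ => simp [parseOk, PState.tree, mkState, unary, SExp.and]

end SlackCoNP

namespace SlackCoNP

open SExp Matrix

/-! ### The checks performed by the verifiers -/

/-- The test `m * den = D * num` for an entry `e = (num, den)`. -/
def entryCheck (D e m : SExp) : SExp := eqv (mul m e.tl) (mul D e.hd)

/-- The test `m j * den j = D * num j` for all entries of a row `r`. -/
def rowCheck (D r m : SExp) : SExp := all2 entryCheck D r m

/-- The test whether `N` is the natural multiple `D > 0` of the matrix given by `rows`. -/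
def scaleCheck (D rows N : SExp) : SExp := and (le (cons tt nil) D) (all2 rowCheck D rows N)

/-- The test whether `y = yp - yn` and `z = zp - zn` satisfy `yᵀ N ≥ 0`, `N z ≥ 0`,
`yᵀ N z < 0`. -/
def sepCheck (h N yp yn zp zn : SExp) : SExp :=
  and (all2 (fun z r _ => le (dot r z.tl) (dot r z.hd)) (cons zp zn) N nil)
    (and (all2 (fun _ a b => le b a) nil (vecMul h N yp) (vecMul h N yn))
      (le (add (cons tt nil) (add (dot (vecMul h N yp) zp) (dot (vecMul h N yn) zn)))
        (add (dot (vecMul h N yp) zn) (dot (vecMul h N yn) zp))))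

/-- The test whether `y = yp - yn` satisfies `yᵀ N = 0` while its entries do not add up to zero. -/
def kerCheck (h rows N yp yn : SExp) : SExp :=
  and (all2 (fun _ a b => eqv a b) nil (vecMul h N yp) (vecMul h N yn))
    (not (eqv (dot (map (fun _ _ => cons tt nil) nil rows) yp)
      (dot (map (fun _ _ => cons tt nil) nil rows) yn)))

/-- The test whether all rows of `N` are equal; the list `rows` only provides their number. -/
def eqRowsCheck (rows N : SExp) : SExp :=
  all2 (fun a _ r => all2 (fun _ x y => eqv x y) nil r a) N.hd rows N

/-- The check of a certificate `c = (D, N, yp, yn, zp, zn)` for the violation of the cone generating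
conditions by the matrix that is described by the state `s` of the parser. -/
def coneCheck (s c : SExp) : SExp :=
  and (scaleCheck c.hd s.tl.tl.tl.tl c.tl.hd)
    (sepCheck s.tl.hd c.tl.hd c.tl.tl.hd c.tl.tl.tl.hd c.tl.tl.tl.tl.hd c.tl.tl.tl.tl.tl)

/-- The check of a certificate `c = (D, N, yp, yn, zp, zn)` for the fact that the matrix that is
described by the state `s` of the parser is not a slack matrix of a polytope. -/
def polytopeCheck (s c : SExp) : SExp :=
  and (scaleCheck c.hd s.tl.tl.tl.tl c.tl.hd)
    (sel (sepCheck s.tl.hd c.tl.hd c.tl.tl.hd c.tl.tl.tl.hd c.tl.tl.tl.tl.hd c.tl.tl.tl.tl.tl) tt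
      (sel (kerCheck s.tl.hd s.tl.tl.tl.tl c.tl.hd c.tl.tl.hd c.tl.tl.tl.hd) tt
        (eqRowsCheck s.tl.tl.tl.tl c.tl.hd)))

section PolyTime

variable {f₁ f₂ f₃ f₄ f₅ f₆ : SExp → SExp}

@[fun_prop]
theorem PolyTime.scaleCheck (h₁ : PolyTime f₁) (h₂ : PolyTime f₂) (h₃ : PolyTime f₃) :
    PolyTime fun t => SlackCoNP.scaleCheck (f₁ t) (f₂ t) (f₃ t) := by
  unfold SlackCoNP.scaleCheck
  refine PolyTime.and (by fun_prop) (PolyTime.all2 ?_ (by fun_prop) (by fun_prop) (by fun_prop))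
  unfold rowCheck
  refine PolyTime.all2 ?_ (by fun_prop) (by fun_prop) (by fun_prop)
  unfold entryCheck
  fun_prop

@[fun_prop]
theorem PolyTime.sepCheck (h₁ : PolyTime f₁) (h₂ : PolyTime f₂) (h₃ : PolyTime f₃)
    (h₄ : PolyTime f₄) (h₅ : PolyTime f₅) (h₆ : PolyTime f₆) :
    PolyTime fun t => SlackCoNP.sepCheck (f₁ t) (f₂ t) (f₃ t) (f₄ t) (f₅ t) (f₆ t) := by
  unfold SlackCoNP.sepCheck
  exact PolyTime.and
    (PolyTime.all2 (f := fun t => .cons (f₅ t) (f₆ t)) (by fun_prop) (by fun_prop) (by fun_prop)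
      (by fun_prop))
    (PolyTime.and (PolyTime.all2 (f := fun _ => nil) (by fun_prop) (by fun_prop) (by fun_prop)
      (by fun_prop)) (by fun_prop))

@[fun_prop]
theorem PolyTime.kerCheck (h₁ : PolyTime f₁) (h₂ : PolyTime f₂) (h₃ : PolyTime f₃)
    (h₄ : PolyTime f₄) (h₅ : PolyTime f₅) :
    PolyTime fun t => SlackCoNP.kerCheck (f₁ t) (f₂ t) (f₃ t) (f₄ t) (f₅ t) := by
  unfold SlackCoNP.kerCheck
  have h : PolyTime fun t => SExp.map (fun _ _ => .cons tt nil) nil (f₂ t) :=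
    PolyTime.map (f := fun _ => nil) (by fun_prop) (by fun_prop) h₂
  exact PolyTime.and (PolyTime.all2 (f := fun _ => nil) (by fun_prop) (by fun_prop) (by fun_prop)
    (by fun_prop))
    (PolyTime.not (PolyTime.eqv (PolyTime.dot h (by fun_prop)) (PolyTime.dot h (by fun_prop))))

@[fun_prop]
theorem PolyTime.eqRowsCheck (h₁ : PolyTime f₁) (h₂ : PolyTime f₂) :
    PolyTime fun t => SlackCoNP.eqRowsCheck (f₁ t) (f₂ t) := by
  unfold SlackCoNP.eqRowsCheck
  exact PolyTime.all2 (PolyTime.all2 (f := fun _ => nil) (by fun_prop) (by fun_prop) (by fun_prop)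
    (by fun_prop)) (by fun_prop) (by fun_prop) (by fun_prop)

theorem PolyTime.coneCheck : PolyTime fun u => SlackCoNP.coneCheck u.hd u.tl := by
  unfold SlackCoNP.coneCheck
  fun_prop

theorem PolyTime.polytopeCheck : PolyTime fun u => SlackCoNP.polytopeCheck u.hd u.tl := by
  unfold SlackCoNP.polytopeCheck
  fun_prop

end PolyTime

/-! ### The meaning of the checks -/

/-- The vector of natural numbers denoted by a tree, extended by zeros or truncated to the given
size. -/
def vecOf (n : ℕ) (t : SExp) : Fin n → ℕ := fun i => val (get t i)

/-- The matrix of natural numbers denoted by a tree, extended by zeros or truncated to the given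
size. -/
def matOf (p q : ℕ) (t : SExp) : Matrix (Fin p) (Fin q) ℕ := of fun i j => val (get (get t i) j)

variable {p q : ℕ}

theorem val_dot_eq {u : SExp} (v : SExp) {n : ℕ} (hu : u.len ≤ n) :
    val (dot u v) = vecOf n u ⬝ᵥ vecOf n v := by
  rw [val_dot, dotProduct, Finset.sum_subset (Finset.range_subset_range.2 hu),
    ← Fin.sum_univ_eq_sum_range (fun i => val (get u i) * val (get v i)) n]
  · rfl
  · intro i _ hi
    rw [get_of_len_le (by simpa using hi)]
    simp

theorem vecOf_vecMul {h N : SExp} (y : SExp) (hh : h.len = q) (hN : N.len ≤ p) :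
    vecOf q (vecMul h N y) = vecOf p y ᵥ* matOf p q N := by
  funext j
  rw [vecOf, val_get_vecMul _ _ (by omega), Finset.sum_subset (Finset.range_subset_range.2 hN),
    ← Fin.sum_univ_eq_sum_range (fun i => val (get (get N i) j) * val (get y i)) p]
  · simp [Matrix.vecMul, dotProduct, vecOf, matOf, mul_comm]
  · intro i _ hi
    rw [get_of_len_le (t := N) (by simpa using hi)]
    simp

theorem all2_vec {c : SExp → SExp → SExp → SExp} {a : SExp} {r : ℕ → ℕ → Prop} (n : ℕ)
    (hc : ∀ x y, c a x y ≠ nil ↔ r (val x) (val y)) {u v : SExp} (hu : u.len = n) (hv : v.len = n) :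
    all2 c a u v ≠ nil ↔ ∀ i, r (vecOf n u i) (vecOf n v i) := by
  rw [all2_ne_nil, hu, hv]
  simp only [le_refl, true_and, hc]
  exact ⟨fun h i => h i i.2, fun h i hi => h ⟨i, hi⟩⟩

/-- The integer vectors `yp - yn` and `zp - zn` witness that a matrix of natural numbers violates
the cone generating conditions. -/
def NatSep (A : Matrix (Fin p) (Fin q) ℕ) (yp yn : Fin p → ℕ) (zp zn : Fin q → ℕ) : Prop :=
  A *ᵥ zn ≤ A *ᵥ zp ∧ yn ᵥ* A ≤ yp ᵥ* A ∧
    (yp ᵥ* A) ⬝ᵥ zp + (yn ᵥ* A) ⬝ᵥ zn < (yp ᵥ* A) ⬝ᵥ zn + (yn ᵥ* A) ⬝ᵥ zp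

/-- The integer vector `yp - yn` witnesses that the all-ones vector is not in the column space. -/
def NatKer (A : Matrix (Fin p) (Fin q) ℕ) (yp yn : Fin p → ℕ) : Prop :=
  yp ᵥ* A = yn ᵥ* A ∧ ∑ i, yp i ≠ ∑ i, yn i

theorem sepCheck_ne_nil {h N yp yn zp zn : SExp} (hh : h.len = q) (hN : N.len ≤ p)
    (hN' : ∀ i : Fin p, (get N i).len ≤ q) :
    sepCheck h N yp yn zp zn ≠ nil ↔
      NatSep (matOf p q N) (vecOf p yp) (vecOf p yn) (vecOf q zp) (vecOf q zn) := by
  have h1 : all2 (fun z r _ => le (dot r z.tl) (dot r z.hd)) (cons zp zn) N nil ≠ nil ↔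
      matOf p q N *ᵥ vecOf q zn ≤ matOf p q N *ᵥ vecOf q zp := by
    simp only [all2_ne_nil, le_ne_nil, len_nil, zero_le, true_and, hd_cons, tl_cons]
    constructor
    · intro h i
      by_cases hi : (i : ℕ) < N.len
      · have := h i hi
        rw [val_dot_eq _ (hN' i), val_dot_eq _ (hN' i)] at this
        exact this
      · have : matOf p q N i = 0 := by
          funext j
          simp [matOf, get_of_len_le (t := N) (not_lt.1 hi)]
        simp [Matrix.mulVec, this]
    · intro h i hi
      rw [val_dot_eq _ (hN' ⟨i, by omega⟩), val_dot_eq _ (hN' ⟨i, by omega⟩)]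
      exact h ⟨i, by omega⟩
  have hx := fun y => vecOf_vecMul (q := q) (p := p) y hh hN
  have hd := fun y z => val_dot_eq (u := SExp.vecMul h N y) z (n := q) (by simp [hh])
  rw [sepCheck, and_ne_nil, and_ne_nil, h1, all2_vec (r := fun a b => b ≤ a) q
    (fun x y => le_ne_nil) (by simpa) (by simpa), le_ne_nil]
  simp only [val_add, hd, hx]
  simp [tt, NatSep, Pi.le_def]
  intro _ _
  omega

theorem kerCheck_ne_nil {h rows N yp yn : SExp} (hh : h.len = q) (hr : rows.len = p)
    (hN : N.len ≤ p) : kerCheck h rows N yp yn ≠ nil ↔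
      NatKer (matOf p q N) (vecOf p yp) (vecOf p yn) := by
  have hx := fun y => vecOf_vecMul (q := q) (p := p) y hh hN
  have hd := fun y => val_dot_eq (u := map (fun _ _ => cons tt nil) nil rows) y (n := p)
    (by simp [hr])
  have hone : vecOf p (map (fun _ _ => cons tt nil) nil rows) = 1 := by
    funext i
    rw [vecOf, get_map _ _ (by omega)]
    simp [tt]
  have he : ∀ {a b : SExp}, eqv a b = nil ↔ val a ≠ val b := fun {a b} => by
    rw [Ne, ← eqv_ne_nil, not_ne_iff]
  rw [kerCheck, and_ne_nil, not_ne_nil, all2_vec (r := fun a b => a = b) q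
    (fun x y => eqv_ne_nil) (by simpa) (by simpa), he]
  simp only [hd, hx, hone, one_dotProduct, NatKer, funext_iff]

theorem eqRowsCheck_ne_nil {rows N : SExp} (hr : rows.len = p)
    (h : eqRowsCheck rows N ≠ nil) (i k : Fin p) (j : Fin q) :
    matOf p q N i j = matOf p q N k j := by
  obtain ⟨-, h⟩ := all2_ne_nil.1 h
  rw [hr] at h
  suffices H : ∀ i : Fin p, matOf p q N i j = val (get N.hd j) from (H i).trans (H k).symm
  intro i
  obtain ⟨hl, hi⟩ := all2_ne_nil.1 (h i i.2)
  by_cases hj : (j : ℕ) < (get N i).len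
  · exact eqv_ne_nil.1 (hi j hj)
  · rw [matOf, of_apply, get_of_len_le (not_lt.1 hj), get_of_len_le (by omega)]

theorem eqRowsCheck_of_eq {rows N : SExp} (hr : rows.len = p) (hN : N.len = p)
    (hN' : ∀ i : Fin p, (get N i).len = q)
    (h : ∀ i k j, matOf p q N i j = matOf p q N k j) : eqRowsCheck rows N ≠ nil := by
  refine all2_ne_nil.2 ⟨by omega, fun i hi => all2_ne_nil.2 ?_⟩
  rw [hr] at hi
  have h0 : (get N 0).len = q := hN' ⟨0, by omega⟩
  rw [get_zero] at h0
  refine ⟨by rw [hN' ⟨i, hi⟩, h0], fun j hj => eqv_ne_nil.2 ?_⟩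
  exact h ⟨i, hi⟩ ⟨0, by omega⟩ ⟨j, by rwa [← hN' ⟨i, hi⟩]⟩

@[simp]
theorem val_bitsTree (l : List Bool) : val (bitsTree l) = bval l := by
  induction l with
  | nil => rfl
  | cons b l ih =>
    change bit (ofBool b) + 2 * val (bitsTree l) = _
    cases b <;> simp [ih, bval, ofBool]

theorem FractionMatrix.get_rowsTree_raw (F : FractionMatrix p q) (i : Fin p) :
    get (rowsTree F.raw) i = rowTree (List.ofFn fun j =>
      (Computability.encodeNat (F.num i j).natAbs, Computability.encodeNat (F.den i j))) := by
  rw [get_rowsTree]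
  simp [FractionMatrix.raw]

theorem FractionMatrix.len_rowsTree_raw (F : FractionMatrix p q) : (rowsTree F.raw).len = p := by
  simp [FractionMatrix.raw, rowsTree]

theorem scaleCheck_ne_nil {D N : SExp} (F : FractionMatrix p q) :
    scaleCheck D (rowsTree F.raw) N ≠ nil ↔ 0 < val D ∧ N.len ≤ p ∧
      (∀ i : Fin p, (get N i).len ≤ q) ∧
      ∀ i j, matOf p q N i j * F.den i j = val D * (F.num i j).natAbs := by
  have hrow : ∀ i : Fin p, rowCheck D (get (rowsTree F.raw) i) (get N i) ≠ nil ↔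
      (get N i).len ≤ q ∧ ∀ j, matOf p q N i j * F.den i j = val D * (F.num i j).natAbs := by
    intro i
    rw [rowCheck, all2_ne_nil, F.get_rowsTree_raw]
    have hl : (rowTree (List.ofFn fun j => (Computability.encodeNat (F.num i j).natAbs,
      Computability.encodeNat (F.den i j)))).len = q := by simp [rowTree]
    rw [hl]
    refine and_congr_right fun _ => ⟨fun h j => ?_, fun h j hj => ?_⟩
    · have := h j j.2
      rw [entryCheck, eqv_ne_nil] at this
      simpa [rowTree, get_ofList, bval_encodeNat, matOf] using this
    · have := h ⟨j, hj⟩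
      rw [entryCheck, eqv_ne_nil]
      simpa [rowTree, get_ofList, bval_encodeNat, matOf, hj] using this
  rw [scaleCheck, and_ne_nil, le_ne_nil, all2_ne_nil, F.len_rowsTree_raw]
  refine and_congr (by simp [tt, Nat.one_le_iff_ne_zero, Nat.pos_iff_ne_zero])
    (and_congr_right fun _ => ?_)
  rw [← forall_and]
  exact ⟨fun h i => (hrow i).1 (h i i.2), fun h i hi => (hrow ⟨i, hi⟩).2 (h ⟨i, hi⟩)⟩

end SlackCoNP

namespace SlackCoNP

open SExp Matrix

/-! ### From certificates to membership in coNP -/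

/-- A predicate that implies nonnegativity defines a problem in coNP as soon as nonnegative
rational matrices without that property have short certificates that are checked in polynomial
time. The check gets the matrix in the form in which the parser delivers it. -/
theorem inCoNP_of_check {P : ∀ {p q : ℕ}, Matrix (Fin p) (Fin q) ℝ → Prop}
    (hP : ∀ {p q : ℕ} {M : Matrix (Fin p) (Fin q) ℝ}, P M → IsNonneg M)
    {C : SExp → SExp → SExp} (hC : PolyTime fun u => C u.hd u.tl) (b : Polynomial ℕ)
    (hs : ∀ {p q : ℕ} (F : FractionMatrix p q) (c : SExp), (∀ i j, 0 ≤ F.num i j) →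
      C (PState.semi q F.raw).tree c ≠ nil → ¬ P F.toReal)
    (hc : ∀ {p q : ℕ} (F : FractionMatrix p q), (∀ i j, 0 ≤ F.num i j) → ¬ P F.toReal →
      ∃ c : SExp, c.size ≤ b.eval F.encode.length ∧ C (PState.semi q F.raw).tree c ≠ nil) :
    InCoNP (matrixProblem P) := by
  have hsel : ∀ {a c d : SExp}, sel a c d ≠ nil ↔ (a ≠ nil ∧ c ≠ nil) ∨ (a = nil ∧ d ≠ nil) := by
    intro a c d
    cases a <;> simp
  have hV : PolyTime fun u => sel (parseOk (parse u.hd)) (C (parse u.hd) u.tl) tt :=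
    PolyTime.sel (by fun_prop)
      (hC.comp (g := fun u => .cons (parse u.hd) u.tl) (by fun_prop)) (by fun_prop)
  refine inNP_of_polyTime hV (b + 1) (fun w hw => ?_) (fun w c h => ?_)
  · change w ∉ matrixProblem P at hw
    by_cases h : parseOk (PState.run w).tree = nil
    -- A string that is not the code of a nonnegative matrix needs no certificate.
    · refine ⟨nil, by simp, ?_⟩
      rw [hsel, hd_cons, parse_strTree]
      exact Or.inr ⟨h, by simp [tt]⟩
    · obtain ⟨q, rows, h1, h2⟩ := parseOk_tree.1 h
      obtain ⟨p, F, h3, rfl, rfl⟩ := PState.exists_of_run_eq h1 h2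
      obtain ⟨c, h4, h5⟩ := hc F h3 fun h => hw ⟨p, q, F, rfl, h⟩
      refine ⟨c, by simpa using h4.trans (Nat.le_succ _), ?_⟩
      rw [hsel, hd_cons, tl_cons, parse_strTree]
      exact Or.inl ⟨h, by rwa [h1]⟩
  · rintro ⟨p, q, F, rfl, hF⟩
    have h0 : ∀ i j, 0 ≤ F.num i j := by
      intro i j
      have h1 := hP hF i j
      by_contra h2
      rw [FractionMatrix.toReal, of_apply] at h1
      have h3 : (F.num i j : ℝ) < 0 := by exact_mod_cast not_le.1 h2
      have h4 : (0 : ℝ) < F.den i j := by exact_mod_cast F.den_pos i j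
      exact absurd h1 (not_le.2 (div_neg_of_neg_of_pos h3 h4))
    have h1 := PState.run_encode F h0
    rw [hsel, hd_cons, tl_cons, parse_strTree, h1] at h
    obtain h | h := h
    · exact hs F c h0 h.2 hF
    · refine absurd h.1 (parseOk_tree.2 ⟨q, F.raw, rfl, fun r hr => ?_⟩)
      obtain ⟨i, rfl⟩ := (List.mem_ofFn' _ _).1 hr
      simp

/-! ### Sizes of codes -/

theorem bval_lt (l : List Bool) : bval l < 2 ^ l.length := by
  rw [← val_bitsTree]
  simpa [bitsTree] using val_lt (bitsTree l)

theorem length_le_of_bval_lt {l : List Bool} (hl : Canonical l) {k : ℕ} (h : bval l < 2 ^ k) :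
    l.length ≤ k := by
  induction l generalizing k with
  | nil => simp
  | cons b l ih =>
    have h0 := bval_pos hl (by simp)
    cases k with
    | zero => omega
    | succ k =>
      have := ih (canonical_cons.1 hl).1 (k := k) (by rw [bval, pow_succ] at h; omega)
      simpa using this

/-- A natural number in binary notation as a tree. -/
def natTree (n : ℕ) : SExp := bitsTree (Computability.encodeNat n)

/-- A vector of natural numbers as a tree. -/
def vecTree {n : ℕ} (v : Fin n → ℕ) : SExp := ofList (List.ofFn fun i => natTree (v i))

/-- A matrix of natural numbers as a tree, the list of its rows. -/
def matTree {p q : ℕ} (A : Matrix (Fin p) (Fin q) ℕ) : SExp :=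
  ofList (List.ofFn fun i => vecTree (A i))

variable {p q : ℕ}

@[simp]
theorem val_natTree (n : ℕ) : val (natTree n) = n := by rw [natTree, val_bitsTree, bval_encodeNat]

@[simp]
theorem len_vecTree (v : Fin p → ℕ) : (vecTree v).len = p := by simp [vecTree]

@[simp]
theorem len_matTree (A : Matrix (Fin p) (Fin q) ℕ) : (matTree A).len = p := by simp [matTree]

@[simp]
theorem get_matTree (A : Matrix (Fin p) (Fin q) ℕ) (i : Fin p) :
    get (matTree A) i = vecTree (A i) := by simp [matTree, get_ofList]

@[simp]
theorem vecOf_vecTree (v : Fin p → ℕ) : vecOf p (vecTree v) = v := by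
  funext i
  simp [vecOf, vecTree, get_ofList]

@[simp]
theorem matOf_matTree (A : Matrix (Fin p) (Fin q) ℕ) : matOf p q (matTree A) = A := by
  ext i j
  have := congrFun (vecOf_vecTree (A i)) j
  simpa [matOf, vecOf] using this

theorem size_natTree_le {n k : ℕ} (h : n < 2 ^ k) : (natTree n).size ≤ 4 * k + 1 := by
  have h1 : (Computability.encodeNat n).length ≤ k :=
    length_le_of_bval_lt (canonical_encodeNat n) (by rwa [bval_encodeNat])
  have h2 := size_ofList_le (l := (Computability.encodeNat n).map ofBool) (N := 3) (by
    intro x hx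
    obtain ⟨b, -, rfl⟩ := List.mem_map.1 hx
    cases b <;> simp [ofBool])
  rw [List.length_map] at h2
  rw [natTree, bitsTree]
  omega

theorem size_vecTree_le {v : Fin p → ℕ} {k ℓ : ℕ} (h : ∀ i, v i < 2 ^ k) (hp : p ≤ ℓ) :
    (vecTree v).size ≤ ℓ * (4 * k + 2) + 1 := by
  have h2 := size_ofList_le (l := List.ofFn fun i => natTree (v i)) (N := 4 * k + 1) (by
    intro x hx
    obtain ⟨b, rfl⟩ := (List.mem_ofFn' _ _).1 hx
    exact size_natTree_le (h _))
  rw [List.length_ofFn] at h2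
  exact h2.trans (by gcongr)

theorem size_matTree_le {A : Matrix (Fin p) (Fin q) ℕ} {k ℓ : ℕ} (h : ∀ i j, A i j < 2 ^ k)
    (hp : p ≤ ℓ) (hq : q ≤ ℓ) : (matTree A).size ≤ ℓ * (ℓ * (4 * k + 2) + 2) + 1 := by
  have h2 := size_ofList_le (l := List.ofFn fun i => vecTree (A i)) (N := ℓ * (4 * k + 2) + 1) (by
    intro x hx
    obtain ⟨b, rfl⟩ := (List.mem_ofFn' _ _).1 hx
    exact size_vecTree_le (h _) hq)
  rw [List.length_ofFn] at h2
  exact h2.trans (by gcongr)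

/-- The tree of a certificate. -/
def certTree (D : ℕ) (N : Matrix (Fin p) (Fin q) ℕ) (yp yn : Fin p → ℕ) (zp zn : Fin q → ℕ) :
    SExp :=
  cons (natTree D) (cons (matTree N) (cons (vecTree yp) (cons (vecTree yn)
    (cons (vecTree zp) (vecTree zn)))))

/-- A bound for the size of a certificate, given the length of the input and the number of bits of
the numbers in the certificate. -/
noncomputable def certBound (k : Polynomial ℕ) : Polynomial ℕ :=
  (4 * k + 1) + (.X * (.X * (4 * k + 2) + 2) + 1) + 4 * (.X * (4 * k + 2) + 1) + 5

theorem size_certTree_le {D : ℕ} {N : Matrix (Fin p) (Fin q) ℕ} {yp yn : Fin p → ℕ}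
    {zp zn : Fin q → ℕ} {b : Polynomial ℕ} {ℓ : ℕ} (hp : p ≤ ℓ) (hq : q ≤ ℓ)
    (hD : D < 2 ^ b.eval ℓ) (hN : ∀ i j, N i j < 2 ^ b.eval ℓ) (hyp : ∀ i, yp i < 2 ^ b.eval ℓ)
    (hyn : ∀ i, yn i < 2 ^ b.eval ℓ) (hzp : ∀ i, zp i < 2 ^ b.eval ℓ)
    (hzn : ∀ i, zn i < 2 ^ b.eval ℓ) :
    (certTree D N yp yn zp zn).size ≤ (certBound b).eval ℓ := by
  have h1 := size_natTree_le hD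
  have h2 := size_matTree_le hN hp hq
  have h3 := size_vecTree_le hyp hp
  have h4 := size_vecTree_le hyn hp
  have h5 := size_vecTree_le hzp hq
  have h6 := size_vecTree_le hzn hq
  simp only [certBound, certTree, size_cons, Polynomial.eval_add, Polynomial.eval_mul,
    Polynomial.eval_X, Polynomial.eval_one, Polynomial.eval_ofNat]
  omega

theorem FractionMatrix.length_entry_le (F : FractionMatrix p q) (i : Fin p) (j : Fin q) :
    (encodeInt (F.num i j) ++ [Symbol.slash] ++ encodeNat (F.den i j) ++ [Symbol.comma]).length ≤
      F.encode.length := by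
  set e : Fin p → Fin q → List Symbol := fun i j =>
    encodeInt (F.num i j) ++ [Symbol.slash] ++ encodeNat (F.den i j) ++ [Symbol.comma] with he
  have h1 : (e i j).length ≤ (List.ofFn (e i)).flatten.length :=
    (List.sublist_flatten_of_mem ((List.mem_ofFn' _ _).2 ⟨j, rfl⟩)).length_le
  have h2 : ((List.ofFn (e i)).flatten ++ [Symbol.semicolon]).length ≤
      (List.ofFn fun i => (List.ofFn (e i)).flatten ++ [Symbol.semicolon]).flatten.length :=
    (List.sublist_flatten_of_mem ((List.mem_ofFn'
      (fun i => (List.ofFn (e i)).flatten ++ [Symbol.semicolon]) _).2 ⟨i, rfl⟩)).length_le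
  have h3 : F.encode = List.replicate q (Symbol.bit true) ++ [Symbol.semicolon] ++
    (List.ofFn fun i => (List.ofFn (e i)).flatten ++ [Symbol.semicolon]).flatten := rfl
  rw [h3, List.length_append (bs := List.flatten _)]
  rw [List.length_append] at h2
  exact h1.trans ((Nat.le_add_right _ _).trans (h2.trans (Nat.le_add_left _ _)))

theorem FractionMatrix.num_lt (F : FractionMatrix p q) (i : Fin p) (j : Fin q) :
    (F.num i j).natAbs < 2 ^ F.encode.length := by
  have h := F.length_entry_le i j
  have h1 := bval_lt (Computability.encodeNat (F.num i j).natAbs)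
  rw [bval_encodeNat] at h1
  refine h1.trans_le (Nat.pow_le_pow_right (by norm_num) (le_trans ?_ h))
  simp [encodeInt, encodeNat]
  omega

theorem FractionMatrix.den_lt (F : FractionMatrix p q) (i : Fin p) (j : Fin q) :
    F.den i j < 2 ^ F.encode.length := by
  have h := F.length_entry_le i j
  have h1 := bval_lt (Computability.encodeNat (F.den i j))
  rw [bval_encodeNat] at h1
  refine h1.trans_le (Nat.pow_le_pow_right (by norm_num) (le_trans ?_ h))
  simp [encodeInt, encodeNat]
  omega

theorem FractionMatrix.cols_le (F : FractionMatrix p q) : q ≤ F.encode.length := by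
  simp [FractionMatrix.encode]

theorem FractionMatrix.rows_le (F : FractionMatrix p q) : p ≤ F.encode.length := by
  have : ∀ l : List (List Symbol), (∀ x ∈ l, x ≠ []) → l.length ≤ l.flatten.length := by
    intro l hl
    induction l with
    | nil => simp
    | cons x l ih =>
      have h1 := List.length_pos_iff.2 (hl x (by simp))
      have h2 := ih fun y hy => hl y (by simp [hy])
      simp only [List.length_cons, List.flatten_cons, List.length_append]
      omega
  have := this (List.ofFn fun i : Fin p => (List.ofFn fun j : Fin q =>
    encodeInt (F.num i j) ++ [Symbol.slash] ++ encodeNat (F.den i j) ++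
          [Symbol.comma]).flatten ++ [Symbol.semicolon]) (by
    intro x hx
    obtain ⟨i, rfl⟩ := (List.mem_ofFn' _ _).1 hx
    simp)
  rw [List.length_ofFn] at this
  refine this.trans ?_
  rw [FractionMatrix.encode, List.length_append (bs := List.flatten _)]
  exact Nat.le_add_left _ _

/-! ### Clearing denominators -/

/-- `N` is the multiple by the positive natural number `D` of a nonnegative rational matrix. -/
def FractionMatrix.Scaled (F : FractionMatrix p q) (D : ℕ) (N : Matrix (Fin p) (Fin q) ℕ) : Prop :=
  0 < D ∧ ∀ i j, N i j * F.den i j = D * (F.num i j).natAbs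

theorem FractionMatrix.Scaled.map_eq {F : FractionMatrix p q} {D : ℕ}
    {N : Matrix (Fin p) (Fin q) ℕ} (h : F.Scaled D N) (hF : ∀ i j, 0 ≤ F.num i j) :
    N.map (Nat.cast : ℕ → ℝ) = (D : ℝ) • F.toReal := by
  ext i j
  have h1 : (N i j * F.den i j : ℝ) = D * F.num i j := by
    have := h.2 i j
    have h2 : ((F.num i j).natAbs : ℤ) = F.num i j := Int.natAbs_of_nonneg (hF i j)
    have h3 : (N i j * F.den i j : ℤ) = D * F.num i j := by rw [← h2]; exact_mod_cast this
    exact_mod_cast h3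
  have h4 : (F.den i j : ℝ) ≠ 0 := by exact_mod_cast (F.den_pos i j).ne'
  rw [map_apply, Matrix.smul_apply, toReal, of_apply, smul_eq_mul]
  field_simp
  exact h1

/-- The product of all denominators is a common denominator with polynomially many bits. -/
theorem FractionMatrix.exists_scaled (F : FractionMatrix p q) : ∃ D N, F.Scaled D N ∧
    D ≤ 2 ^ (F.encode.length ^ 3) ∧ ∀ i j, N i j ≤ 2 ^ (F.encode.length ^ 3 + F.encode.length) := by
  set ℓ := F.encode.length with hℓ
  set D := ∏ i, ∏ j, F.den i j with hD
  have hdvd : ∀ i j, F.den i j ∣ D := fun i j =>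
    (Finset.dvd_prod_of_mem _ (Finset.mem_univ j)).trans
      (Finset.dvd_prod_of_mem (fun i => ∏ j, F.den i j) (Finset.mem_univ i))
  have hDle : D ≤ 2 ^ ℓ ^ 3 := by
    calc D ≤ ∏ _i : Fin p, ∏ _j : Fin q, 2 ^ ℓ :=
          Finset.prod_le_prod' fun i _ => Finset.prod_le_prod' fun j _ => (F.den_lt i j).le
      _ = 2 ^ (ℓ * q * p) := by simp [pow_mul]
      _ ≤ 2 ^ ℓ ^ 3 := by
          refine Nat.pow_le_pow_right (by norm_num) ?_
          have h1 := F.cols_le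
          have h2 := F.rows_le
          rw [← hℓ] at h1 h2
          calc ℓ * q * p ≤ ℓ * ℓ * ℓ := by gcongr
            _ = ℓ ^ 3 := by ring
  refine ⟨D, of fun i j => D / F.den i j * (F.num i j).natAbs, ⟨?_, fun i j => ?_⟩, hDle, ?_⟩
  · exact Finset.prod_pos fun i _ => Finset.prod_pos fun j _ => F.den_pos i j
  · rw [of_apply, mul_right_comm, Nat.div_mul_cancel (hdvd i j)]
  · intro i j
    rw [of_apply, pow_add]
    exact Nat.mul_le_mul ((Nat.div_le_self _ _).trans hDle) (F.num_lt i j).le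

/-! ### The two verifiers -/

theorem coneCheck_ne_nil (F : FractionMatrix p q) {c : SExp}
    (h : coneCheck (PState.semi q F.raw).tree c ≠ nil) : ∃ D N yp yn zp zn,
      F.Scaled D N ∧ NatSep N yp yn zp zn := by
  obtain ⟨h1, h2⟩ := and_ne_nil.1 h
  obtain ⟨h3, h4, h5, h6⟩ := (scaleCheck_ne_nil F).1 h1
  exact ⟨_, _, _, _, _, _, ⟨h3, h6⟩, (sepCheck_ne_nil (len_unary q) h4 h5).1 h2⟩

theorem coneCheck_certTree (F : FractionMatrix p q) {D N yp yn zp zn} (h1 : F.Scaled D N)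
    (h2 : NatSep N yp yn zp zn) :
    coneCheck (PState.semi q F.raw).tree (certTree D N yp yn zp zn) ≠ nil := by
  refine and_ne_nil.2 ⟨(scaleCheck_ne_nil F).2 ?_,
    (sepCheck_ne_nil (p := p) (len_unary q) ?_ ?_).2 ?_⟩
  · simpa [certTree] using! h1
  all_goals simp [certTree, h2]

theorem polytopeCheck_ne_nil (F : FractionMatrix p q) {c : SExp}
    (h : polytopeCheck (PState.semi q F.raw).tree c ≠ nil) : ∃ D N yp yn zp zn,
      F.Scaled D N ∧ (NatSep N yp yn zp zn ∨ NatKer N yp yn ∨ ∀ i k j, N i j = N k j) := by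
  obtain ⟨h1, h2⟩ := and_ne_nil.1 h
  obtain ⟨h3, h4, h5, h6⟩ := (scaleCheck_ne_nil F).1 h1
  refine ⟨_, _, vecOf p c.tl.tl.hd, vecOf p c.tl.tl.tl.hd, vecOf q c.tl.tl.tl.tl.hd,
    vecOf q c.tl.tl.tl.tl.tl, ⟨h3, h6⟩, ?_⟩
  have hsel : ∀ {a d : SExp}, sel a tt d ≠ nil ↔ a ≠ nil ∨ d ≠ nil := by
    intro a d
    cases a <;> simp [tt]
  rw [hsel, hsel] at h2
  exact h2.imp (sepCheck_ne_nil (len_unary q) h4 h5).1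
    (Or.imp (kerCheck_ne_nil (len_unary q) F.len_rowsTree_raw h4).1
      (eqRowsCheck_ne_nil F.len_rowsTree_raw))

theorem polytopeCheck_certTree (F : FractionMatrix p q) {D N yp yn zp zn} (h1 : F.Scaled D N)
    (h2 : NatSep N yp yn zp zn ∨ NatKer N yp yn ∨ ∀ i k j, N i j = N k j) :
    polytopeCheck (PState.semi q F.raw).tree (certTree D N yp yn zp zn) ≠ nil := by
  refine and_ne_nil.2 ⟨(scaleCheck_ne_nil F).2 ?_, ?_⟩
  · simpa [certTree] using! h1
  have hsel : ∀ {a d : SExp}, sel a tt d ≠ nil ↔ a ≠ nil ∨ d ≠ nil := by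
    intro a d
    cases a <;> simp [tt]
  rw [hsel, hsel]
  refine h2.imp (fun h => (sepCheck_ne_nil (p := p) (len_unary q) ?_ ?_).2 ?_)
    (Or.imp (fun h => (kerCheck_ne_nil (len_unary q) F.len_rowsTree_raw ?_).2 ?_)
      fun h => eqRowsCheck_of_eq (q := q) F.len_rowsTree_raw ?_ ?_ ?_)
  all_goals simp [certTree, h]
  exact h

end SlackCoNP

namespace SlackCoNP

open Matrix

/-! ### Farkas' lemma and separating pairs -/

/-- Farkas' lemma: a linear form that is nonnegative wherever finitely many linear forms are
nonnegative is a nonnegative combination of them. If the last of the forms is needed, then the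
others are projected along a vector `x` where only this one is negative (Bartl's proof). -/
theorem exists_nonneg_combination {V : Type*} [AddCommGroup V] [Module ℝ V] {n : ℕ}
    (a : Fin n → V →ₗ[ℝ] ℝ) (b : V →ₗ[ℝ] ℝ) (h : ∀ x, (∀ i, 0 ≤ a i x) → 0 ≤ b x) :
    ∃ y : Fin n → ℝ, (∀ i, 0 ≤ y i) ∧ b = ∑ i, y i • a i := by
  induction n generalizing b with
  | zero =>
    refine ⟨0, by simp, LinearMap.ext fun x => ?_⟩
    have h1 := h x (by simp)
    have h2 := h (-x) (by simp)
    simp only [map_neg] at h2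
    simp
    linarith
  | succ n ih =>
    by_cases h0 : ∀ x, (∀ i : Fin n, 0 ≤ a i.castSucc x) → 0 ≤ b x
    · obtain ⟨y, hy, hb⟩ := ih (fun i => a i.castSucc) b h0
      refine ⟨Fin.snoc y 0, fun i => ?_, ?_⟩
      · induction i using Fin.lastCases <;> simp [hy]
      · simpa [Fin.sum_univ_castSucc] using hb
    push Not at h0
    obtain ⟨x, hx, hbx⟩ := h0
    have hlast : a (Fin.last n) x < 0 := by
      by_contra h1
      refine absurd (h x fun i => ?_) (not_le.2 hbx)
      induction i using Fin.lastCases with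
      | last => exact not_lt.1 h1
      | cast i => exact hx i
    set α := a (Fin.last n) with hα
    set r := (α x)⁻¹ with hr
    have hr0 : r < 0 := inv_lt_zero.2 hlast
    obtain ⟨y, hy, hb⟩ := ih (fun i => a i.castSucc - (r * a i.castSucc x) • α)
      (b - (r * b x) • α) (by
      intro w hw
      have h1 := h (w - (r * α w) • x) (fun i => ?_)
      · simpa [mul_right_comm] using h1
      · induction i using Fin.lastCases with
        | last =>
          have : r * α x = 1 := inv_mul_cancel₀ hlast.ne
          have h2 : r * α w * α x = α w := by rw [mul_right_comm, this, one_mul]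
          simp [← hα, h2]
        | cast i => simpa [mul_right_comm] using hw i)
    refine ⟨Fin.snoc y (r * b x - ∑ i, y i * (r * a i.castSucc x)), fun i => ?_, ?_⟩
    · induction i using Fin.lastCases with
      | last =>
        have h1 : 0 < r * b x := mul_pos_of_neg_of_neg hr0 hbx
        have h2 : ∑ i, y i * (r * a i.castSucc x) ≤ 0 :=
          Finset.sum_nonpos fun i _ => mul_nonpos_of_nonneg_of_nonpos (hy i)
            (mul_nonpos_of_nonpos_of_nonneg hr0.le (hx i))
        rw [Fin.snoc_last]
        linarith
      | cast i => simpa using hy i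
    · rw [Fin.sum_univ_castSucc]
      simp only [Fin.snoc_castSucc, Fin.snoc_last, ← hα]
      have h1 : b = (∑ i, y i • (a i.castSucc - (r * a i.castSucc x) • α)) + (r * b x) • α := by
        rw [← hb]
        simp
      simp only [smul_sub, Finset.sum_sub_distrib, smul_smul, ← Finset.sum_smul] at h1
      conv_lhs => rw [h1]
      module

variable {p q : ℕ}

/-- `y` and `z` witness that the cone generating conditions fail for `M`: the row combination
`yᵀ M` is nonnegative, but it is separated from the rows of `M` by `z`. This condition is symmetric
under transposition. -/
def Sep (M : Matrix (Fin p) (Fin q) ℝ) (y : Fin p → ℝ) (z : Fin q → ℝ) : Prop :=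
  0 ≤ y ᵥ* M ∧ 0 ≤ M *ᵥ z ∧ (y ᵥ* M) ⬝ᵥ z < 0

theorem Sep.transpose {M : Matrix (Fin p) (Fin q) ℝ} {y : Fin p → ℝ} {z : Fin q → ℝ}
    (h : Sep M y z) : Sep Mᵀ z y := by
  refine ⟨by simpa [vecMul_transpose] using h.2.1, by simpa [mulVec_transpose] using h.1, ?_⟩
  rw [vecMul_transpose, dotProduct_comm, dotProduct_mulVec]
  exact h.2.2

/-- The nontrivial inclusion in the row cone generating condition. -/
theorem rcgc_iff {M : Matrix (Fin p) (Fin q) ℝ} (hM : IsNonneg M) : RCGC M ↔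
    ∀ y : Fin p → ℝ, 0 ≤ y ᵥ* M → ∃ y' : Fin p → ℝ, 0 ≤ y' ∧ y' ᵥ* M = y ᵥ* M := by
  constructor
  · intro h y hy
    have : y ᵥ* M ∈ {x : Fin q → ℝ | ∃ y : Fin p → ℝ, (∀ i, 0 ≤ y i) ∧ y ᵥ* M = x} := by
      rw [h]
      exact ⟨⟨y, rfl⟩, hy⟩
    exact this
  · intro h
    refine Set.Subset.antisymm ?_ ?_
    · rintro _ ⟨y, hy, rfl⟩
      exact ⟨⟨y, rfl⟩, fun j =>
        dotProduct_nonneg_of_nonneg (v := y) (w := fun i => M i j) hy fun i => hM i j⟩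
    · rintro _ ⟨⟨y, rfl⟩, hy⟩
      exact h y hy

theorem rcgc_iff_not_sep {M : Matrix (Fin p) (Fin q) ℝ} (hM : IsNonneg M) :
    RCGC M ↔ ∀ y z, ¬ Sep M y z := by
  rw [rcgc_iff hM]
  constructor
  · rintro h y z ⟨h1, h2, h3⟩
    obtain ⟨y', h4, h5⟩ := h y h1
    rw [← h5, ← dotProduct_mulVec] at h3
    exact absurd h3 (not_lt.2 (dotProduct_nonneg_of_nonneg h4 h2))
  · intro h y hy
    obtain ⟨y', h1, h2⟩ := exists_nonneg_combination
      (fun i => dotProductBilin ℝ ℝ (M i))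
      (dotProductBilin ℝ ℝ (y ᵥ* M)) (by
        intro z hz
        by_contra h3
        exact h y z ⟨hy, hz, not_le.1 h3⟩)
    refine ⟨y', h1, ?_⟩
    funext j
    have := LinearMap.congr_fun h2 (Pi.single j 1)
    simp at this
    rw [this]
    simp [Matrix.vecMul, dotProduct]

theorem ccgc_iff_rcgc_transpose {M : Matrix (Fin p) (Fin q) ℝ} : CCGC M ↔ RCGC Mᵀ := by
  simp only [CCGC, RCGC, vecMul_transpose]

theorem ccgc_iff_rcgc {M : Matrix (Fin p) (Fin q) ℝ} (hM : IsNonneg M) : CCGC M ↔ RCGC M := by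
  have hM' : IsNonneg Mᵀ := fun i j => hM j i
  rw [ccgc_iff_rcgc_transpose, rcgc_iff_not_sep hM, rcgc_iff_not_sep hM']
  exact ⟨fun h y z hs => h z y hs.transpose, fun h y z hs => h z y (by simpa using hs.transpose)⟩

end SlackCoNP

namespace SlackCoNP

open Matrix

variable {p q n : ℕ}

/-! ### Slack matrices of cones -/

/-- The row combination `yᵀ A B` is nonnegative if and only if `yᵀ A` is in the cone. -/
theorem isNonneg_rcgc_of_isConeSlackMatrix {M : Matrix (Fin p) (Fin q) ℝ}
    (h : IsConeSlackMatrix M) : IsNonneg M ∧ RCGC M := by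
  obtain ⟨n, K, A, B, ⟨h1, h2⟩, rfl⟩ := h
  have hM : IsNonneg (A * B) := by
    intro i
    have : A i ∈ K := by
      rw [h1]
      refine ⟨Pi.single i 1, fun k => ?_, by simp [row]⟩
      by_cases hk : k = i <;> simp [hk]
    rw [h2] at this
    exact this
  refine ⟨hM, (rcgc_iff hM).2 fun y hy => ?_⟩
  have : y ᵥ* A ∈ K := by
    rw [h2]
    simpa [vecMul_vecMul] using! hy
  rw [h1] at this
  obtain ⟨y', h3, h4⟩ := this
  exact ⟨y', h3, by rw [← vecMul_vecMul, h4, vecMul_vecMul]⟩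

/-- Coordinates on a subspace of a space of row vectors. -/
theorem exists_vecMul_coordinates (S : Submodule ℝ (Fin q → ℝ)) :
    ∃ (n : ℕ) (B : Matrix (Fin n) (Fin q) ℝ), (∀ x, x ᵥ* B ∈ S) ∧ (∀ s ∈ S, ∃ x, x ᵥ* B = s) ∧
      Function.Injective fun x => x ᵥ* B := by
  set b := Module.finBasis ℝ S
  have h : ∀ x, x ᵥ* (of fun k => (b k : Fin q → ℝ)) = (b.equivFun.symm x : S) := by
    intro x
    rw [b.equivFun_symm_apply, vecMul_eq_sum]
    simp
    rfl
  refine ⟨Module.finrank ℝ S, of fun k => (b k : Fin q → ℝ), ?_, ?_, ?_⟩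
  · intro x
    rw [h]
    exact Subtype.property _
  · intro s hs
    exact ⟨b.equivFun ⟨s, hs⟩, by rw [h, LinearEquiv.symm_apply_apply]⟩
  · intro x y hxy
    simp only [h] at hxy
    exact b.equivFun.symm.injective (Subtype.ext hxy)

theorem isConeSlackMatrix_iff {M : Matrix (Fin p) (Fin q) ℝ} :
    IsConeSlackMatrix M ↔ IsNonneg M ∧ RCGC M := by
  refine ⟨isNonneg_rcgc_of_isConeSlackMatrix, fun ⟨hM, h⟩ => ?_⟩
  rw [rcgc_iff hM] at h
  -- The cone is described in coordinates on the row space of `M`.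
  obtain ⟨n, B, h1, h2, h3⟩ := exists_vecMul_coordinates (LinearMap.range M.vecMulLinear)
  have h4 : ∀ i, ∃ x, x ᵥ* B = M i := fun i => h2 _ ⟨Pi.single i 1, by simp [row]⟩
  choose A hA using h4
  have hAB : M = of A * B := by
    funext i
    rw [mul_apply_eq_vecMul]
    exact (hA i).symm
  refine ⟨n, {x | ∀ j, 0 ≤ (x ᵥ* B) j}, of A, B, ⟨Set.ext fun x => ⟨fun hx => ?_, ?_⟩, rfl⟩, hAB⟩
  · obtain ⟨y, hy⟩ := h1 x
    rw [vecMulLinear_apply] at hy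
    obtain ⟨y', hy1, hy2⟩ := h y (by rw [hy]; exact hx)
    exact ⟨y', hy1, h3 (by simp only [vecMul_vecMul, ← hAB, hy2, hy])⟩
  · rintro ⟨y, hy, rfl⟩
    rw [Set.mem_ofPred_eq, vecMul_vecMul, ← hAB]
    exact fun j => dotProduct_nonneg_of_nonneg (v := y) (w := fun i => M i j) hy fun i => hM i j

/-! ### Slack matrices of polytopes -/

theorem mem_convexHull_rows_iff {V : Matrix (Fin p) (Fin n) ℝ} {x : Fin n → ℝ} :
    x ∈ convexHull ℝ (Set.range fun i => V i) ↔
      ∃ y : Fin p → ℝ, 0 ≤ y ∧ ∑ i, y i = 1 ∧ y ᵥ* V = x := by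
  have h : (Set.range fun i => V i) =
      V.vecMulLinear '' (Set.range fun i => (Pi.single i 1 : Fin p → ℝ)) := by
    rw [← Set.range_comp]
    congr 1
    funext i
    simp [row]
  rw [h, ← LinearMap.image_convexHull, convexHull_rangle_single_eq_stdSimplex]
  simp [stdSimplex, and_assoc, Pi.le_def]

/-- A bounded polyhedron has no nonzero direction of recession. -/
theorem eq_zero_of_mulVec_nonpos {W : Matrix (Fin q) (Fin n) ℝ} {w : Fin q → ℝ}
    (hb : Bornology.IsBounded {x | W *ᵥ x ≤ w}) {x d : Fin n → ℝ} (hx : W *ᵥ x ≤ w)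
    (hd : W *ᵥ d ≤ 0) : d = 0 := by
  obtain ⟨C, hC⟩ := hb.exists_norm_le
  by_contra h
  have h0 : 0 < ‖d‖ := norm_pos_iff.2 h
  have h1 : ∀ t : ℝ, 0 ≤ t → t * ‖d‖ ≤ C + ‖x‖ := by
    intro t ht
    have h2 : ‖x + t • d‖ ≤ C := hC _ (by
      rw [Set.mem_ofPred_eq, mulVec_add, mulVec_smul]
      intro j
      have := mul_nonpos_of_nonneg_of_nonpos ht (hd j)
      have := hx j
      simp only [Pi.add_apply, Pi.smul_apply, smul_eq_mul]
      linarith)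
    have h3 : ‖t • d‖ ≤ ‖x + t • d‖ + ‖x‖ := by
      have := norm_sub_le (x + t • d) x
      rwa [add_sub_cancel_left] at this
    rw [norm_smul, Real.norm_of_nonneg ht] at h3
    linarith
  have h4 := hC x hx
  have h5 := norm_nonneg x
  have h6 := h1 ((C + ‖x‖ + 1) / ‖d‖) (div_nonneg (by linarith) h0.le)
  rw [div_mul_cancel₀ _ h0.ne'] at h6
  linarith

/-- The slack of a combination of generators, homogenized by the sum of the coefficients. -/
theorem vecMul_slack (V : Matrix (Fin p) (Fin n) ℝ) (W : Matrix (Fin q) (Fin n) ℝ) (w : Fin q → ℝ)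
    (y : Fin p → ℝ) :
    y ᵥ* (of fun i j => w j - (W *ᵥ V i) j) = (∑ i, y i) • w - W *ᵥ (y ᵥ* V) := by
  have h1 : (of fun i j => w j - (W *ᵥ V i) j) = (of fun (_ : Fin p) j => w j) - V * Wᵀ := by
    ext i j
    simp [mul_apply_eq_vecMul, vecMul_transpose]
  have h2 : y ᵥ* (of fun (_ : Fin p) j => w j) = (∑ i, y i) • w := by
    funext j
    simp [Matrix.vecMul, dotProduct, Finset.sum_mul]
  rw [h1, vecMul_sub, h2, ← vecMul_vecMul, vecMul_transpose]

theorem exists_ne_of_one_le_finrank {P : Set (Fin n → ℝ)}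
    (h : 1 ≤ Module.finrank ℝ (vectorSpan ℝ P)) : ∃ x ∈ P, ∃ x' ∈ P, x ≠ x' := by
  by_contra! h'
  have : vectorSpan ℝ P = ⊥ := by
    rw [vectorSpan_def, Submodule.span_eq_bot]
    rintro _ ⟨x, hx, x', hx', rfl⟩
    simp [h' x hx x' hx']
  rw [this, finrank_bot] at h
  omega

/-- If a combination of generators with coefficient sum `σ` has nonnegative slack, then `σ ≥ 0`:
otherwise, dividing by `σ` gives a point at which all inequalities are reversed, and the bounded
polyhedron can only consist of that point. -/
theorem sum_nonneg_of_slack_nonneg {P : Set (Fin n → ℝ)} {V : Matrix (Fin p) (Fin n) ℝ}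
    {W : Matrix (Fin q) (Fin n) ℝ} {w : Fin q → ℝ} (h : IsPolytopeRepresentation P V W w)
    (hP : 1 ≤ Module.finrank ℝ (vectorSpan ℝ P)) (hb : Bornology.IsBounded {x | W *ᵥ x ≤ w})
    {y : Fin p → ℝ} (hy : 0 ≤ (∑ i, y i) • w - W *ᵥ (y ᵥ* V)) : 0 ≤ ∑ i, y i := by
  by_contra hσ
  rw [not_le] at hσ
  set σ := ∑ i, y i
  obtain ⟨x, hx, x', hx', hne⟩ := exists_ne_of_one_le_finrank hP
  have h1 : ∀ x ∈ P, x = σ⁻¹ • (y ᵥ* V) := by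
    intro x hx
    rw [h.2] at hx
    refine sub_eq_zero.1 (eq_zero_of_mulVec_nonpos hb hx fun j => ?_)
    have h2 := hy j
    have h3 := hx j
    rw [mulVec_sub, mulVec_smul]
    simp only [Pi.zero_apply, Pi.sub_apply, Pi.smul_apply, smul_eq_mul] at h2 ⊢
    have h4 : w j ≤ σ⁻¹ * (W *ᵥ (y ᵥ* V)) j := by
      have := mul_le_mul_of_nonpos_left h2 (inv_lt_zero.2 hσ).le
      rw [mul_sub, inv_mul_cancel_left₀ hσ.ne] at this
      linarith
    linarith
  exact hne ((h1 x hx).trans (h1 x' hx').symm)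

theorem isPolytopeSlackMatrix_imp {M : Matrix (Fin p) (Fin q) ℝ} (h : IsPolytopeSlackMatrix M) :
    IsNonneg M ∧ RCGC M ∧ (∀ y, y ᵥ* M = 0 → ∑ i, y i = 0) ∧ ∃ i k j, M i j ≠ M k j := by
  obtain ⟨n, P, V, W, w, h, hP, rfl⟩ := h
  have hconv : ∀ x, W *ᵥ x ≤ w ↔ ∃ y : Fin p → ℝ, 0 ≤ y ∧ ∑ i, y i = 1 ∧ y ᵥ* V = x := by
    intro x
    rw [← mem_convexHull_rows_iff, ← h.1, h.2]
    rfl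
  have hb : Bornology.IsBounded {x | W *ᵥ x ≤ w} := by
    change Bornology.IsBounded {x | ∀ j, (W *ᵥ x) j ≤ w j}
    rw [← h.2, h.1, isBounded_convexHull]
    exact (Set.finite_range _).isBounded
  obtain ⟨x, hx, x', hx', hne⟩ := exists_ne_of_one_le_finrank hP
  have hM : IsNonneg (of fun i j => w j - (W *ᵥ V i) j) := by
    intro i j
    have h1 : V i ∈ P := by
      rw [h.1]
      exact subset_convexHull ℝ _ ⟨i, rfl⟩
    rw [h.2] at h1
    exact sub_nonneg.2 (h1 j)
  have hσ : ∀ y : Fin p → ℝ, 0 ≤ y ᵥ* (of fun i j => w j - (W *ᵥ V i) j) → 0 ≤ ∑ i, y i :=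
    fun y hy => sum_nonneg_of_slack_nonneg h hP hb (by rwa [vecMul_slack] at hy)
  refine ⟨hM, (rcgc_iff hM).2 fun y hy => ?_, fun y hy => ?_, ?_⟩
  -- If the coefficient sum is positive, the combination is a multiple of a point of the polytope;
  -- if it is zero, the combination is a direction of recession.
  · obtain h0 | h0 := (hσ y hy).lt_or_eq
    · set σ := ∑ i, y i
      rw [vecMul_slack] at hy
      obtain ⟨y', h1, h2, h3⟩ := (hconv (σ⁻¹ • (y ᵥ* V))).1 (by
        intro j
        have h2 := mul_le_mul_of_nonneg_left (hy j) (inv_pos.2 h0).le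
        rw [mulVec_smul]
        simp only [Pi.zero_apply, Pi.sub_apply, Pi.smul_apply, smul_eq_mul] at h2 ⊢
        rw [mul_sub, inv_mul_cancel_left₀ h0.ne'] at h2
        linarith)
      refine ⟨σ • y', smul_nonneg h0.le h1, ?_⟩
      rw [vecMul_slack, vecMul_slack, smul_vecMul, h3, smul_inv_smul₀ h0.ne']
      simp [← Finset.mul_sum, h2, σ]
    · refine ⟨0, le_rfl, ?_⟩
      rw [vecMul_slack, ← h0, zero_smul, zero_sub] at hy
      rw [zero_vecMul, vecMul_slack, ← h0,
        eq_zero_of_mulVec_nonpos hb (x := x) (by rw [h.2] at hx; exact hx) (neg_nonneg.1 hy)]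
      simp
  · have h1 := hσ y hy.ge
    have h2 := hσ (-y) (by rw [neg_vecMul, hy, neg_zero])
    simp only [Pi.neg_apply, Finset.sum_neg_distrib] at h2
    linarith
  · by_contra! h'
    have h1 : ∀ i k, V i = V k := by
      intro i k
      refine sub_eq_zero.1 (eq_zero_of_mulVec_nonpos hb (x := x) (by rw [h.2] at hx; exact hx) ?_)
      intro j
      have := h' i k j
      simp only [of_apply] at this
      rw [mulVec_sub]
      simp only [Pi.sub_apply, Pi.zero_apply]
      linarith
    have h2 : (Set.range fun i => V i).Subsingleton := by
      rintro _ ⟨i, rfl⟩ _ ⟨k, rfl⟩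
      exact h1 i k
    have h3 : P.Subsingleton := by
      rw [h.1]
      obtain h3 | ⟨v, h3⟩ := h2.eq_empty_or_singleton
      · simp [h3]
      · simp [h3]
    exact hne (h3 hx hx')

/-- The polytope is the section of the row cone by the affine hyperplane on which `u` is `1`, where
`M u` is the all-ones vector; it is described in coordinates on its direction space. -/
theorem isPolytopeSlackMatrix_of {M : Matrix (Fin p) (Fin q) ℝ} (hM : IsNonneg M) (h : RCGC M)
    (hk : ∀ y, y ᵥ* M = 0 → ∑ i, y i = 0) {i₀ i₁ : Fin p} {j₀ : Fin q} (hne : M i₀ j₀ ≠ M i₁ j₀) :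
    IsPolytopeSlackMatrix M := by
  rw [rcgc_iff hM] at h
  obtain ⟨u, hu⟩ : ∃ u, M *ᵥ u = 1 := by
    have := mem_span_of_iInf_ker_le_ker
      (L := fun j => (LinearMap.proj j).comp M.vecMulLinear)
      (K := ∑ i, (LinearMap.proj i : (Fin p → ℝ) →ₗ[ℝ] ℝ)) (by
        intro y hy
        simp only [Submodule.mem_iInf, LinearMap.mem_ker, LinearMap.comp_apply,
          vecMulLinear_apply, LinearMap.proj_apply] at hy
        simpa using hk y (funext hy))
    obtain ⟨u, hu⟩ := (Submodule.mem_span_range_iff_exists_fun ℝ).1 this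
    refine ⟨u, funext fun i => ?_⟩
    have := LinearMap.congr_fun hu (Pi.single i 1)
    simpa [Matrix.mulVec, dotProduct, Finset.sum_pi_single, mul_comm] using this
  have hrow : ∀ i, M i ⬝ᵥ u = 1 := fun i => congrFun hu i
  have hcomb : ∀ y, (y ᵥ* M) ⬝ᵥ u = ∑ i, y i := fun y => by
    rw [← dotProduct_mulVec, hu, dotProduct_one]
  obtain ⟨n, B, h1, h2, h3⟩ := exists_vecMul_coordinates
    (LinearMap.range M.vecMulLinear ⊓ LinearMap.ker (dotProductBilin ℝ ℝ u))
  have h4 : ∀ i, ∃ x, x ᵥ* B = M i - M i₀ := by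
    refine fun i => h2 _ ⟨⟨Pi.single i 1 - Pi.single i₀ 1, by simp [row]⟩, ?_⟩
    simp [dotProduct_comm u, hrow]
  choose V hV using h4
  have hVB : ∀ y : Fin p → ℝ, ∑ i, y i = 1 → (y ᵥ* of V) ᵥ* B = y ᵥ* M - M i₀ := by
    intro y hy
    have : of V * B = M - of fun _ => M i₀ := by
      funext i
      rw [mul_apply_eq_vecMul]
      exact hV i
    rw [vecMul_vecMul, this, vecMul_sub]
    congr 1
    funext j
    simp [Matrix.vecMul, dotProduct, ← Finset.sum_mul, hy]
  have hW : ∀ x, (∀ j, ((-Bᵀ) *ᵥ x) j ≤ M i₀ j) ↔ 0 ≤ x ᵥ* B + M i₀ := by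
    intro x
    refine forall_congr' fun j => ?_
    rw [neg_mulVec, mulVec_transpose]
    simp only [Pi.neg_apply, Pi.add_apply, Pi.zero_apply]
    constructor <;> intro <;> linarith
  have hP : {x | ∀ j, ((-Bᵀ) *ᵥ x) j ≤ M i₀ j} = convexHull ℝ (Set.range fun i => of V i) := by
    ext x
    rw [mem_convexHull_rows_iff, Set.mem_ofPred_eq, hW]
    constructor
    · intro hx
      obtain ⟨⟨y, hy⟩, hxu⟩ := h1 x
      rw [vecMulLinear_apply] at hy
      replace hxu : (x ᵥ* B) ⬝ᵥ u = 0 := (dotProduct_comm _ _).trans hxu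
      have hy' : (y + Pi.single i₀ 1) ᵥ* M = x ᵥ* B + M i₀ := by
        rw [add_vecMul, hy]
        simp [row]
      obtain ⟨y', h5, h6⟩ := h (y + Pi.single i₀ 1) (by rwa [hy'])
      have h7 : ∑ i, y' i = 1 := by
        rw [← hcomb, h6, hy', add_dotProduct, hxu, hrow, zero_add]
      refine ⟨y', h5, h7, h3 ?_⟩
      simp only
      rw [hVB y' h7, h6, hy', add_sub_cancel_right]
    · rintro ⟨y, hy, h5, rfl⟩
      rw [hVB y h5, sub_add_cancel]
      exact fun j => dotProduct_nonneg_of_nonneg (v := y) (w := fun i => M i j) hy fun i => hM i j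
  refine ⟨n, _, of V, -Bᵀ, M i₀, ⟨hP, rfl⟩, ?_, ?_⟩
  · rw [hP]
    refine Submodule.one_le_finrank_iff.2 fun hbot => hne ?_
    have h5 : V i₀ -ᵥ V i₁ ∈ vectorSpan ℝ (convexHull ℝ (Set.range fun i => of V i)) :=
      vsub_mem_vectorSpan ℝ (subset_convexHull ℝ _ ⟨i₀, rfl⟩) (subset_convexHull ℝ _ ⟨i₁, rfl⟩)
    rw [hbot, Submodule.mem_bot, vsub_eq_zero_iff_eq] at h5
    have h6 := (hV i₀).symm.trans ((congrArg (fun v => v ᵥ* B) h5).trans (hV i₁))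
    exact sub_left_injective (congrFun h6 j₀)
  · ext i j
    have h5 : (of V i ᵥ* B) j = M i j - M i₀ j := congrFun (hV i) j
    rw [of_apply, neg_mulVec, mulVec_transpose, Pi.neg_apply, h5]
    ring

theorem isPolytopeSlackMatrix_iff {M : Matrix (Fin p) (Fin q) ℝ} :
    IsPolytopeSlackMatrix M ↔ IsNonneg M ∧ RCGC M ∧ (∀ y, y ᵥ* M = 0 → ∑ i, y i = 0) ∧
      ∃ i k j, M i j ≠ M k j :=
  ⟨isPolytopeSlackMatrix_imp, fun ⟨h1, h2, h3, _, _, _, h4⟩ => isPolytopeSlackMatrix_of h1 h2 h3 h4⟩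

end SlackCoNP

namespace SlackCoNP

open Matrix

/-! ### Small solutions of linear systems -/

section SmallSolutions

variable {m n : Type*} [Fintype n]

/-- Moving a nonnegative vector `x` in a direction `v` until one more coordinate vanishes. -/
theorem exists_support_ssubset {x v : n → ℝ} (hx : 0 ≤ x) (hv : ∀ j, x j = 0 → v j = 0)
    {j₁ : n} (hj : v j₁ < 0) : ∃ t : ℝ, 0 ≤ t ∧ 0 ≤ x + t • v ∧
      (Finset.univ.filter fun j => (x + t • v) j ≠ 0) ⊂ Finset.univ.filter fun j => x j ≠ 0 := by
  obtain ⟨j₀, h0, hmin⟩ := Finset.exists_min_image (Finset.univ.filter fun j => v j < 0)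
    (fun j => x j / -v j) ⟨j₁, by simpa using hj⟩
  simp only [Finset.mem_filter_univ] at h0 hmin
  have ht : 0 ≤ x j₀ / -v j₀ := div_nonneg (hx j₀) (by linarith)
  refine ⟨x j₀ / -v j₀, ht, fun j => ?_, ?_⟩
  · simp only [Pi.zero_apply, Pi.add_apply, Pi.smul_apply, smul_eq_mul]
    by_cases h : v j < 0
    · have h1 := (le_div_iff₀ (by linarith)).1 (hmin j h)
      linarith
    · exact add_nonneg (hx j) (mul_nonneg ht (not_lt.1 h))
  · refine Finset.ssubset_iff_subset_ne.2 ⟨fun j => ?_, fun h => ?_⟩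
    · simp only [Finset.mem_filter_univ, Pi.add_apply, Pi.smul_apply, smul_eq_mul]
      exact fun h h' => h (by simp [h', hv j h'])
    · have h1 : j₀ ∈ Finset.univ.filter fun j => x j ≠ 0 := by
        simp only [Finset.mem_filter_univ]
        exact fun h' => h0.ne (hv _ h')
      rw [← h] at h1
      simp only [Finset.mem_filter_univ, Pi.add_apply, Pi.smul_apply, smul_eq_mul] at h1
      refine h1 ?_
      have := h0.ne
      field_simp
      ring

/-- Among the solutions of a linear system there is one that is basic: the columns that belong to
nonzero coordinates are linearly independent. The hypothesis on the kernel says that the sum of the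
coordinates of a solution is determined by the system. -/
theorem exists_basic_solution {A : Matrix m n ℝ} {b : m → ℝ} {c : n → ℝ}
    (hA : ∀ v, A *ᵥ v = 0 → ∑ j, v j = 0) {x : n → ℝ} (hx : 0 ≤ x) (hb : A *ᵥ x = b)
    (hc : c ⬝ᵥ x < 0) : ∃ x : n → ℝ, 0 ≤ x ∧ A *ᵥ x = b ∧ c ⬝ᵥ x < 0 ∧
      ∀ v, (∀ j, x j = 0 → v j = 0) → A *ᵥ v = 0 → v = 0 := by
  obtain ⟨x, ⟨h1, h2, h3⟩, hmin⟩ := (measure fun x : n → ℝ =>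
    (Finset.univ.filter fun j => x j ≠ 0).card).wf.has_min
      {x | 0 ≤ x ∧ A *ᵥ x = b ∧ c ⬝ᵥ x < 0} ⟨x, hx, hb, hc⟩
  -- A vector in the kernel has coordinates of both signs, so one can move along it in the
  -- direction in which `c` does not increase.
  have key : ∀ v, (∀ j, x j = 0 → v j = 0) → A *ᵥ v = 0 → c ⬝ᵥ v ≤ 0 → v = 0 := by
    intro v hv hAv hcv
    by_contra h0
    obtain ⟨j, hj⟩ : ∃ j, v j < 0 := by
      by_contra! h4
      exact h0 (funext fun j =>
        (Finset.sum_eq_zero_iff_of_nonneg fun j _ => h4 j).1 (hA v hAv) j (Finset.mem_univ j))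
    obtain ⟨t, ht, h4, h5⟩ := exists_support_ssubset h1 hv hj
    refine hmin (x + t • v) ⟨h4, ?_, ?_⟩ (Finset.card_lt_card h5)
    · rw [mulVec_add, mulVec_smul, hAv, smul_zero, add_zero, h2]
    · rw [dotProduct_add, dotProduct_smul, smul_eq_mul]
      have := mul_nonpos_of_nonneg_of_nonpos ht hcv
      linarith
  refine ⟨x, h1, h2, h3, fun v hv hAv => ?_⟩
  obtain h | h := le_total (c ⬝ᵥ v) 0
  · exact key v hv hAv h
  · refine neg_eq_zero.1 (key (-v) (fun j hj => by simp [hv j hj]) ?_ ?_)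
    · rw [mulVec_neg, hAv, neg_zero]
    · rwa [dotProduct_neg, neg_nonpos]

/-- Cramer's rule for a system with linearly independent columns, in the form of its normal
equations. -/
theorem exists_bounded_multiple [Fintype m] [DecidableEq n] (A : Matrix m n ℤ) (b : m → ℤ) {B : ℕ}
    (hAB : ∀ i j, |A i j| ≤ B) (hbB : ∀ i, |b i| ≤ B)
    (hA : ∀ v : n → ℝ, A.map (Int.castRingHom ℝ) *ᵥ v = 0 → v = 0) {x : n → ℝ}
    (hx : A.map (Int.castRingHom ℝ) *ᵥ x = Int.castRingHom ℝ ∘ b) :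
    ∃ (y : n → ℤ) (d : ℤ), d ≠ 0 ∧ (∀ j, (y j : ℝ) = d * x j) ∧
      ∀ j, |y j| ≤ (Fintype.card n).factorial * (Fintype.card m * B ^ 2) ^ Fintype.card n := by
  set f := Int.castRingHom ℝ
  have hker : ∀ v : n → ℝ, (Aᵀ * A).map f *ᵥ v = 0 → v = 0 := by
    intro v hv
    refine hA v (dotProduct_self_eq_zero.1 ?_)
    rw [Matrix.map_mul, ← mulVec_mulVec] at hv
    rw [dotProduct_mulVec, ← mulVec_transpose, ← transpose_map, hv, zero_dotProduct]
  have hdet : (Aᵀ * A).det ≠ 0 := by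
    intro h0
    have h1 : ((Aᵀ * A).map f).det = 0 := by
      have := RingHom.map_det f (Aᵀ * A)
      rw [h0, map_zero] at this
      exact this.symm
    obtain ⟨v, hv, hv'⟩ := exists_mulVec_eq_zero_iff.2 h1
    exact hv (hker v hv')
  refine ⟨cramer (Aᵀ * A) (Aᵀ *ᵥ b), (Aᵀ * A).det, hdet, fun j => ?_, fun j => ?_⟩
  · have h1 : (Aᵀ * A).map f *ᵥ (f ∘ cramer (Aᵀ * A) (Aᵀ *ᵥ b)) =
        (Aᵀ * A).map f *ᵥ (((Aᵀ * A).det : ℝ) • x) := by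
      have h2 := congrArg (f ∘ ·) (mulVec_cramer (Aᵀ * A) (Aᵀ *ᵥ b))
      have h3 : f ∘ ((Aᵀ * A) *ᵥ cramer (Aᵀ * A) (Aᵀ *ᵥ b)) =
        (Aᵀ * A).map f *ᵥ (f ∘ cramer (Aᵀ * A) (Aᵀ *ᵥ b)) := funext (RingHom.map_mulVec f _ _)
      have h4 : f ∘ (Aᵀ *ᵥ b) = (Aᵀ).map f *ᵥ (f ∘ b) := funext (RingHom.map_mulVec f _ _)
      have h5 : f ∘ ((Aᵀ * A).det • (Aᵀ *ᵥ b)) = ((Aᵀ * A).det : ℝ) • (f ∘ (Aᵀ *ᵥ b)) := by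
        funext j
        simp [f]
      have h6 : (Aᵀ * A).map f *ᵥ x = f ∘ (Aᵀ *ᵥ b) := by
        rw [Matrix.map_mul, ← mulVec_mulVec, hx, h4]
      rw [← h3, mulVec_smul, h6, ← h5]
      exact h2
    rw [← sub_eq_zero, ← mulVec_sub] at h1
    have := congrFun (sub_eq_zero.1 (hker _ h1)) j
    simpa [f] using this
  · have hsum : ∀ u v : m → ℤ, (∀ i, |u i| ≤ B) → (∀ i, |v i| ≤ B) →
        |u ⬝ᵥ v| ≤ (Fintype.card m * B ^ 2 : ℤ) := by
      intro u v hu hv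
      calc |u ⬝ᵥ v| ≤ ∑ i, |u i * v i| := Finset.abs_sum_le_sum_abs _ _
        _ ≤ ∑ _i : m, (B ^ 2 : ℤ) := Finset.sum_le_sum fun i _ => by
          rw [abs_mul, sq]
          exact mul_le_mul (hu i) (hv i) (abs_nonneg _) (by positivity)
        _ = _ := by simp
    rw [cramer_apply]
    have := det_le (A := (Aᵀ * A).updateCol j (Aᵀ *ᵥ b)) (abv := AbsoluteValue.abs)
      (x := (Fintype.card m * B ^ 2 : ℤ)) (fun i k => by
        rw [updateCol_apply]
        split_ifs
        · exact hsum _ _ (fun k => hAB k i) hbB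
        · exact hsum _ _ (fun k => hAB k i) fun l => hAB l k)
    simpa using this

/-- If a linear system with integer coefficients, which determines the sum of the coordinates, has
a nonnegative real solution with `c · x < 0`, then a multiple of it has a solution of this kind in
natural numbers that are bounded in terms of the coefficients. -/
theorem exists_bounded_solution [Fintype m] [Nonempty m] (A : Matrix m n ℤ) (b : m → ℤ)
    {c : n → ℝ} {B : ℕ} (hB : 0 < B) (hAB : ∀ i j, |A i j| ≤ B) (hbB : ∀ i, |b i| ≤ B)
    (hA : ∀ v : n → ℝ, A.map (Int.castRingHom ℝ) *ᵥ v = 0 → ∑ j, v j = 0) {x : n → ℝ} (hx : 0 ≤ x)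
    (hb : A.map (Int.castRingHom ℝ) *ᵥ x = Int.castRingHom ℝ ∘ b) (hc : c ⬝ᵥ x < 0) :
    ∃ (y : n → ℕ) (d : ℕ), (A.map (Int.castRingHom ℝ) *ᵥ fun j => (y j : ℝ)) =
        (d : ℝ) • (Int.castRingHom ℝ ∘ b) ∧ (c ⬝ᵥ fun j => (y j : ℝ)) < 0 ∧
      ∀ j, y j ≤ (Fintype.card n).factorial * (Fintype.card m * B ^ 2) ^ Fintype.card n := by
  classical
  obtain ⟨x, hx, hb, hc, hbas⟩ := exists_basic_solution hA hx hb hc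
  set f := Int.castRingHom ℝ
  set J := {j // x j ≠ 0}
  have hext : ∀ v : n → ℝ, (∀ j, x j = 0 → v j = 0) →
      (A.submatrix id ((↑) : J → n)).map f *ᵥ (fun j => v j) = A.map f *ᵥ v := by
    intro v hv
    funext i
    simp only [mulVec, dotProduct]
    rw [← Fintype.sum_subtype_add_sum_subtype (fun j => x j ≠ 0), Finset.sum_eq_zero (s :=
      (Finset.univ : Finset {j // ¬ x j ≠ 0})), add_zero]
    · rfl
    · rintro ⟨j, hj⟩ -
      simp [hv j (not_not.1 hj)]
  obtain ⟨z, d, hd, hz, hzB⟩ := exists_bounded_multiple (A.submatrix id ((↑) : J → n)) b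
    (fun i j => hAB i j) hbB (fun v hv => by
      set v' : n → ℝ := fun j => if h : x j ≠ 0 then v ⟨j, h⟩ else 0 with hv'
      have h1 : ∀ j, x j = 0 → v' j = 0 := fun j hj => by simp [hv', hj]
      have h2 : (fun j : J => v' j) = v := funext fun j => by simp [hv', j.2]
      have h3 := hbas v' h1 (by rw [← hext v' h1, h2, hv])
      rw [← h2, h3]
      rfl) (x := fun j => x j) (by rw [hext x fun _ h => h, hb])
  have hy : (fun j => ((if h : x j ≠ 0 then (z ⟨j, h⟩).natAbs else 0 : ℕ) : ℝ)) =
      (d.natAbs : ℝ) • x := by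
    funext j
    by_cases h : x j ≠ 0
    · have h1 := hz ⟨j, h⟩
      have h2 := hx j
      rw [dif_pos h, Nat.cast_natAbs, Int.cast_abs, h1, abs_mul, abs_of_nonneg h2]
      simp
    · simp [not_not.1 h]
  refine ⟨fun j => if h : x j ≠ 0 then (z ⟨j, h⟩).natAbs else 0, d.natAbs, ?_, ?_, fun j => ?_⟩
  · rw [hy, mulVec_smul, hb]
  · rw [hy, dotProduct_smul, smul_eq_mul]
    exact mul_neg_of_pos_of_neg (by exact_mod_cast Int.natAbs_pos.2 hd) hc
  · dsimp only
    split_ifs with h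
    · have h1 := hzB ⟨j, h⟩
      have h2 : Fintype.card J ≤ Fintype.card n := Fintype.card_subtype_le _
      have h3 : 0 < Fintype.card m * B ^ 2 := Nat.mul_pos Fintype.card_pos (by positivity)
      have h4 : (z ⟨j, h⟩).natAbs ≤
          (Fintype.card J).factorial * (Fintype.card m * B ^ 2) ^ Fintype.card J := by
        zify
        exact h1
      exact h4.trans (Nat.mul_le_mul (Nat.factorial_le h2) (Nat.pow_le_pow_right h3 h2))
    · exact Nat.zero_le _

end SmallSolutions

end SlackCoNP

namespace SlackCoNP

open Matrix

/-! ### Small witnesses -/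

section SmallWitnesses

variable {m n : Type*} [Fintype m] [Fintype n]

/-- The system in the nonnegative unknowns `yp`, `yn`, `s` that says that the slack `s` is equal to
`(yp - yn)ᵀ A` and, in its last row, prescribes the sum of all unknowns. -/
def slackSystem [DecidableEq n] (A : Matrix m n ℤ) : Matrix (n ⊕ Unit) (m ⊕ m ⊕ n) ℤ :=
  of (Sum.elim (fun j => Sum.elim (fun i => A i j) (Sum.elim (fun i => -A i j) (-Pi.single j 1)))
    fun _ _ => 1)

theorem slackSystem_mulVec_inl [DecidableEq n] (A : Matrix m n ℤ) (x : m ⊕ m ⊕ n → ℝ) (j : n) :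
    ((slackSystem A).map (Int.castRingHom ℝ) *ᵥ x) (.inl j) =
      ((fun i => x (.inl i) - x (.inr (.inl i))) ᵥ* A.map (Int.castRingHom ℝ)) j -
        x (.inr (.inr j)) := by
  simp [slackSystem, Matrix.mulVec, Matrix.vecMul, dotProduct, Pi.single_apply, mul_comm,
    ← sub_eq_add_neg, ← add_sub_assoc, mul_sub]

theorem slackSystem_mulVec_inr [DecidableEq n] (A : Matrix m n ℤ) (x : m ⊕ m ⊕ n → ℝ) (u : Unit) :
    ((slackSystem A).map (Int.castRingHom ℝ) *ᵥ x) (.inr u) = ∑ k, x k := by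
  simp [slackSystem, Matrix.mulVec, dotProduct]

/-- A bound for the basic solutions of systems with `r` rows, `s` columns, and entries at
most `B`. -/
def solutionBound (r s B : ℕ) : ℕ := s.factorial * (r * B ^ 2) ^ s

theorem solutionBound_mono {r r' s s' B B' : ℕ} (hr : r ≤ r') (hs : s ≤ s') (hB : B ≤ B')
    (h : 0 < r' * B' ^ 2) : solutionBound r s B ≤ solutionBound r' s' B' := by
  refine Nat.mul_le_mul (Nat.factorial_le hs) ?_
  exact (Nat.pow_le_pow_left (by gcongr) s).trans (Nat.pow_le_pow_right h hs)

/-- If some real combination `y` of the rows of an integer matrix is nonnegative while `y · c < 0`,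
then there is such a combination with small integer coefficients, given as differences of natural
numbers. -/
theorem exists_small_combination (A : Matrix m n ℤ) {B : ℕ} (hB : 0 < B)
    (hAB : ∀ i j, |A i j| ≤ B) {c y : m → ℝ} (hy : 0 ≤ y ᵥ* A.map (Int.castRingHom ℝ))
    (hc : y ⬝ᵥ c < 0) : ∃ yp yn : m → ℕ,
      0 ≤ (fun i => (yp i - yn i : ℝ)) ᵥ* A.map (Int.castRingHom ℝ) ∧
      (fun i => (yp i - yn i : ℝ)) ⬝ᵥ c < 0 ∧
      ∀ i, yp i ≤ solutionBound (Fintype.card n + 1)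
          (Fintype.card m + (Fintype.card m + Fintype.card n)) B ∧
        yn i ≤ solutionBound (Fintype.card n + 1)
          (Fintype.card m + (Fintype.card m + Fintype.card n)) B := by
  classical
  have hB' : (1 : ℤ) ≤ B := by exact_mod_cast hB
  have hcost : ∀ x : m ⊕ m ⊕ n → ℝ, Sum.elim c (Sum.elim (-c) 0) ⬝ᵥ x =
      (fun i => x (.inl i) - x (.inr (.inl i))) ⬝ᵥ c := by
    intro x
    simp [dotProduct, mul_comm, ← sub_eq_add_neg, mul_sub]
  -- The given solution, split into positive and negative parts.
  set x : m ⊕ m ⊕ n → ℝ := Sum.elim (fun i => max (y i) 0) (Sum.elim (fun i => max (-y i) 0)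
    (y ᵥ* A.map (Int.castRingHom ℝ))) with hx
  have hdiff : (fun i => x (.inl i) - x (.inr (.inl i))) = y := by
    funext i
    simp only [hx, Sum.elim_inl, Sum.elim_inr]
    obtain h | h := le_total (y i) 0
    · rw [max_eq_right h, max_eq_left (by linarith)]; ring
    · rw [max_eq_left h, max_eq_right (by linarith)]; ring
  have hx0 : 0 ≤ x := by
    rintro (i | i | j)
    · exact le_max_right _ _
    · exact le_max_right _ _
    · exact hy j
  have hcx : Sum.elim c (Sum.elim (-c) 0) ⬝ᵥ x < 0 := by rw [hcost, hdiff]; exact hc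
  have hT : 0 < ∑ k, x k := by
    refine (Finset.sum_nonneg fun k _ => hx0 k).lt_of_ne' fun h0 => hcx.ne ?_
    have : x = 0 := funext fun k =>
      (Finset.sum_eq_zero_iff_of_nonneg fun k _ => hx0 k).1 h0 k (Finset.mem_univ k)
    rw [this, dotProduct_zero]
  have hbd : ∀ k l, |slackSystem A k l| ≤ B := by
    rintro (j | u) k
    · rcases k with i | i | k
      · exact hAB i j
      · simpa [slackSystem] using hAB i j
      · by_cases h : k = j
        · subst h
          simpa [slackSystem] using hB'
        · simp [slackSystem, h]
    · simpa [slackSystem] using hB'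
  have hrhs : ∀ k : n ⊕ Unit, |(Sum.elim 0 1 : n ⊕ Unit → ℤ) k| ≤ B := by
    rintro (j | u)
    · simp
    · simpa using hB'
  have hsum : ∀ v, (slackSystem A).map (Int.castRingHom ℝ) *ᵥ v = 0 → ∑ k, v k = 0 := by
    intro v hv
    rw [← slackSystem_mulVec_inr A v (), hv, Pi.zero_apply]
  have hsol : (slackSystem A).map (Int.castRingHom ℝ) *ᵥ ((∑ k, x k)⁻¹ • x) =
      Int.castRingHom ℝ ∘ (Sum.elim 0 1 : n ⊕ Unit → ℤ) := by
    rw [mulVec_smul]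
    funext k
    rcases k with j | u
    · rw [Pi.smul_apply, slackSystem_mulVec_inl, hdiff]
      simp [hx]
    · rw [Pi.smul_apply, slackSystem_mulVec_inr, smul_eq_mul, inv_mul_cancel₀ hT.ne']
      simp
  obtain ⟨z, d, h1, h2, h3⟩ := exists_bounded_solution (slackSystem A) (Sum.elim 0 1)
    (c := Sum.elim c (Sum.elim (-c) 0)) hB hbd hrhs hsum (smul_nonneg (inv_pos.2 hT).le hx0) hsol
    (by
      rw [dotProduct_smul, smul_eq_mul]
      exact mul_neg_of_pos_of_neg (inv_pos.2 hT) hcx)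
  have h4 : ∀ j, ((fun i => (z (.inl i) - z (.inr (.inl i)) : ℝ)) ᵥ*
      A.map (Int.castRingHom ℝ)) j = z (.inr (.inr j)) := by
    intro j
    have h5 := congrFun h1 (.inl j)
    rw [slackSystem_mulVec_inl] at h5
    simpa [sub_eq_zero] using h5
  simp only [Fintype.card_sum, Fintype.card_unit] at h3
  refine ⟨fun i => z (.inl i), fun i => z (.inr (.inl i)), fun j => ?_, ?_, fun i => ⟨h3 _, h3 _⟩⟩
  · rw [h4]
    exact Nat.cast_nonneg _
  · rw [hcost] at h2
    exact h2

end SmallWitnesses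

variable {p q : ℕ}

theorem natSep_iff {N : Matrix (Fin p) (Fin q) ℕ} {yp yn : Fin p → ℕ} {zp zn : Fin q → ℕ} :
    NatSep N yp yn zp zn ↔ Sep (N.map (Nat.cast : ℕ → ℝ)) (fun i => yp i - yn i)
      fun j => zp j - zn j := by
  have h1 : ∀ (y : Fin p → ℕ) j, ((y ᵥ* N) j : ℝ) =
      ((fun i => (y i : ℝ)) ᵥ* N.map (Nat.cast : ℕ → ℝ)) j := fun y j =>
    RingHom.map_vecMul (Nat.castRingHom ℝ) N y j
  have h2 : ∀ (z : Fin q → ℕ) i, ((N *ᵥ z) i : ℝ) =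
      (N.map (Nat.cast : ℕ → ℝ) *ᵥ fun j => (z j : ℝ)) i := fun z i =>
    RingHom.map_mulVec (Nat.castRingHom ℝ) N z i
  have h3 : ∀ (u z : Fin q → ℕ), ((u ⬝ᵥ z : ℕ) : ℝ) = (fun j => (u j : ℝ)) ⬝ᵥ fun j => (z j : ℝ) :=
    fun u z => RingHom.map_dotProduct (Nat.castRingHom ℝ) u z
  have h4 : ∀ u v : Fin p → ℕ, (fun i => (u i - v i : ℝ)) =
      (fun i => (u i : ℝ)) - fun i => (v i : ℝ) := fun u v => rfl
  have h5 : ∀ u v : Fin q → ℕ, (fun i => (u i - v i : ℝ)) =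
      (fun i => (u i : ℝ)) - fun i => (v i : ℝ) := fun u v => rfl
  rw [NatSep, Sep, h4, h5, sub_vecMul, mulVec_sub, sub_nonneg, sub_nonneg]
  have e1 : N *ᵥ zn ≤ N *ᵥ zp ↔ (N.map (Nat.cast : ℕ → ℝ) *ᵥ fun j => (zn j : ℝ)) ≤
      N.map (Nat.cast : ℕ → ℝ) *ᵥ fun j => (zp j : ℝ) := by
    refine forall_congr' fun i => ?_
    rw [← h2, ← h2, Nat.cast_le]
  have e2 : yn ᵥ* N ≤ yp ᵥ* N ↔ (fun i => (yn i : ℝ)) ᵥ* N.map (Nat.cast : ℕ → ℝ) ≤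
      (fun i => (yp i : ℝ)) ᵥ* N.map (Nat.cast : ℕ → ℝ) := by
    refine forall_congr' fun i => ?_
    rw [← h1, ← h1, Nat.cast_le]
  rw [e1, e2, ← Nat.cast_lt (α := ℝ)]
  simp only [Nat.cast_add, h3, h1]
  rw [sub_dotProduct, dotProduct_sub, dotProduct_sub]
  constructor
  · rintro ⟨a, b, c⟩
    exact ⟨b, a, by linarith⟩
  · rintro ⟨a, b, c⟩
    exact ⟨b, a, by linarith⟩

theorem natKer_iff {N : Matrix (Fin p) (Fin q) ℕ} {yp yn : Fin p → ℕ} :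
    NatKer N yp yn ↔ (fun i => (yp i - yn i : ℝ)) ᵥ* N.map (Nat.cast : ℕ → ℝ) = 0 ∧
      ∑ i, (yp i - yn i : ℝ) ≠ 0 := by
  have h1 : ∀ (y : Fin p → ℕ) j, ((y ᵥ* N) j : ℝ) =
      ((fun i => (y i : ℝ)) ᵥ* N.map (Nat.cast : ℕ → ℝ)) j := fun y j =>
    RingHom.map_vecMul (Nat.castRingHom ℝ) N y j
  have h4 : (fun i => (yp i - yn i : ℝ)) = (fun i => (yp i : ℝ)) - fun i => (yn i : ℝ) := rfl
  rw [NatKer, Finset.sum_sub_distrib, h4, sub_vecMul, sub_eq_zero, sub_ne_zero, funext_iff,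
    funext_iff]
  simp only [← h1, Nat.cast_inj]
  exact_mod_cast Iff.rfl

theorem Sep.smul_iff {M : Matrix (Fin p) (Fin q) ℝ} {y : Fin p → ℝ} {z : Fin q → ℝ} {D : ℝ}
    (hD : 0 < D) : Sep (D • M) y z ↔ Sep M y z := by
  have h : ∀ {n : ℕ} {v : Fin n → ℝ}, 0 ≤ D • v ↔ 0 ≤ v := fun {n v} =>
    forall_congr' fun j => mul_nonneg_iff_of_pos_left hD
  rw [Sep, Sep, vecMul_smul, smul_mulVec, smul_dotProduct, h, h, smul_neg_iff_of_pos_left hD]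

/-- A separating pair is replaced by one of small integer vectors, first `y` and then `z`. -/
theorem exists_small_natSep {N : Matrix (Fin p) (Fin q) ℕ} {B : ℕ} (hB : 0 < B)
    (hN : ∀ i j, N i j ≤ B) {y : Fin p → ℝ} {z : Fin q → ℝ}
    (h : Sep (N.map (Nat.cast : ℕ → ℝ)) y z) : ∃ yp yn zp zn, NatSep N yp yn zp zn ∧
      (∀ i, yp i ≤ solutionBound (q + 1) (p + (p + q)) B ∧
        yn i ≤ solutionBound (q + 1) (p + (p + q)) B) ∧
      ∀ j, zp j ≤ solutionBound (p + 1) (q + (q + p)) B ∧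
        zn j ≤ solutionBound (p + 1) (q + (q + p)) B := by
  have hmap : (N.map (Nat.cast : ℕ → ℤ)).map (Int.castRingHom ℝ) = N.map (Nat.cast : ℕ → ℝ) := by
    ext i j
    simp
  have hmap' : (N.map (Nat.cast : ℕ → ℤ))ᵀ.map (Int.castRingHom ℝ) =
      (N.map (Nat.cast : ℕ → ℝ))ᵀ := by
    ext i j
    simp
  have hNB : ∀ i j, |N.map (Nat.cast : ℕ → ℤ) i j| ≤ B := by
    intro i j
    simpa using hN i j
  obtain ⟨h1, h2, h3⟩ := h
  obtain ⟨yp, yn, h4, h5, h6⟩ := exists_small_combination (N.map (Nat.cast : ℕ → ℤ)) hB hNB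
    (by rwa [hmap]) (c := N.map (Nat.cast : ℕ → ℝ) *ᵥ z) (by rwa [dotProduct_mulVec])
  rw [hmap] at h4
  obtain ⟨zp, zn, h7, h8, h9⟩ := exists_small_combination (N.map (Nat.cast : ℕ → ℤ))ᵀ hB
    (fun j i => hNB i j) (y := z) (by rwa [hmap', vecMul_transpose])
    (c := (fun i => (yp i - yn i : ℝ)) ᵥ* N.map (Nat.cast : ℕ → ℝ))
    (by rwa [dotProduct_comm, ← dotProduct_mulVec])
  rw [hmap', vecMul_transpose] at h7
  rw [dotProduct_comm] at h8
  simp only [Fintype.card_fin] at h6 h9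
  exact ⟨yp, yn, zp, zn, natSep_iff.2 ⟨h4, h7, h8⟩, h6, h9⟩

/-- A vector in the left kernel with nonzero coefficient sum is replaced by a small integer one: up
to sign, it is a vector `y` with `yᵀ (N, -N) ≥ 0` and `∑ i, y i < 0`. -/
theorem exists_small_natKer {N : Matrix (Fin p) (Fin q) ℕ} {B : ℕ} (hB : 0 < B)
    (hN : ∀ i j, N i j ≤ B) {y : Fin p → ℝ} (h : y ᵥ* N.map (Nat.cast : ℕ → ℝ) = 0)
    (hy : ∑ i, y i ≠ 0) : ∃ yp yn, NatKer N yp yn ∧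
      ∀ i, yp i ≤ solutionBound (q + q + 1) (p + (p + (q + q))) B ∧
        yn i ≤ solutionBound (q + q + 1) (p + (p + (q + q))) B := by
  wlog hneg : ∑ i, y i < 0 generalizing y
  · refine this (y := -y) (by rw [neg_vecMul, h, neg_zero]) (by simpa using hy) ?_
    have := hy.lt_or_gt.resolve_left hneg
    simpa using this
  set A : Matrix (Fin p) (Fin q ⊕ Fin q) ℤ :=
    fromCols (N.map (Nat.cast : ℕ → ℤ)) (-N.map (Nat.cast : ℕ → ℤ)) with hA
  have hmap : A.map (Int.castRingHom ℝ) =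
      fromCols (N.map (Nat.cast : ℕ → ℝ)) (-N.map (Nat.cast : ℕ → ℝ)) := by
    ext i (j | j) <;> simp [hA]
  obtain ⟨yp, yn, h1, h2, h3⟩ := exists_small_combination A hB
    (by rintro i (j | j) <;> simpa [hA] using hN i j) (c := 1) (y := y)
    (by rw [hmap, vecMul_fromCols, vecMul_neg, h]; rintro (j | j) <;> simp)
    (by rwa [dotProduct_one])
  refine ⟨yp, yn, natKer_iff.2 ⟨?_, ?_⟩, ?_⟩
  · rw [hmap, vecMul_fromCols, vecMul_neg] at h1
    funext j
    have h4 := h1 (.inl j)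
    have h5 := h1 (.inr j)
    simp only [Sum.elim_inl, Sum.elim_inr, Pi.zero_apply, Pi.neg_apply, neg_nonneg] at h4 h5
    exact le_antisymm h5 h4
  · rw [dotProduct_one] at h2
    exact h2.ne
  · simpa using h3

/-! ### Assembling the certificates -/

/-- A bound for the number of bits of the numbers in a certificate, in terms of the length of the
input string. The scaled matrix has entries of at most `2 ^ (X ^ 3 + X)`; the systems to be solved
have at most `2 * X + 1` rows and `4 * X` columns. -/
noncomputable def bitBound : Polynomial ℕ :=
  4 * .X * (4 * .X) + (2 * .X + 1 + (.X ^ 3 + .X) * 2) * (4 * .X) + (.X ^ 3 + .X) + 1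

theorem solutionBound_lt {r s ℓ : ℕ} (hr : r ≤ 2 * ℓ + 1) (hs : s ≤ 4 * ℓ) :
    solutionBound r s (2 ^ (ℓ ^ 3 + ℓ)) < 2 ^ bitBound.eval ℓ := by
  refine (solutionBound_mono hr hs le_rfl (by positivity)).trans_lt ?_
  calc solutionBound (2 * ℓ + 1) (4 * ℓ) (2 ^ (ℓ ^ 3 + ℓ))
      ≤ (2 ^ (4 * ℓ)) ^ (4 * ℓ) *
        (2 ^ (2 * ℓ + 1) * (2 ^ (ℓ ^ 3 + ℓ)) ^ 2) ^ (4 * ℓ) := by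
        refine Nat.mul_le_mul ((Nat.factorial_le_pow _).trans ?_) ?_
        · exact Nat.pow_le_pow_left Nat.lt_two_pow_self.le _
        · exact Nat.pow_le_pow_left (Nat.mul_le_mul_right _ Nat.lt_two_pow_self.le) _
    _ = 2 ^ (4 * ℓ * (4 * ℓ) + (2 * ℓ + 1 + (ℓ ^ 3 + ℓ) * 2) * (4 * ℓ)) := by
        rw [← pow_mul, ← pow_mul, ← pow_add, ← pow_mul, ← pow_add]
    _ < 2 ^ bitBound.eval ℓ := by
        refine Nat.pow_lt_pow_right (by norm_num) ?_
        simp [bitBound]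

theorem scale_lt {ℓ a : ℕ} (ha : a ≤ 2 ^ (ℓ ^ 3 + ℓ)) : a < 2 ^ bitBound.eval ℓ := by
  refine ha.trans_lt (Nat.pow_lt_pow_right (by norm_num) ?_)
  simp [bitBound]

theorem FractionMatrix.exists_sep_cert (F : FractionMatrix p q) {D : ℕ}
    {N : Matrix (Fin p) (Fin q) ℕ} (hN : ∀ i j, N i j ≤ 2 ^ (F.encode.length ^ 3 + F.encode.length))
    (hD : D ≤ 2 ^ (F.encode.length ^ 3)) {y : Fin p → ℝ} {z : Fin q → ℝ}
    (h : Sep (N.map (Nat.cast : ℕ → ℝ)) y z) : ∃ yp yn zp zn, NatSep N yp yn zp zn ∧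
      (certTree D N yp yn zp zn).size ≤ (certBound bitBound).eval F.encode.length := by
  obtain ⟨yp, yn, zp, zn, h1, h2, h3⟩ := exists_small_natSep (by positivity) hN h
  have hp := F.rows_le
  have hq := F.cols_le
  have h4 := solutionBound_lt (r := q + 1) (s := p + (p + q)) (ℓ := F.encode.length) (by omega)
    (by omega)
  have h5 := solutionBound_lt (r := p + 1) (s := q + (q + p)) (ℓ := F.encode.length) (by omega)
    (by omega)
  refine ⟨yp, yn, zp, zn, h1, size_certTree_le hp hq
    (scale_lt (hD.trans (Nat.pow_le_pow_right (by norm_num) (by omega))))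
    (fun i j => scale_lt (hN i j)) ?_ ?_ ?_ ?_⟩
  · exact fun i => (h2 i).1.trans_lt h4
  · exact fun i => (h2 i).2.trans_lt h4
  · exact fun i => (h3 i).1.trans_lt h5
  · exact fun i => (h3 i).2.trans_lt h5

theorem FractionMatrix.exists_ker_cert (F : FractionMatrix p q) {D : ℕ}
    {N : Matrix (Fin p) (Fin q) ℕ} (hN : ∀ i j, N i j ≤ 2 ^ (F.encode.length ^ 3 + F.encode.length))
    (hD : D ≤ 2 ^ (F.encode.length ^ 3)) {y : Fin p → ℝ}
    (h : y ᵥ* N.map (Nat.cast : ℕ → ℝ) = 0) (hy : ∑ i, y i ≠ 0) :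
    ∃ yp yn, NatKer N yp yn ∧
      (certTree D N yp yn 0 0).size ≤ (certBound bitBound).eval F.encode.length := by
  obtain ⟨yp, yn, h1, h2⟩ := exists_small_natKer (by positivity) hN h hy
  have hp := F.rows_le
  have hq := F.cols_le
  have h4 := solutionBound_lt (r := q + q + 1) (s := p + (p + (q + q))) (ℓ := F.encode.length)
    (by omega) (by omega)
  exact ⟨yp, yn, h1, size_certTree_le hp hq
    (scale_lt (hD.trans (Nat.pow_le_pow_right (by norm_num) (by omega))))
    (fun i j => scale_lt (hN i j)) (fun i => (h2 i).1.trans_lt h4) (fun i => (h2 i).2.trans_lt h4)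
    (fun _ => by simp) (fun _ => by simp)⟩

theorem FractionMatrix.isNonneg_toReal (F : FractionMatrix p q) (hF : ∀ i j, 0 ≤ F.num i j) :
    IsNonneg F.toReal := fun i j =>
  div_nonneg (by exact_mod_cast hF i j) (Nat.cast_nonneg _)

theorem FractionMatrix.Scaled.sep_iff {F : FractionMatrix p q} {D : ℕ}
    {N : Matrix (Fin p) (Fin q) ℕ} (h : F.Scaled D N) (hF : ∀ i j, 0 ≤ F.num i j)
    {y : Fin p → ℝ} {z : Fin q → ℝ} : Sep (N.map (Nat.cast : ℕ → ℝ)) y z ↔ Sep F.toReal y z := by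
  rw [h.map_eq hF, Sep.smul_iff (by exact_mod_cast h.1)]

/-- Separating pairs serve as certificates. -/
theorem inCoNP_rcgc {P : ∀ {p q : ℕ}, Matrix (Fin p) (Fin q) ℝ → Prop}
    (hP : ∀ {p q : ℕ} {M : Matrix (Fin p) (Fin q) ℝ}, P M ↔ IsNonneg M ∧ RCGC M) :
    InCoNP (matrixProblem P) := by
  refine inCoNP_of_check (fun h => (hP.1 h).1) PolyTime.coneCheck (certBound bitBound)
    (fun F c hF h hPF => ?_) (fun F hF h => ?_)
  · obtain ⟨D, N, yp, yn, zp, zn, h1, h2⟩ := coneCheck_ne_nil F h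
    exact (rcgc_iff_not_sep (F.isNonneg_toReal hF)).1 (hP.1 hPF).2 _ _
      ((h1.sep_iff hF).1 (natSep_iff.1 h2))
  · rw [hP, and_iff_right (F.isNonneg_toReal hF), rcgc_iff_not_sep (F.isNonneg_toReal hF)] at h
    push Not at h
    obtain ⟨y, z, h⟩ := h
    obtain ⟨D, N, h1, h2, h3⟩ := F.exists_scaled
    obtain ⟨yp, yn, zp, zn, h4, h5⟩ := F.exists_sep_cert h3 h2 ((h1.sep_iff hF).2 h)
    exact ⟨_, h5, coneCheck_certTree F h1 h4⟩

/-- The certificates are separating pairs, and vectors in the left kernel whose coefficient sum is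
not zero; for a matrix with equal rows only the scaled matrix matters. -/
theorem inCoNP_polytope : InCoNP (matrixProblem IsPolytopeSlackMatrix) := by
  refine inCoNP_of_check (fun h => (isPolytopeSlackMatrix_iff.1 h).1) PolyTime.polytopeCheck
    (certBound bitBound) (fun {p q} F c hF h hPF => ?_) (fun {p q} F hF h => ?_)
  · obtain ⟨D, N, yp, yn, zp, zn, h1, h2⟩ := polytopeCheck_ne_nil F h
    obtain ⟨-, h3, h4, i, k, j, h5⟩ := isPolytopeSlackMatrix_iff.1 hPF
    have hD : (D : ℝ) ≠ 0 := by exact_mod_cast h1.1.ne'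
    obtain h2 | h2 | h2 := h2
    · exact (rcgc_iff_not_sep (F.isNonneg_toReal hF)).1 h3 _ _ ((h1.sep_iff hF).1 (natSep_iff.1 h2))
    · obtain ⟨h6, h7⟩ := natKer_iff.1 h2
      rw [h1.map_eq hF, vecMul_smul, smul_eq_zero_iff_right hD] at h6
      exact h7 (h4 _ h6)
    · have h6 : ∀ i, (N i j : ℝ) = D * F.toReal i j :=
        fun i => congrFun (congrFun (h1.map_eq hF) i) j
      exact h5 (mul_left_cancel₀ hD (by rw [← h6, ← h6, h2 i k j]))
  · obtain ⟨D, N, h1, h2, h3⟩ := F.exists_scaled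
    have hD : (D : ℝ) ≠ 0 := by exact_mod_cast h1.1.ne'
    rw [isPolytopeSlackMatrix_iff, and_iff_right (F.isNonneg_toReal hF),
      rcgc_iff_not_sep (F.isNonneg_toReal hF)] at h
    by_cases h4 : ∃ y z, Sep F.toReal y z
    · obtain ⟨y, z, h4⟩ := h4
      obtain ⟨yp, yn, zp, zn, h5, h6⟩ := F.exists_sep_cert h3 h2 ((h1.sep_iff hF).2 h4)
      exact ⟨_, h6, polytopeCheck_certTree F h1 (.inl h5)⟩
    by_cases h5 : ∃ y, y ᵥ* F.toReal = 0 ∧ ∑ i, y i ≠ 0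
    · obtain ⟨y, h5, h6⟩ := h5
      obtain ⟨yp, yn, h7, h8⟩ := F.exists_ker_cert h3 h2
        (by rw [h1.map_eq hF, vecMul_smul, h5, smul_zero]) h6
      exact ⟨_, h8, polytopeCheck_certTree F h1 (.inr (.inl h7))⟩
    push Not at h4 h5
    refine ⟨certTree D N 0 0 0 0, ?_, polytopeCheck_certTree F h1 (.inr (.inr ?_))⟩
    · exact size_certTree_le F.rows_le F.cols_le
        (scale_lt (h2.trans (Nat.pow_le_pow_right (by norm_num) (by omega))))
        (fun i j => scale_lt (h3 i j)) (by simp) (by simp) (by simp) (by simp)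
    · have h6 : ∀ i j, (N i j : ℝ) = D * F.toReal i j :=
        fun i j => congrFun (congrFun (h1.map_eq hF) i) j
      intro i k j
      by_contra h7
      refine h ⟨h4, h5, i, k, j, fun h8 => h7 ?_⟩
      have := (h6 i j).trans ((congrArg _ h8).trans (h6 k j).symm)
      exact_mod_cast this

end SlackCoNP

theorem theorem3p1 :
    SlackCoNP.InCoNP (SlackCoNP.matrixProblem fun M =>
      SlackCoNP.IsNonneg M ∧ SlackCoNP.RCGC M) ∧
    SlackCoNP.InCoNP (SlackCoNP.matrixProblem fun M =>
      SlackCoNP.IsNonneg M ∧ SlackCoNP.CCGC M) ∧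
    SlackCoNP.InCoNP (SlackCoNP.matrixProblem fun M => SlackCoNP.IsConeSlackMatrix M) ∧
    SlackCoNP.InCoNP (SlackCoNP.matrixProblem fun M => SlackCoNP.IsPolytopeSlackMatrix M) :=
  ⟨SlackCoNP.inCoNP_rcgc Iff.rfl,
    SlackCoNP.inCoNP_rcgc (and_congr_right fun h => SlackCoNP.ccgc_iff_rcgc h),
    SlackCoNP.inCoNP_rcgc SlackCoNP.isConeSlackMatrix_iff, SlackCoNP.inCoNP_polytope⟩
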